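/- **Setting.** Let $C$, $D$ be triangulated categories and $A$ an abelian category. *Weight structures.* A weight structure $w$ on $C$ is a pair of classes of objects $C^{w\le 0},C^{w\ge 0}$, closed under finite direct sums and retracts, with $C^{w\le 0}[1]\subset C^{w\le 0}$, $C^{w\ge 0}[-1]\subset C^{w\ge 0}$, $\mathrm{Hom}(X,Y[1])=0$ for $X\in C^{w\ge 0}$, $Y\in C^{w\le 0}$, and such that every $X$ lies in a distinguished triangle $X\to A'\to B'\to X[1]$ with $A'\in C^{w\le 0}$, $B'\in C^{w\ge 0}$. Put $C^{w\le n}=C^{w\le 0}[-n]$, $C^{w\ge n}=C^{w\ge 0}[-n]$; $X$ is bounded if it lies in some $C^{w\le n}$ and in some $C^{w\ge n'}$. A weight Postnikov tower $\mathcal T$ of $X$ consists of morphisms $Y_i\to Y_{i+1}$ and compatible morphisms $Y_i\to X$ ($i\in\mathbb Z$) with $Y_i\in C^{w\ge 1-i}$ and $\mathrm{Cone}(Y_i\to X)\in C^{w\le -i}$, together with distinguished triangles $Y_i\to Y_{i+1}\to X_i\to Y_i[1]$. Its weight complex has the terms $X^p=X_{-p}[p]$ and the differentials induced by $X_{-p}\to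 Y_{-p}[1]\to X_{-p-1}[1]$. A morphism of towers over $g:X\to X'$ is a family of morphisms $Y_i\to Y_i'$, $X_i\to X_i'$ commuting with all these data and with $g$. *Dualities.* A duality is a functor $\Phi:C^{op}\times D\to A$, homological in each argument (hence bi-additive), together with a binatural isomorphism $\sigma:\Phi(X,Y)\cong\Phi(X[1],Y[1])$. Iterating $\sigma$ one identifies $\Phi(X[-m],Y)$ with $\Phi(X,Y[m])$ for $m\in\mathbb Z$. A weight structure $w$ on $C$ and a $t$-structure $t$ on $D$ are orthogonal with respect to $\Phi$ if $\Phi(X,Y)=0$ whenever $X\in C^{w\le 0}$, $Y\in D^{t\ge 1}$, or $X\in C^{w\ge 0}$, $Y\in D^{t\le -1}$. The duality is nice if for all distinguished triangles $S_1\xrightarrow{l}S_2\xrightarrow{m}S_3\xrightarrow{n}S_1[1]$ in $C$ and $T_1\xrightarrow{f}T_2\xrightarrow{g}T_3\xrightarrow{h}T_1[1]$ in $D$ the projection $(a,b,c)\mapsto (a,b)$ is an epimorphism from the kernel of $$\Phi(S_1,T_1)\oplus\Phi(S_2,T_2)\oplus\Phi(S_3,T_3)\to\Phi(S_1,T_2)\oplus\Phi(S_2,T_3)\oplus\Phi(S_3[-1],T_1),\qquad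 (a,b,c)\mapsto (f_*a-l^*b,\ g_*b-m^*c,\ h_*c-n[-1]^*a)$$ onto the kernel of $(a,b)\mapsto f_*a-l^*b$, where $h_*c\in\Phi(S_3,T_1[1])$ is considered as an element of $\Phi(S_3[-1],T_1)$ by means of $\sigma$. *Spectral sequences.* For $Y\in D$ write $t_{\ge q}Y$, $t_{\le q}Y$ for the truncations and $t_{=q}Y=t_{\ge q}t_{\le q}Y$. For a tower $\mathcal T$ of $X$ and $H=\Phi(-,Y)$, $H^m=H(-[-m])$, let $T=T(\mathcal T,Y)$ be the spectral sequence of the exact couple $D_1^{pq}=H(Y_p[1-p-q])$, $E_1^{pq}=H(X_p[-p-q])=H^q(X^{-p})$, obtained by applying $H$ to the shifts of the distinguished triangles of $\mathcal T$; let $F^pH^m(X)=\ker(H(X[-m])\to H(Y_p[-m]))$. Let $S=S(X,Y)$ be the spectral sequence, starting from $E_2$, of the exact couple $D_2^{pq}=\Phi(X,(t_{\ge q}Y)[p+q-1])$, $E_2^{pq}=\Phi(X,(t_{=q}Y)[p+q])$ given by the distinguished triangles $t_{=q}Y\to t_{\ge q}Y\to t_{\ge q+1}Y\to (t_{=q}Y)[1]$;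 let $F^p\Phi(X,Y[m])=\ker(\Phi(X,Y[m])\to\Phi(X,(t_{\ge m+1-p}Y)[m]))$. In both cases we say that $y\in E_r^{pq}$ represents an element $x$ of the abutment in degree $p+q$ if $x$ and $y$ have the same image in the $D$-term of index $p+1$ of the original couple (for $y$, under the map induced by $E\to D$); here elements are generalized ones, i.e. morphisms from arbitrary objects of $A$. **Theorem.** Let $w$ and $t$ be orthogonal with respect to $\Phi$. 0. Every object of $C$ has a weight Postnikov tower, and for arbitrary towers of $X$ and $X'$ every $g:X\to X'$ extends to a morphism of towers. 1. If $X$ is bounded, then $S(X,Y)$ converges to $\Phi(X,Y[p+q])$, naturally in $X$ and $Y$: the filtration $F^\bullet$ is finite in each degree, there is $r_1$ such that all differentials $d_r$ vanish for $r\ge r_1$, and for these $r$ there are epimorphisms $F^p\Phi(X,Y[p+q])\to E_r^{pq}(S)$ with kernel $F^{p+1}\Phi(X,Y[p+q])$, which are compatible with the identifications of $E_{r+1}$ with the cohomology of $E_r$, send each element to one which represents it, and are natural in $X$ and $Y$. 2. For all $r\ge 2$, $p,q$, all $X$, $Y$ and all weight Postnikov towers $\mathcal T$ of $X$ there are isomorphisms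 $e:E_r^{pq}(T(\mathcal T,Y))\cong E_r^{pq}(S(X,Y))$, natural with respect to morphisms of towers over morphisms $X\to X'$ and to morphisms $Y\to Y'$. Moreover, for all $k,m$, $$F^{-k}H^m(X)=\mathrm{Im}(\Phi(X,t_{\le k}(Y[m]))\to\Phi(X,Y[m])\cong H^m(X)),$$ the filtration $F^{-k}\Phi(X,Y[m])$ is the image of $\Phi(X,t_{\le k}(Y[m]))$ too, and the isomorphisms $e$ are compatible with this: $y\in E_r^{pq}(T)$ represents $x\in H^{p+q}(X)$ if and only if $e(y)$ represents the image of $x$ in $\Phi(X,Y[p+q])$. 3. If $\Phi$ is nice, then for all $X$, $\mathcal T$, $Y$ these isomorphisms $e$ ($r\ge 2$) are the components of an isomorphism of spectral sequences $T(\mathcal T,Y)\cong S(X,Y)$ starting from $E_2$. 4. For every $i,j\in\mathbb Z$, every $Y$ and the weight complex $(X^p)$ of any weight Postnikov tower of $X$ there is an isomorphism $$\Phi(X,(t_{=i}Y)[i][j])\cong\frac{\ker(\Phi(X^{-j},Y[i])\to\Phi(X^{-1-j},Y[i]))}{\mathrm{Im}(\Phi(X^{1-j},Y[i])\to\Phi(X^{-j},Y[i]))},$$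 natural with respect to morphisms of towers over morphisms $X\to X'$ and to morphisms $Y\to Y'$. -/

import Mathlib

open CategoryTheory Category Limits Opposite

noncomputable section

set_option linter.unusedSectionVars false

namespace WeightDuality

universe v u

/-- A bigraded exact couple with cohomological conventions, starting at the page `s`.
With the usual bidegrees `(p, q)`, the object `E p n` is `E^{p,n-p}` and the object `D p m` is
`D^{p,m+1-p}`. Thus `i`, `j`, `k` have the bidegrees `(-1,1)`, `(s-1,1-s)`, `(1,0)`, and
the differential `k ≫ j` of the page `s` has bidegree `(s,1-s)`. -/
structure ExactCouple (A : Type u) [Category.{v} A] [Abelian A] (s : ℕ) where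
  D : ℤ → ℤ → A
  E : ℤ → ℤ → A
  i (p p' m : ℤ) (h : p' + 1 = p) : D p m ⟶ D p' m
  j (p p' m n : ℤ) (hp : p' + 1 = p + s) (hn : m + 1 = n) : D p m ⟶ E p' n
  k (p p' n : ℤ) (h : p + 1 = p') : E p n ⟶ D p' n
  i_j (p p' p'' m n : ℤ) (h : p' + 1 = p) (hp : p'' + 1 = p' + s) (hn : m + 1 = n) :
    i p p' m h ≫ j p' p'' m n hp hn = 0
  j_k (p p' p'' m n : ℤ) (hp : p' + 1 = p + s) (hn : m + 1 = n) (h : p' + 1 = p'') :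
    j p p' m n hp hn ≫ k p' p'' n h = 0
  k_i (p p' n : ℤ) (h : p + 1 = p') : k p p' n h ≫ i p' p n h = 0
  exact_i_j (p p' p'' m n : ℤ) (h : p' + 1 = p) (hp : p'' + 1 = p' + s) (hn : m + 1 = n) :
    (ShortComplex.mk _ _ (i_j p p' p'' m n h hp hn)).Exact
  exact_j_k (p p' p'' m n : ℤ) (hp : p' + 1 = p + s) (hn : m + 1 = n) (h : p' + 1 = p'') :
    (ShortComplex.mk _ _ (j_k p p' p'' m n hp hn h)).Exact
  exact_k_i (p p' n : ℤ) (h : p + 1 = p') :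
    (ShortComplex.mk _ _ (k_i p p' n h)).Exact

namespace ExactCouple

variable {A : Type u} [Category.{v} A] [Abelian A] {s : ℕ}

/-- A morphism of exact couples. -/
structure Hom (c c' : ExactCouple A s) where
  D (p m : ℤ) : c.D p m ⟶ c'.D p m
  E (p n : ℤ) : c.E p n ⟶ c'.E p n
  comm_i (p p' m : ℤ) (h : p' + 1 = p) : c.i p p' m h ≫ D p' m = D p m ≫ c'.i p p' m h
  comm_j (p p' m n : ℤ) (hp : p' + 1 = p + s) (hn : m + 1 = n) :
    c.j p p' m n hp hn ≫ E p' n = D p m ≫ c'.j p p' m n hp hn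
  comm_k (p p' n : ℤ) (h : p + 1 = p') : c.k p p' n h ≫ D p' n = E p n ≫ c'.k p p' n h

section derived

variable (c : ExactCouple A s)

/-- The differential `k ≫ j` of the first page of the exact couple. -/
def d (p p' n n' : ℤ) (hp : p + s = p') (hn : n + 1 = n') : c.E p n ⟶ c.E p' n' :=
  c.k p (p + 1) n rfl ≫ c.j (p + 1) p' n n' (by lia) hn

lemma k_j (p p' p'' n n' : ℤ) (h : p + 1 = p') (hp : p'' + 1 = p' + s) (hn : n + 1 = n') :
    c.k p p' n h ≫ c.j p' p'' n n' hp hn = c.d p p'' n n' (by lia) hn := by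
  subst h; rfl

lemma j_d (p p' p'' m n n' : ℤ) (hp : p' + 1 = p + s) (hn : m + 1 = n) (hp' : p' + s = p'')
    (hn' : n + 1 = n') : c.j p p' m n hp hn ≫ c.d p' p'' n n' hp' hn' = 0 := by
  rw [d, ← assoc, c.j_k, zero_comp]

lemma d_d (p p' p'' n n' n'' : ℤ) (hp : p + s = p') (hp' : p' + s = p'') (hn : n + 1 = n')
    (hn' : n' + 1 = n'') : c.d p p' n n' hp hn ≫ c.d p' p'' n' n'' hp' hn' = 0 := by
  rw [d, assoc, j_d, comp_zero]

/-- The short complex formed by two consecutive differentials. -/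
abbrev sc (p₀ p p₁ n₀ n n₁ : ℤ) (h₀ : p₀ + s = p) (h₁ : p + s = p₁) (hn₀ : n₀ + 1 = n)
    (hn₁ : n + 1 = n₁) : ShortComplex A :=
  ShortComplex.mk _ _ (c.d_d p₀ p p₁ n₀ n n₁ h₀ h₁ hn₀ hn₁)

/-- The short complex whose homology is the next page in the position of `E p n`. -/
abbrev scAt (p n : ℤ) : ShortComplex A :=
  c.sc (p - s) p (p + s) (n - 1) n (n + 1) (by lia) rfl (by lia) rfl

/-- The `D`-terms of the derived couple: the images of the maps `i`. -/
def D' (p m : ℤ) : A := image (c.i (p + 1) p m rfl)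

/-- The inclusion of the `D`-terms of the derived couple. -/
def ι (p m : ℤ) : c.D' p m ⟶ c.D p m := image.ι _

instance (p m : ℤ) : Mono (c.ι p m) := inferInstanceAs (Mono (image.ι _))

/-- The projection to the `D`-terms of the derived couple. -/
def ε (p m : ℤ) : c.D (p + 1) m ⟶ c.D' p m := factorThruImage _

instance (p m : ℤ) : Epi (c.ε p m) := inferInstanceAs (Epi (factorThruImage _))

lemma ε_ι (p m : ℤ) : c.ε p m ≫ c.ι p m = c.i (p + 1) p m rfl := image.fac _

lemma ι_j (p p' m n : ℤ) (hp : p' + 1 = p + s) (hn : m + 1 = n) :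
    c.ι p m ≫ c.j p p' m n hp hn = 0 := by
  rw [← cancel_epi (c.ε p m), ← assoc, ε_ι, i_j, comp_zero]

lemma exact_ι_j (p p' m n : ℤ) (hp : p' + 1 = p + s) (hn : m + 1 = n) :
    (ShortComplex.mk _ _ (c.ι_j p p' m n hp hn)).Exact := by
  have := c.exact_i_j (p + 1) p p' m n rfl hp hn
  rw [ShortComplex.exact_iff_exact_up_to_refinements] at this ⊢
  intro Z x hx
  obtain ⟨Z', π, hπ, y, hy⟩ := this x hx
  exact ⟨Z', π, hπ, y ≫ c.ε p m, by simpa [ε_ι] using hy⟩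

lemma k_ε (p m : ℤ) : c.k p (p + 1) m rfl ≫ c.ε p m = 0 := by
  rw [← cancel_mono (c.ι p m), assoc, ε_ι, k_i, zero_comp]

lemma exact_k_ε (p m : ℤ) : (ShortComplex.mk _ _ (c.k_ε p m)).Exact := by
  have := c.exact_k_i p (p + 1) m rfl
  rw [ShortComplex.exact_iff_exact_up_to_refinements] at this ⊢
  intro Z x hx
  exact this x (by dsimp at hx ⊢; simp only [← ε_ι, ← assoc, hx, zero_comp])

/-- Lifting to the `D`-terms of the derived couple of a map which is killed by `j`. -/
def liftι {Z : A} {p m : ℤ} (x : Z ⟶ c.D p m)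
    (hx : x ≫ c.j p (p + s - 1) m (m + 1) (by lia) rfl = 0) : Z ⟶ c.D' p m :=
  (c.exact_ι_j p (p + s - 1) m (m + 1) (by lia) rfl).lift x hx

lemma liftι_ι {Z : A} {p m : ℤ} (x : Z ⟶ c.D p m)
    (hx : x ≫ c.j p (p + s - 1) m (m + 1) (by lia) rfl = 0) : c.liftι x hx ≫ c.ι p m = x :=
  (c.exact_ι_j p (p + s - 1) m (m + 1) (by lia) rfl).lift_f x hx

/-- The map `i` of the derived couple, the restriction of `i`. -/
def i' (p p' m : ℤ) (h : p' + 1 = p) : c.D' p m ⟶ c.D' p' m :=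
  c.liftι (c.ι p m ≫ c.i p p' m h)
    (by rw [assoc, i_j, comp_zero])

lemma i'_ι (p p' m : ℤ) (h : p' + 1 = p) :
    c.i' p p' m h ≫ c.ι p' m = c.ι p m ≫ c.i p p' m h :=
  c.liftι_ι _ _

lemma ε_i' (p m : ℤ) :
    c.ε (p + 1) m ≫ c.i' (p + 1) p m rfl = c.i (p + 1 + 1) (p + 1) m rfl ≫ c.ε p m := by
  rw [← cancel_mono (c.ι p m), assoc, assoc, i'_ι, ← assoc, ε_ι, ε_ι]

lemma k_liftCycles (p p' m n : ℤ) (hp : p' = p + s) (hn : m + 1 = n) :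
    c.k p (p + 1) m rfl ≫ (c.scAt p' n).liftCycles (c.j (p + 1) p' m n (by lia) hn)
      (c.j_d _ _ _ _ _ _ _ _ rfl rfl) ≫ (c.scAt p' n).homologyπ = 0 := by
  obtain rfl : p = p' - s := by lia
  obtain rfl : m = n - 1 := by lia
  have : c.k (p' - s) (p' - s + 1) (n - 1) rfl ≫
      (c.scAt p' n).liftCycles (c.j (p' - s + 1) p' (n - 1) n (by lia) hn)
      (c.j_d _ _ _ _ _ _ _ _ rfl rfl) = (c.scAt p' n).toCycles := by
    rw [← cancel_mono (c.scAt p' n).iCycles, assoc, ShortComplex.liftCycles_i,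
      ShortComplex.toCycles_i, k_j]
  rw [← assoc, this, ShortComplex.toCycles_comp_homologyπ]

/-- The map `j` of the derived couple: `j` applied to a preimage under `i`. -/
def j' (p p' m n : ℤ) (hp : p' + 1 = p + (s + 1 : ℕ)) (hn : m + 1 = n) :
    c.D' p m ⟶ (c.scAt p' n).homology :=
  (c.exact_k_ε p m).desc
    ((c.scAt p' n).liftCycles (c.j (p + 1) p' m n (by lia) hn)
      (c.j_d _ _ _ _ _ _ _ _ rfl rfl) ≫ (c.scAt p' n).homologyπ)
    (c.k_liftCycles p p' m n (by lia) hn)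

lemma ε_j' (p p' m n : ℤ) (hp : p' + 1 = p + (s + 1 : ℕ)) (hn : m + 1 = n) :
    c.ε p m ≫ c.j' p p' m n hp hn =
      (c.scAt p' n).liftCycles (c.j (p + 1) p' m n (by lia) hn)
        (c.j_d _ _ _ _ _ _ _ _ rfl rfl) ≫ (c.scAt p' n).homologyπ :=
  (c.exact_k_ε p m).g_desc _ _

/-- The map from the homology at `E p n` to `D p' n` induced by `k`. -/
def kD (p p' n : ℤ) (h : p + 1 = p') : (c.scAt p n).homology ⟶ c.D p' n :=
  (c.scAt p n).descHomology ((c.scAt p n).iCycles ≫ c.k p p' n h) (by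
    rw [ShortComplex.toCycles_i_assoc]
    dsimp only
    rw [d, assoc, j_k, comp_zero])

lemma π_kD (p p' n : ℤ) (h : p + 1 = p') :
    (c.scAt p n).homologyπ ≫ c.kD p p' n h = (c.scAt p n).iCycles ≫ c.k p p' n h :=
  ShortComplex.π_descHomology _ _ _

lemma kD_j (p p' p'' n n' : ℤ) (h : p + 1 = p') (hp : p'' + 1 = p' + s) (hn : n + 1 = n') :
    c.kD p p' n h ≫ c.j p' p'' n n' hp hn = 0 := by
  subst hn
  obtain rfl : p'' = p + s := by lia
  rw [← cancel_epi (c.scAt p n).homologyπ, ← assoc, π_kD, assoc, k_j, comp_zero]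
  exact (c.scAt p n).iCycles_g

/-- The map `k` of the derived couple, induced by `k`. -/
def k' (p p' n : ℤ) (h : p + 1 = p') : (c.scAt p n).homology ⟶ c.D' p' n :=
  c.liftι (c.kD p p' n h) (c.kD_j _ _ _ _ _ h (by lia) rfl)

lemma k'_ι (p p' n : ℤ) (h : p + 1 = p') : c.k' p p' n h ≫ c.ι p' n = c.kD p p' n h :=
  c.liftι_ι _ _

lemma i'_j' (p p' p'' m n : ℤ) (h : p' + 1 = p) (hp : p'' + 1 = p' + (s + 1 : ℕ))
    (hn : m + 1 = n) : c.i' p p' m h ≫ c.j' p' p'' m n hp hn = 0 := by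
  subst h
  rw [← cancel_epi (c.ε (p' + 1) m), ← assoc, ε_i', assoc, ε_j', comp_zero, ← assoc]
  have : c.i (p' + 1 + 1) (p' + 1) m rfl ≫ (c.scAt p'' n).liftCycles
      (c.j (p' + 1) p'' m n (by lia) hn) (c.j_d _ _ _ _ _ _ _ _ rfl rfl) = 0 := by
    rw [← cancel_mono (c.scAt p'' n).iCycles, assoc, ShortComplex.liftCycles_i, i_j, zero_comp]
  rw [this, zero_comp]

lemma j'_k' (p p' p'' m n : ℤ) (hp : p' + 1 = p + (s + 1 : ℕ)) (hn : m + 1 = n)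
    (h : p' + 1 = p'') : c.j' p p' m n hp hn ≫ c.k' p' p'' n h = 0 := by
  rw [← cancel_epi (c.ε p m), ← cancel_mono (c.ι p'' n), ← assoc, ε_j', assoc, assoc, k'_ι, π_kD,
    ← assoc, ShortComplex.liftCycles_i, j_k, comp_zero, zero_comp]

lemma k'_i' (p p' n : ℤ) (h : p + 1 = p') : c.k' p p' n h ≫ c.i' p' p n h = 0 := by
  rw [← cancel_mono (c.ι p n), assoc, i'_ι, ← assoc, k'_ι,
    ← cancel_epi (c.scAt p n).homologyπ, ← assoc, ← assoc, π_kD, assoc, k_i, comp_zero,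
    comp_zero, zero_comp]

lemma exact_i'_j' (p p' p'' m n : ℤ) (h : p' + 1 = p) (hp : p'' + 1 = p' + (s + 1 : ℕ))
    (hn : m + 1 = n) : (ShortComplex.mk _ _ (c.i'_j' p p' p'' m n h hp hn)).Exact := by
  subst h
  rw [ShortComplex.exact_iff_exact_up_to_refinements]
  intro Z x hx
  dsimp at x hx
  obtain ⟨Z₁, π₁, hπ₁, y, hy⟩ := surjective_up_to_refinements_of_epi (c.ε p' m) x
  have hy' : (y ≫ (c.scAt p'' n).liftCycles (c.j (p' + 1) p'' m n (by lia) hn)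
      (c.j_d _ _ _ _ _ _ _ _ rfl rfl)) ≫ (c.scAt p'' n).homologyπ = 0 := by
    rw [assoc, ← c.ε_j' p' p'' m n hp hn, ← assoc, ← hy, assoc, hx, comp_zero]
  rw [ShortComplex.comp_homologyπ_eq_zero_iff_up_to_refinements] at hy'
  obtain ⟨Z₂, π₂, hπ₂, z, hz⟩ := hy'
  obtain rfl : p' = p'' - s := by lia
  obtain rfl : m = n - 1 := by lia
  have hz' : π₂ ≫ y ≫ c.j (p'' - s + 1) p'' (n - 1) n (by lia) hn =
      z ≫ c.k (p'' - s) (p'' - s + 1) (n - 1) rfl ≫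
        c.j (p'' - s + 1) p'' (n - 1) n (by lia) hn := by
    have := congrArg (fun f => f ≫ (c.scAt p'' n).iCycles) hz
    simp only [assoc, ShortComplex.liftCycles_i, ShortComplex.toCycles_i] at this
    rw [k_j]
    exact this
  obtain ⟨Z₃, π₃, hπ₃, t, ht⟩ :=
    (c.exact_i_j (p'' - s + 1 + 1) (p'' - s + 1) p'' (n - 1) n rfl (by lia)
      hn).exact_up_to_refinements (π₂ ≫ y - z ≫ c.k (p'' - s) (p'' - s + 1) (n - 1) rfl)
      (by dsimp; rw [Preadditive.sub_comp, assoc, assoc, hz', sub_self])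
  dsimp at ht
  refine ⟨Z₃, π₃ ≫ π₂ ≫ π₁, inferInstance, t ≫ c.ε _ _, ?_⟩
  dsimp
  rw [assoc t, ε_i', ← assoc t, ← ht, assoc, assoc, hy, assoc, Preadditive.sub_comp, assoc, assoc,
    k_ε, comp_zero, sub_zero]

lemma exact_j'_k' (p p' p'' m n : ℤ) (hp : p' + 1 = p + (s + 1 : ℕ)) (hn : m + 1 = n)
    (h : p' + 1 = p'') : (ShortComplex.mk _ _ (c.j'_k' p p' p'' m n hp hn h)).Exact := by
  rw [ShortComplex.exact_iff_exact_up_to_refinements]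
  intro Z x hx
  dsimp at x hx
  obtain ⟨Z₁, π₁, hπ₁, y, hy⟩ :=
    surjective_up_to_refinements_of_epi (c.scAt p' n).homologyπ x
  obtain ⟨Z₂, π₂, hπ₂, z, hz⟩ :=
    (c.exact_j_k (p + 1) p' p'' m n (by lia) hn h).exact_up_to_refinements
      (y ≫ (c.scAt p' n).iCycles) (by
        dsimp
        rw [assoc, ← π_kD, ← k'_ι, ← assoc, ← hy, assoc, ← assoc x, hx, zero_comp, comp_zero])
  dsimp at hz
  refine ⟨Z₂, π₂ ≫ π₁, inferInstance, z ≫ c.ε _ _, ?_⟩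
  dsimp
  rw [assoc, assoc, ε_j', hy, ← assoc, ← assoc]
  congr 1
  rw [← cancel_mono (c.scAt p' n).iCycles, assoc, assoc, ShortComplex.liftCycles_i, hz]

lemma exact_k'_i' (p p' n : ℤ) (h : p + 1 = p') :
    (ShortComplex.mk _ _ (c.k'_i' p p' n h)).Exact := by
  rw [ShortComplex.exact_iff_exact_up_to_refinements]
  intro Z x hx
  dsimp at x hx
  obtain ⟨Z₁, π₁, hπ₁, y, hy⟩ := (c.exact_k_i p p' n h).exact_up_to_refinements
      (x ≫ c.ι p' n) (by dsimp; rw [assoc, ← i'_ι, ← assoc, hx, zero_comp])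
  dsimp at hy
  have hy' : y ≫ (c.scAt p n).g = 0 := by
    dsimp only
    rw [← c.k_j p p' (p + s) n _ h (by lia) rfl, ← assoc, ← hy, assoc, assoc, ι_j, comp_zero,
      comp_zero]
  refine ⟨Z₁, π₁, inferInstance,
    (c.scAt p n).liftCycles y hy' ≫ (c.scAt p n).homologyπ, ?_⟩
  dsimp
  rw [← cancel_mono (c.ι p' n), assoc, assoc, assoc, k'_ι, π_kD, ← assoc _ _ (c.k _ _ _ _),
    ShortComplex.liftCycles_i, hy]

/-- The derived exact couple. -/
def derived : ExactCouple A (s + 1) where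
  D := c.D'
  E p n := (c.scAt p n).homology
  i := c.i'
  j := c.j'
  k := c.k'
  i_j := c.i'_j'
  j_k := c.j'_k'
  k_i := c.k'_i'
  exact_i_j := c.exact_i'_j'
  exact_j_k := c.exact_j'_k'
  exact_k_i := c.exact_k'_i'

/-- The `a`-th derived couple. -/
def iter : (a : ℕ) → ExactCouple A (s + a)
  | 0 => c
  | a + 1 => (iter a).derived

/-- The inclusion of the `D`-terms of the `a`-th derived couple into the original ones. -/
def iterι (p m : ℤ) : (a : ℕ) → ((c.iter a).D p m ⟶ c.D p m)
  | 0 => 𝟙 _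
  | a + 1 => (c.iter a).ι p m ≫ iterι p m a

end derived

namespace Hom

variable {c c' : ExactCouple A s} (f : Hom c c')

lemma comm_d (p p' n n' : ℤ) (hp : p + s = p') (hn : n + 1 = n') :
    c.d p p' n n' hp hn ≫ f.E p' n' = f.E p n ≫ c'.d p p' n n' hp hn := by
  rw [d, d, assoc, f.comm_j, ← assoc, f.comm_k, assoc]

/-- The map between the short complexes of two consecutive differentials. -/
def sc (p₀ p p₁ n₀ n n₁ : ℤ) (h₀ : p₀ + s = p) (h₁ : p + s = p₁) (hn₀ : n₀ + 1 = n)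
    (hn₁ : n + 1 = n₁) :
    c.sc p₀ p p₁ n₀ n n₁ h₀ h₁ hn₀ hn₁ ⟶ c'.sc p₀ p p₁ n₀ n n₁ h₀ h₁ hn₀ hn₁ where
  τ₁ := f.E _ _
  τ₂ := f.E _ _
  τ₃ := f.E _ _
  comm₁₂ := (f.comm_d _ _ _ _ (by assumption) (by assumption)).symm
  comm₂₃ := (f.comm_d _ _ _ _ (by assumption) (by assumption)).symm

/-- The map between the short complexes whose homologies form the next page. -/
abbrev scAt (p n : ℤ) : c.scAt p n ⟶ c'.scAt p n :=
  f.sc (p - s) p (p + s) (n - 1) n (n + 1) (by lia) rfl (by lia) rfl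

/-- The map between the `D`-terms of the derived couples. -/
def D' (p m : ℤ) : c.D' p m ⟶ c'.D' p m :=
  c'.liftι (c.ι p m ≫ f.D p m)
    (by rw [assoc, ← f.comm_j, ← assoc, ι_j, zero_comp])

lemma D'_ι (p m : ℤ) : f.D' p m ≫ c'.ι p m = c.ι p m ≫ f.D p m :=
  c'.liftι_ι _ _

lemma ε_D' (p m : ℤ) : c.ε p m ≫ f.D' p m = f.D (p + 1) m ≫ c'.ε p m := by
  rw [← cancel_mono (c'.ι p m), assoc, assoc, D'_ι, ε_ι, ← assoc, ε_ι, f.comm_i]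

/-- The morphism induced on the derived couples. -/
def derived : Hom c.derived c'.derived where
  D := f.D'
  E p n := ShortComplex.homologyMap (f.scAt p n)
  comm_i p p' m h := by
    change c.i' p p' m h ≫ _ = _ ≫ c'.i' p p' m h
    rw [← cancel_mono (c'.ι p' m), assoc, assoc, D'_ι, i'_ι, ← assoc, i'_ι, ← assoc, D'_ι,
      assoc, assoc, f.comm_i]
  comm_j p p' m n hp hn := by
    change c.j' p p' m n hp hn ≫ _ = _ ≫ c'.j' p p' m n hp hn
    rw [← cancel_epi (c.ε p m), ← assoc, ← assoc, ε_D', ε_j', assoc, assoc, ε_j',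
      ShortComplex.homologyπ_naturality, ← assoc, ← assoc]
    congr 1
    rw [← cancel_mono (c'.scAt p' n).iCycles, assoc, assoc, ShortComplex.liftCycles_i,
      ShortComplex.cyclesMap_i, ← assoc, ShortComplex.liftCycles_i]
    exact f.comm_j _ _ _ _ (by lia) hn
  comm_k p p' n h := by
    change c.k' p p' n h ≫ _ = _ ≫ c'.k' p p' n h
    rw [← cancel_mono (c'.ι p' n), assoc, assoc, D'_ι, k'_ι, ← assoc, k'_ι,
      ← cancel_epi (c.scAt p n).homologyπ, ← assoc, π_kD,
      ShortComplex.homologyπ_naturality_assoc, π_kD, ShortComplex.cyclesMap_i_assoc, assoc,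
      f.comm_k]
    rfl

/-- The morphism induced on the `a`-th derived couples. -/
def iter : (a : ℕ) → Hom (c.iter a) (c'.iter a)
  | 0 => f
  | a + 1 => (iter a).derived

end Hom

section spectralSequence

variable (c : ExactCouple A s)

/-- The page `(E, k ≫ j)` of an exact couple, indexed by the usual bidegrees `(p, q)`. -/
def page (r : ℤ) (hr : (s : ℤ) = r) :
    HomologicalComplex A (ComplexShape.up' (⟨r, 1 - r⟩ : ℤ × ℤ)) where
  X a := c.E a.1 (a.1 + a.2)
  d a b :=
    if h : a.1 + r = b.1 ∧ a.2 + (1 - r) = b.2 then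
      c.d a.1 b.1 (a.1 + a.2) (b.1 + b.2) (by lia) (by lia)
    else 0
  shape a b h := by
    rw [dif_neg]
    rintro ⟨h₁, h₂⟩
    exact h (Prod.ext h₁ h₂)
  d_comp_d' a b b' _ _ := by
    split_ifs
    · exact c.d_d _ _ _ _ _ _ _ _ _ _
    all_goals simp

lemma page_d (r : ℤ) (hr : (s : ℤ) = r) (a b : ℤ × ℤ) (h : a + (r, 1 - r) = b) :
    (c.page r hr).d a b = c.d a.1 b.1 (a.1 + a.2) (b.1 + b.2)
      (by subst h; simp [hr]) (by subst h; simp; lia) :=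
  dif_pos ⟨congrArg Prod.fst h, congrArg Prod.snd h⟩

/-- The short complexes of two consecutive differentials do not depend on the way in which
the outer indices are written. -/
def scIso (p₀ p p₁ n₀ n n₁ : ℤ) (h₀ : p₀ + s = p) (h₁ : p + s = p₁) (hn₀ : n₀ + 1 = n)
    (hn₁ : n + 1 = n₁) : c.sc p₀ p p₁ n₀ n n₁ h₀ h₁ hn₀ hn₁ ≅ c.scAt p n :=
  eqToIso (by
    obtain rfl : p₀ = p - s := by lia
    obtain rfl : n₀ = n - 1 := by lia
    subst h₁ hn₁
    rfl)

/-- The short complex of a page in degree `a`, in terms of the differentials of the couple. -/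
def pageSc'Iso (r : ℤ) (hr : (s : ℤ) = r) (a : ℤ × ℤ) :
    (c.page r hr).sc' (a - (r, 1 - r)) a (a + (r, 1 - r)) ≅
      c.sc (a - (r, 1 - r)).1 a.1 (a + (r, 1 - r)).1
        ((a - (r, 1 - r)).1 + (a - (r, 1 - r)).2) (a.1 + a.2)
        ((a + (r, 1 - r)).1 + (a + (r, 1 - r)).2)
        (by simp; lia) (by simp; lia) (by simp; lia) (by simp; lia) :=
  ShortComplex.isoMk (Iso.refl (c.E (a - (r, 1 - r)).1 _)) (Iso.refl (c.E a.1 _))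
    (Iso.refl (c.E (a + (r, 1 - r)).1 _))
    ((id_comp _).trans ((c.page_d r hr (a - (r, 1 - r)) a (by simp)).symm.trans (comp_id _).symm))
    ((id_comp _).trans ((c.page_d r hr a (a + (r, 1 - r)) rfl).symm.trans (comp_id _).symm))

/-- The short complex of a page in degree `a`. -/
def pageScIso (r : ℤ) (hr : (s : ℤ) = r) (a : ℤ × ℤ) :
    (c.page r hr).sc a ≅ c.scAt a.1 (a.1 + a.2) :=
  (c.page r hr).isoSc' (a - (r, 1 - r)) a (a + (r, 1 - r))
    (ComplexShape.prev_eq' _ (by simp)) (ComplexShape.next_eq' _ (by simp)) ≪≫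
  c.pageSc'Iso r hr a ≪≫ c.scIso _ _ _ _ _ _ _ _ _ _

/-- The homology of a page is the underlying object of the page of the derived couple. -/
def pageHomologyIso (r r' : ℤ) (hr : (s : ℤ) = r) (hr' : ((s + 1 : ℕ) : ℤ) = r') (a : ℤ × ℤ) :
    (c.page r hr).homology a ≅ (c.derived.page r' hr').X a :=
  ShortComplex.homologyMapIso (c.pageScIso r hr a)

/-- Two numbers of derivations which are equal give the same couple. -/
def iterIso {a b : ℕ} (h : a = b) (p n : ℤ) : (c.iter a).E p n ≅ (c.iter b).E p n :=
  eqToIso (by rw [h])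

/-- The spectral sequence of an exact couple, considered from the page `r₀` on: the page `r` is
given by the `(r - s)`-th derived couple. -/
def spectralSequence (r₀ : ℤ) (h₀ : (s : ℤ) ≤ r₀) : CohomologicalSpectralSequence A r₀ where
  page r hr := (c.iter (r - s).toNat).page r (by lia)
  iso r r' a h hr :=
    (c.iter (r - s).toNat).pageHomologyIso r r' (by lia) (by lia) a ≪≫
      c.iterIso (a := (r - s).toNat + 1) (b := (r' - s).toNat) (by lia) _ _

end spectralSequence

namespace Hom

variable {c c' : ExactCouple A s} (f : Hom c c')

/-- The map induced on pages. -/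
def page (r : ℤ) (hr : (s : ℤ) = r) : c.page r hr ⟶ c'.page r hr where
  f a := f.E a.1 (a.1 + a.2)
  comm' a b h := by
    rw [c.page_d _ _ _ _ h, c'.page_d _ _ _ _ h]
    exact (f.comm_d _ _ _ _ _ _).symm

lemma scIso_naturality (p₀ p p₁ n₀ n n₁ : ℤ) (h₀ : p₀ + s = p) (h₁ : p + s = p₁)
    (hn₀ : n₀ + 1 = n) (hn₁ : n + 1 = n₁) :
    (c.scIso p₀ p p₁ n₀ n n₁ h₀ h₁ hn₀ hn₁).hom ≫ f.scAt p n =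
      f.sc p₀ p p₁ n₀ n n₁ h₀ h₁ hn₀ hn₁ ≫ (c'.scIso p₀ p p₁ n₀ n n₁ h₀ h₁ hn₀ hn₁).hom := by
  obtain rfl : p₀ = p - s := by lia
  obtain rfl : n₀ = n - 1 := by lia
  subst h₁ hn₁
  simp [scIso]

lemma pageSc'Iso_naturality (r : ℤ) (hr : (s : ℤ) = r) (a : ℤ × ℤ) :
    (HomologicalComplex.shortComplexFunctor' A _ (a - (r, 1 - r)) a (a + (r, 1 - r))).map
      (f.page r hr) ≫ (c'.pageSc'Iso r hr a).hom =
    (c.pageSc'Iso r hr a).hom ≫ f.sc _ _ _ _ _ _ _ _ _ _ := by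
  ext
  all_goals exact (comp_id _).trans (id_comp _).symm

lemma pageScIso_naturality (r : ℤ) (hr : (s : ℤ) = r) (a : ℤ × ℤ) :
    (HomologicalComplex.shortComplexFunctor A _ a).map (f.page r hr) ≫
      (c'.pageScIso r hr a).hom = (c.pageScIso r hr a).hom ≫ f.scAt a.1 (a.1 + a.2) := by
  have h := (HomologicalComplex.natIsoSc' A (ComplexShape.up' (⟨r, 1 - r⟩ : ℤ × ℤ))
    (a - (r, 1 - r)) a (a + (r, 1 - r)) (ComplexShape.prev_eq' _ (by simp))
    (ComplexShape.next_eq' _ (by simp))).hom.naturality (f.page r hr)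
  have h₂ := f.pageSc'Iso_naturality r hr a
  have h₃ := f.scIso_naturality (a - (r, 1 - r)).1 a.1 (a + (r, 1 - r)).1
    ((a - (r, 1 - r)).1 + (a - (r, 1 - r)).2) (a.1 + a.2)
    ((a + (r, 1 - r)).1 + (a + (r, 1 - r)).2)
    (by simp; lia) (by simp; lia) (by simp; lia) (by simp; lia)
  refine ((assoc _ _ _).symm.trans (congrArg (· ≫ _) h)).trans ((assoc _ _ _).trans ?_)
  refine Eq.trans ?_ (assoc _ _ _).symm
  refine congrArg (((HomologicalComplex.natIsoSc' A (ComplexShape.up' (⟨r, 1 - r⟩ : ℤ × ℤ))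
    (a - (r, 1 - r)) a (a + (r, 1 - r)) (ComplexShape.prev_eq' _ (by simp))
    (ComplexShape.next_eq' _ (by simp))).hom.app (c.page r hr)) ≫ ·) ?_
  refine ((assoc _ _ _).symm.trans (congrArg (· ≫ _) h₂)).trans ((assoc _ _ _).trans ?_)
  exact (congrArg ((c.pageSc'Iso r hr a).hom ≫ ·) h₃.symm).trans (assoc _ _ _).symm

lemma pageHomologyIso_naturality (r r' : ℤ) (hr : (s : ℤ) = r) (hr' : ((s + 1 : ℕ) : ℤ) = r')
    (a : ℤ × ℤ) :
    HomologicalComplex.homologyMap (f.page r hr) a ≫ (c'.pageHomologyIso r r' hr hr' a).hom =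
      (c.pageHomologyIso r r' hr hr' a).hom ≫ (f.derived.page r' hr').f a := by
  have h₁ := ShortComplex.homologyMap_comp (S₁ := (c.page r hr).sc a)
    (S₂ := (c'.page r hr).sc a)
    ((HomologicalComplex.shortComplexFunctor A _ a).map (f.page r hr)) (c'.pageScIso r hr a).hom
  have h₂ := ShortComplex.homologyMap_comp (c.pageScIso r hr a).hom (f.scAt a.1 (a.1 + a.2))
  refine h₁.symm.trans (Eq.trans ?_ h₂)
  exact congrArg (fun φ => ShortComplex.homologyMap (S₁ := (c.page r hr).sc a) φ)
    (f.pageScIso_naturality r hr a)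

lemma iterIso_naturality {a b : ℕ} (h : a = b) (p n : ℤ) :
    (c.iterIso h p n).hom ≫ (f.iter b).E p n = (f.iter a).E p n ≫ (c'.iterIso h p n).hom := by
  subst h
  simp [iterIso]

/-- The morphism of spectral sequences induced by a morphism of exact couples. -/
def spectralSequence (r₀ : ℤ) (h₀ : (s : ℤ) ≤ r₀) :
    c.spectralSequence r₀ h₀ ⟶ c'.spectralSequence r₀ h₀ where
  hom r hr := (f.iter (r - s).toNat).page r (by lia)
  comm r r' a h hr := by
    refine ((assoc _ _ _).symm.trans (congrArg (· ≫ _)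
      ((f.iter (r - s).toNat).pageHomologyIso_naturality r r' (by lia) (by lia) a))).trans ?_
    refine (assoc _ _ _).trans (Eq.trans ?_ (assoc _ _ _).symm)
    exact congrArg (_ ≫ ·) (f.iterIso_naturality (a := (r - s).toNat + 1)
      (b := (r' - s).toNat) (by lia) a.1 (a.1 + a.2)).symm

end Hom

/-- An abutment of an exact couple: graded objects `H m` with maps to the terms `D p m`
which are compatible with the maps `i`. -/
structure Abutment (c : ExactCouple A s) where
  H : ℤ → A
  α (p m : ℤ) : H m ⟶ c.D p m
  α_i (p p' m : ℤ) (h : p' + 1 = p) : α p m ≫ c.i p p' m h = α p' m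

/-- The map from the term in bidegree `a` of the page `r` to the terms `D` of the exact couple
which is induced by `k`. -/
def pageK (c : ExactCouple A s) (r₀ : ℤ) (h₀ : (s : ℤ) ≤ r₀) (r : ℤ) (hr : r₀ ≤ r) (a : ℤ × ℤ) :
    ((c.spectralSequence r₀ h₀).page r hr).X a ⟶ c.D (a.1 + 1) (a.1 + a.2) :=
  (c.iter (r - s).toNat).k a.1 (a.1 + 1) (a.1 + a.2) rfl ≫ c.iterι _ _ (r - s).toNat

namespace Abutment

variable {c : ExactCouple A s} (h : c.Abutment)

/-- The decreasing filtration `F^p` on the abutment in degree `m`. -/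
def filtration (p m : ℤ) : Subobject (h.H m) := kernelSubobject (h.α p m)

/-- A (generalized) element `x` of the abutment in degree `p + q` is represented by an element
`y` of `E_r^{p,q}`, `a = (p, q)`, if both have the same image in the terms `D` of the couple.
(Then `x` belongs to `F^p`.) -/
def Represents (r₀ : ℤ) (h₀ : (s : ℤ) ≤ r₀) (r : ℤ) (hr : r₀ ≤ r) (a : ℤ × ℤ) {Z : A}
    (x : Z ⟶ h.H (a.1 + a.2)) (y : Z ⟶ ((c.spectralSequence r₀ h₀).page r hr).X a) : Prop :=
  x ≫ h.α (a.1 + 1) (a.1 + a.2) = y ≫ c.pageK r₀ h₀ r hr a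

/-- Convergence of the spectral sequence of an exact couple to an abutment: the filtration of the
abutment is finite in every degree, and from some page on the spectral sequence is stationary and
`E_r^{p,q}` is identified with `F^p H^{p+q} / F^{p+1} H^{p+q}`, in such a way that an element of
`F^p H^{p+q}` is represented by its class. -/
structure Convergence (r₀ : ℤ) (h₀ : (s : ℤ) ≤ r₀) where
  r₁ : ℤ
  le : r₀ ≤ r₁
  exists_top (m : ℤ) : ∃ p, h.filtration p m = ⊤
  exists_bot (m : ℤ) : ∃ p, h.filtration p m = ⊥
  d_eq_zero (r : ℤ) (hr : r₁ ≤ r) (a b : ℤ × ℤ) :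
    ((c.spectralSequence r₀ h₀).page r (le.trans hr)).d a b = 0
  edge (r : ℤ) (hr : r₁ ≤ r) (a : ℤ × ℤ) :
    (h.filtration a.1 (a.1 + a.2) : A) ⟶ ((c.spectralSequence r₀ h₀).page r (le.trans hr)).X a
  epi_edge (r : ℤ) (hr : r₁ ≤ r) (a : ℤ × ℤ) : Epi (edge r hr a)
  edge_eq_zero_iff (r : ℤ) (hr : r₁ ≤ r) (a : ℤ × ℤ) {Z : A}
    (x : Z ⟶ (h.filtration a.1 (a.1 + a.2) : A)) :
    x ≫ edge r hr a = 0 ↔ (h.filtration (a.1 + 1) (a.1 + a.2)).Factors (x ≫ Subobject.arrow _)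
  represents (r : ℤ) (hr : r₁ ≤ r) (a : ℤ × ℤ) :
    h.Represents r₀ h₀ r (le.trans hr) a (Subobject.arrow _) (edge r hr a)
  edge_iso (r : ℤ) (hr : r₁ ≤ r) (a : ℤ × ℤ) :
    ∃ z : (h.filtration a.1 (a.1 + a.2) : A) ⟶
        ((c.spectralSequence r₀ h₀).page r (le.trans hr)).cycles a,
      z ≫ HomologicalComplex.iCycles _ a = edge r hr a ∧
      z ≫ HomologicalComplex.homologyπ _ a ≫
        ((c.spectralSequence r₀ h₀).iso r (r + 1) a rfl (le.trans hr)).hom =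
          edge (r + 1) (by lia) a

end Abutment

end ExactCouple

section triangles

open Pretriangulated

variable {C : Type*} [Category* C] [Preadditive C] [HasZeroObject C] [HasShift C ℤ]
  [∀ n : ℤ, (shiftFunctor C n).Additive] [Pretriangulated C]
  {A : Type*} [Category* A] [Abelian A]

/-- Two morphisms form, up to isomorphism, the beginning of a distinguished triangle. -/
def IsTriangleStart {X Y Z : C} (f : X ⟶ Y) (g : Y ⟶ Z) : Prop :=
  ∃ (T : Triangle C) (_ : T ∈ distTriang C) (e₁ : X ≅ T.obj₁) (e₂ : Y ≅ T.obj₂)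
    (e₃ : Z ≅ T.obj₃), f ≫ e₂.hom = e₁.hom ≫ T.mor₁ ∧ g ≫ e₃.hom = e₂.hom ≫ T.mor₂

namespace IsTriangleStart

variable {X Y Z : C} {f : X ⟶ Y} {g : Y ⟶ Z}

lemma comp_eq_zero (h : IsTriangleStart f g) : f ≫ g = 0 := by
  obtain ⟨T, hT, e₁, e₂, e₃, h₁, h₂⟩ := h
  rw [← cancel_mono e₃.hom, assoc, h₂, ← assoc, h₁, assoc, comp_distTriang_mor_zero₁₂ T hT,
    comp_zero, zero_comp]

lemma map_comp_eq_zero (h : IsTriangleStart f g) (F : C ⥤ A) [F.IsHomological] :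
    F.map f ≫ F.map g = 0 := by
  rw [← F.map_comp, h.comp_eq_zero, F.map_zero]

lemma exact (h : IsTriangleStart f g) (F : C ⥤ A) [F.IsHomological] :
    (ShortComplex.mk _ _ (h.map_comp_eq_zero F)).Exact := by
  obtain ⟨T, hT, e₁, e₂, e₃, h₁, h₂⟩ := id h
  refine ShortComplex.exact_of_iso ?_ (F.map_distinguished_exact T hT)
  refine ShortComplex.isoMk (F.mapIso e₁.symm) (F.mapIso e₂.symm) (F.mapIso e₃.symm) ?_ ?_
  · change F.map e₁.inv ≫ F.map f = F.map T.mor₁ ≫ F.map e₂.inv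
    rw [← F.map_comp, ← F.map_comp]
    congr 1
    rw [Iso.inv_comp_eq, ← assoc, ← h₁, assoc, e₂.hom_inv_id, comp_id]
  · change F.map e₂.inv ≫ F.map g = F.map T.mor₂ ≫ F.map e₃.inv
    rw [← F.map_comp, ← F.map_comp]
    congr 1
    rw [Iso.inv_comp_eq, ← assoc, ← h₂, assoc, e₃.hom_inv_id, comp_id]

section

open Pretriangulated.Opposite

lemma op_map_comp_eq_zero (h : IsTriangleStart f g) (F : Cᵒᵖ ⥤ A) [F.IsHomological] :
    F.map g.op ≫ F.map f.op = 0 := by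
  rw [← F.map_comp, ← op_comp, h.comp_eq_zero, op_zero, F.map_zero]

lemma op_exact (h : IsTriangleStart f g) (F : Cᵒᵖ ⥤ A) [F.IsHomological] :
    (ShortComplex.mk _ _ (h.op_map_comp_eq_zero F)).Exact := by
  obtain ⟨T, hT, e₁, e₂, e₃, h₁, h₂⟩ := id h
  refine ShortComplex.exact_of_iso ?_ (F.map_distinguished_op_exact T hT)
  refine ShortComplex.isoMk (F.mapIso e₃.op) (F.mapIso e₂.op) (F.mapIso e₁.op) ?_ ?_
  · change F.map e₃.hom.op ≫ F.map g.op = F.map T.mor₂.op ≫ F.map e₂.hom.op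
    rw [← F.map_comp, ← F.map_comp, ← op_comp, ← op_comp, h₂]
  · change F.map e₂.hom.op ≫ F.map f.op = F.map T.mor₁.op ≫ F.map e₁.hom.op
    rw [← F.map_comp, ← F.map_comp, ← op_comp, ← op_comp, h₁]

end

end IsTriangleStart

/-- The morphism `X⟦a⟧ ⟶ Y⟦b⟧`, `a + 1 = b`, obtained by shifting a morphism `X ⟶ Y⟦1⟧`. -/
def shiftConn {X Y : C} (f : X ⟶ Y⟦(1 : ℤ)⟧) (a b : ℤ) (h : a + 1 = b) : X⟦a⟧ ⟶ Y⟦b⟧ :=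
  f⟦a⟧' ≫ (shiftFunctorAdd' C 1 a b (by lia)).inv.app Y

lemma shiftConn_naturality {X Y X' Y' : C} (f : X ⟶ Y⟦(1 : ℤ)⟧) (f' : X' ⟶ Y'⟦(1 : ℤ)⟧)
    (x : X ⟶ X') (y : Y ⟶ Y') (w : f ≫ y⟦(1 : ℤ)⟧' = x ≫ f') (a b : ℤ) (h : a + 1 = b) :
    shiftConn f a b h ≫ y⟦b⟧' = x⟦a⟧' ≫ shiftConn f' a b h := by
  have := (shiftFunctorAdd' C 1 a b (by lia)).inv.naturality y
  dsimp at this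
  rw [shiftConn, shiftConn, assoc, ← this, ← assoc, ← Functor.map_comp, w, Functor.map_comp, assoc]

/-- The automorphism of an object given by a sign. -/
def signIso (u : ℤˣ) (X : C) : X ≅ X where
  hom := u • 𝟙 X
  inv := u • 𝟙 X
  hom_inv_id := by simp [smul_smul]
  inv_hom_id := by simp [smul_smul]

lemma comp_signIso (u : ℤˣ) {X Y : C} (f : X ⟶ Y) : f ≫ (signIso u Y).hom = u • f := by
  simp [signIso]

lemma signIso_comp (u : ℤˣ) {X Y : C} (f : X ⟶ Y) : (signIso u X).hom ≫ f = u • f := by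
  simp [signIso]

lemma isTriangleStart_shift₂ (T : Triangle C) (hT : T ∈ distTriang C) (a : ℤ) :
    IsTriangleStart (T.mor₁⟦a⟧') (T.mor₂⟦a⟧') := by
  refine ⟨_, Triangle.shift_distinguished _ hT a, Iso.refl _, signIso a.negOnePow _,
    Iso.refl _, ?_, ?_⟩
  · exact (comp_signIso _ _).trans (id_comp _).symm
  · refine (comp_id _).trans (Eq.trans ?_ (signIso_comp a.negOnePow
      (a.negOnePow • T.mor₂⟦a⟧')).symm)
    rw [smul_smul, Int.units_mul_self, one_smul]

lemma shiftConn_comp {X Y : C} (f : X ⟶ Y⟦(1 : ℤ)⟧) (a b : ℤ) (h : a + 1 = b) :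
    shiftConn f a b h ≫ (shiftFunctorAdd' C a 1 b h).hom.app Y =
      f⟦a⟧' ≫ (shiftFunctorComm C 1 a).hom.app Y := by
  rw [shiftFunctorComm_eq C 1 a b (by lia), shiftConn, assoc]
  rfl

lemma isTriangleStart_of_iso {X Y Z X' Y' Z' : C} {f : X ⟶ Y} {g : Y ⟶ Z} (f' : X' ⟶ Y')
    (g' : Y' ⟶ Z') (h' : Z' ⟶ X'⟦(1 : ℤ)⟧) (hT : Triangle.mk f' g' h' ∈ distTriang C)
    (e₁ : X ≅ X') (e₂ : Y ≅ Y') (e₃ : Z ≅ Z') (h₁ : f ≫ e₂.hom = e₁.hom ≫ f')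
    (h₂ : g ≫ e₃.hom = e₂.hom ≫ g') : IsTriangleStart f g :=
  ⟨Triangle.mk f' g' h', hT, e₁, e₂, e₃, h₁, h₂⟩

lemma isTriangleStart_shift₃ (T : Triangle C) (hT : T ∈ distTriang C) (u : ℤˣ) (a b : ℤ)
    (h : a + 1 = b) : IsTriangleStart (T.mor₂⟦a⟧') (u • shiftConn T.mor₃ a b h) := by
  refine isTriangleStart_of_iso (a.negOnePow • T.mor₂⟦a⟧')
    (a.negOnePow • T.mor₃⟦a⟧' ≫ (shiftFunctorComm C 1 a).hom.app T.obj₁) _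
    (rot_of_distTriang _ (Triangle.shift_distinguished _ hT a))
    (signIso a.negOnePow _) (Iso.refl _)
    ((shiftFunctorAdd' C a 1 b h).app _ ≪≫ signIso (u * a.negOnePow) _) ?_ ?_
  · rw [signIso_comp, smul_smul, Int.units_mul_self, one_smul, Iso.refl_hom, comp_id]
  · rw [Iso.trans_hom, Iso.app_hom, ← assoc, comp_signIso, Iso.refl_hom, id_comp,
      Linear.units_smul_comp, shiftConn_comp, smul_smul, mul_right_comm, Int.units_mul_self,
      one_mul]

lemma isTriangleStart_shift₁ (T : Triangle C) (hT : T ∈ distTriang C) (u : ℤˣ) (a b : ℤ)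
    (h : a + 1 = b) : IsTriangleStart (u • shiftConn T.mor₃ a b h) (T.mor₁⟦b⟧') := by
  refine isTriangleStart_of_iso 
    (a.negOnePow • T.mor₃⟦a⟧' ≫ (shiftFunctorComm C 1 a).hom.app T.obj₁)
    (-((a.negOnePow • T.mor₁⟦a⟧')⟦(1 : ℤ)⟧')) _
    (rot_of_distTriang _ (rot_of_distTriang _ (Triangle.shift_distinguished _ hT a)))
    (signIso (u * a.negOnePow) _) ((shiftFunctorAdd' C a 1 b h).app _)
    ((shiftFunctorAdd' C a 1 b h).app _ ≪≫ signIso (- a.negOnePow) _) ?_ ?_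
  · rw [signIso_comp, Iso.app_hom, Linear.units_smul_comp, shiftConn_comp, smul_smul, mul_assoc,
      Int.units_mul_self, mul_one]
  · have := (shiftFunctorAdd' C a 1 b h).hom.naturality T.mor₁
    dsimp at this
    rw [Iso.trans_hom, Iso.app_hom, Iso.app_hom, ← assoc, comp_signIso, this,
      Functor.map_units_smul, Preadditive.comp_neg, Linear.comp_units_smul]
    simp [Units.smul_def]

end triangles

open Pretriangulated

/-- A weight structure on a triangulated category. -/
structure WeightStructure (C : Type*) [Category* C] [Preadditive C] [HasZeroObject C]
    [HasShift C ℤ] [∀ n : ℤ, (shiftFunctor C n).Additive] [Pretriangulated C] where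
  /-- the class of objects `C^{w ≤ 0}` -/
  le0 : ObjectProperty C
  /-- the class of objects `C^{w ≥ 0}` -/
  ge0 : ObjectProperty C
  le0_zero (X : C) (hX : IsZero X) : le0 X
  ge0_zero (X : C) (hX : IsZero X) : ge0 X
  le0_biprod (X Y : C) (hX : le0 X) (hY : le0 Y) : le0 (X ⊞ Y)
  ge0_biprod (X Y : C) (hX : ge0 X) (hY : ge0 Y) : ge0 (X ⊞ Y)
  le0_retract : le0.IsStableUnderRetracts
  ge0_retract : ge0.IsStableUnderRetracts
  le0_shift (X : C) (hX : le0 X) : le0 (X⟦(1 : ℤ)⟧)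
  ge0_shift (X : C) (hX : ge0 X) : ge0 (X⟦(-1 : ℤ)⟧)
  orthogonal (X Y : C) (hX : ge0 X) (hY : le0 Y) (f : X ⟶ Y⟦(1 : ℤ)⟧) : f = 0
  exists_decomposition (X : C) : ∃ (A B : C) (_ : le0 A) (_ : ge0 B)
    (f : X ⟶ A) (g : A ⟶ B) (h : B ⟶ X⟦(1 : ℤ)⟧), Triangle.mk f g h ∈ distTriang C

namespace WeightStructure

variable {C : Type*} [Category* C] [Preadditive C] [HasZeroObject C]
  [HasShift C ℤ] [∀ n : ℤ, (shiftFunctor C n).Additive] [Pretriangulated C]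
  (w : WeightStructure C)

/-- The class `C^{w ≤ n} = C^{w ≤ 0}[-n]`. -/
def le (n : ℤ) : ObjectProperty C := fun X => w.le0 (X⟦n⟧)

/-- The class `C^{w ≥ n} = C^{w ≥ 0}[-n]`. -/
def ge (n : ℤ) : ObjectProperty C := fun X => w.ge0 (X⟦n⟧)

/-- The bounded objects for a weight structure. -/
def IsBounded (X : C) : Prop := (∃ n, w.le n X) ∧ (∃ n, w.ge n X)

/-- A weight Postnikov tower of `X`: the objects `Y i` are choices of `w_{≥ 1 - i} X`,
and `gr i` is the cone of `Y i ⟶ Y (i + 1)`. -/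
structure Tower (X : C) where
  Y : ℤ → C
  gr : ℤ → C
  step (i i' : ℤ) (h : i + 1 = i') : Y i ⟶ Y i'
  toX (i : ℤ) : Y i ⟶ X
  step_toX (i i' : ℤ) (h : i + 1 = i') : step i i' h ≫ toX i' = toX i
  proj (i i' : ℤ) (h : i + 1 = i') : Y i' ⟶ gr i
  conn (i : ℤ) : gr i ⟶ (Y i)⟦(1 : ℤ)⟧
  dist (i i' : ℤ) (h : i + 1 = i') :
    Triangle.mk (step i i' h) (proj i i' h) (conn i) ∈ distTriang C
  ge (i : ℤ) : w.ge (1 - i) (Y i)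
  le (i : ℤ) : ∃ (Z : C) (_ : w.le (-i) Z) (f : X ⟶ Z) (g : Z ⟶ (Y i)⟦(1 : ℤ)⟧),
    Triangle.mk (toX i) f g ∈ distTriang C

namespace Tower

variable {w} {X X' : C}

/-- A morphism of weight Postnikov towers over a morphism `g : X ⟶ X'`. -/
structure Hom (𝒯 : w.Tower X) (𝒯' : w.Tower X') (g : X ⟶ X') where
  Y (i : ℤ) : 𝒯.Y i ⟶ 𝒯'.Y i
  gr (i : ℤ) : 𝒯.gr i ⟶ 𝒯'.gr i
  comm_step (i i' : ℤ) (h : i + 1 = i') : 𝒯.step i i' h ≫ Y i' = Y i ≫ 𝒯'.step i i' h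
  comm_toX (i : ℤ) : 𝒯.toX i ≫ g = Y i ≫ 𝒯'.toX i
  comm_proj (i i' : ℤ) (h : i + 1 = i') : 𝒯.proj i i' h ≫ gr i = Y i' ≫ 𝒯'.proj i i' h
  comm_conn (i : ℤ) : 𝒯.conn i ≫ (Y i)⟦(1 : ℤ)⟧' = gr i ≫ 𝒯'.conn i

variable (𝒯 : w.Tower X)

/-- The morphism `gr i ⟶ (gr i')⟦1⟧` with `i' + 1 = i`. -/
def grConn (i i' : ℤ) (h : i' + 1 = i) : 𝒯.gr i ⟶ (𝒯.gr i')⟦(1 : ℤ)⟧ :=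
  𝒯.conn i ≫ (𝒯.proj i' i h)⟦(1 : ℤ)⟧'

lemma grConn_comp (i i' i'' : ℤ) (h : i' + 1 = i) (h' : i'' + 1 = i') :
    𝒯.grConn i i' h ≫ (𝒯.grConn i' i'' h')⟦(1 : ℤ)⟧' = 0 := by
  have h₀ : 𝒯.proj i' i h ≫ 𝒯.conn i' = 0 := comp_distTriang_mor_zero₂₃ _ (𝒯.dist i' i h)
  have h₁ : (𝒯.proj i' i h)⟦(1 : ℤ)⟧' ≫ (𝒯.grConn i' i'' h')⟦(1 : ℤ)⟧' = 0 := by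
    rw [← Functor.map_comp, grConn, ← assoc, h₀, zero_comp, Functor.map_zero]
  rw [grConn, assoc, h₁, comp_zero]

/-- The differential of the weight complex. -/
def weightD (p p' : ℤ) (h : p + 1 = p') : (𝒯.gr (-p))⟦p⟧ ⟶ (𝒯.gr (-p'))⟦p'⟧ :=
  shiftConn (𝒯.grConn (-p) (-p') (by lia)) p p' h

lemma shiftConn_comp_shiftConn {X Y Z : C} (f : X ⟶ Y⟦(1 : ℤ)⟧) (g : Y ⟶ Z⟦(1 : ℤ)⟧)
    (hfg : f ≫ g⟦(1 : ℤ)⟧' = 0) (a b c : ℤ) (h : a + 1 = b) (h' : b + 1 = c) :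
    shiftConn f a b h ≫ shiftConn g b c h' = 0 := by
  have h₁ := (shiftFunctorAdd' C 1 a b (by lia)).inv.naturality g
  dsimp at h₁
  rw [shiftConn, shiftConn, assoc, ← assoc _ (g⟦b⟧'), ← h₁, ← assoc, ← assoc,
    ← Functor.map_comp, hfg, Functor.map_zero, zero_comp, zero_comp]

/-- The weight complex attached to a weight Postnikov tower: its term in degree `p` is
`X^p = (gr (-p))⟦p⟧`. -/
def weightComplex : CochainComplex C ℤ where
  X p := (𝒯.gr (-p))⟦p⟧
  d p p' := if h : p + 1 = p' then 𝒯.weightD p p' h else 0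
  shape p p' h := dif_neg h
  d_comp_d' p p' p'' h h' := by
    have h₁ : p + 1 = p' := h
    have h₂ : p' + 1 = p'' := h'
    rw [dif_pos h₁, dif_pos h₂]
    exact shiftConn_comp_shiftConn _ _ (𝒯.grConn_comp _ _ _ _ _) _ _ _ _ _

lemma weightComplex_d (p p' : ℤ) (h : p + 1 = p') :
    𝒯.weightComplex.d p p' = 𝒯.weightD p p' h :=
  dif_pos h

variable {𝒯} {𝒯' : w.Tower X'} {g : X ⟶ X'}

namespace Hom

variable (φ : Hom 𝒯 𝒯' g)

lemma comm_grConn (i i' : ℤ) (h : i' + 1 = i) :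
    𝒯.grConn i i' h ≫ (φ.gr i')⟦(1 : ℤ)⟧' = φ.gr i ≫ 𝒯'.grConn i i' h := by
  rw [grConn, grConn, assoc, ← Functor.map_comp, φ.comm_proj, Functor.map_comp, ← assoc,
    φ.comm_conn, assoc]

/-- The morphism between weight complexes induced by a morphism of towers. -/
def weightComplex : 𝒯.weightComplex ⟶ 𝒯'.weightComplex where
  f p := (φ.gr (-p))⟦p⟧'
  comm' p p' h := by
    rw [𝒯.weightComplex_d p p' h, 𝒯'.weightComplex_d p p' h]
    exact (shiftConn_naturality _ _ _ _ (φ.comm_grConn _ _ _) _ _ _).symm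

end Hom

end Tower

end WeightStructure

open Pretriangulated.Opposite in
/-- A duality `Cᵒᵖ × D ⥤ A`: a bifunctor which is homological with respect to both arguments
(hence bi-additive), equipped with a binatural isomorphism `Φ(X, Y) ≅ Φ(X⟦1⟧, Y⟦1⟧)`. -/
structure Duality (C D A : Type*) [Category* C] [Preadditive C] [HasZeroObject C]
    [HasShift C ℤ] [∀ n : ℤ, (shiftFunctor C n).Additive] [Pretriangulated C]
    [Category* D] [Preadditive D] [HasZeroObject D]
    [HasShift D ℤ] [∀ n : ℤ, (shiftFunctor D n).Additive] [Pretriangulated D]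
    [Category* A] [Abelian A] where
  Φ : Cᵒᵖ ⥤ D ⥤ A
  homological_left (Y : D) : (Φ.flip.obj Y).IsHomological
  homological_right (X : Cᵒᵖ) : (Φ.obj X).IsHomological
  shift : Φ ≅ (shiftFunctor C (1 : ℤ)).op ⋙ Φ ⋙
    (Functor.whiskeringLeft D D A).obj (shiftFunctor D (1 : ℤ))

namespace Duality

variable {C D A : Type*} [Category* C] [Preadditive C] [HasZeroObject C]
    [HasShift C ℤ] [∀ n : ℤ, (shiftFunctor C n).Additive] [Pretriangulated C]
    [Category* D] [Preadditive D] [HasZeroObject D]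
    [HasShift D ℤ] [∀ n : ℤ, (shiftFunctor D n).Additive] [Pretriangulated D]
    [Category* A] [Abelian A]
    (Ψ : Duality C D A)

attribute [instance] homological_left homological_right

/-- The object `Φ(X, Y)`. -/
abbrev obj (X : C) (Y : D) : A := (Ψ.Φ.obj (op X)).obj Y

/-- The map `Φ(X', Y) ⟶ Φ(X, Y')` induced by `g : X ⟶ X'` and `f : Y ⟶ Y'`. -/
def map {X X' : C} (g : X ⟶ X') {Y Y' : D} (f : Y ⟶ Y') : Ψ.obj X' Y ⟶ Ψ.obj X Y' :=
  (Ψ.Φ.map g.op).app Y ≫ (Ψ.Φ.obj (op X)).map f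

/-- The isomorphism `Φ(X', Y) ≅ Φ(X, Y')` induced by `X ≅ X'` and `Y ≅ Y'`. -/
def mapIso {X X' : C} (g : X ≅ X') {Y Y' : D} (f : Y ≅ Y') : Ψ.obj X' Y ≅ Ψ.obj X Y' :=
  (Ψ.Φ.mapIso g.op).app Y ≪≫ (Ψ.Φ.obj (op X)).mapIso f

/-- The isomorphism `Φ(X, Y) ≅ Φ(X⟦1⟧, Y⟦1⟧)`. -/
def shiftOne (X : C) (Y : D) : Ψ.obj X Y ≅ Ψ.obj (X⟦(1 : ℤ)⟧) (Y⟦(1 : ℤ)⟧) :=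
  (Ψ.shift.app (op X)).app Y

/-- The isomorphism `Φ(X, Y) ≅ Φ(X⟦m⟧, Y⟦m⟧)` for `m : ℕ`. -/
def shiftNat (X : C) (Y : D) : (m : ℕ) → (Ψ.obj X Y ≅ Ψ.obj (X⟦(m : ℤ)⟧) (Y⟦(m : ℤ)⟧))
  | 0 => Ψ.mapIso ((shiftFunctorZero C ℤ).app X) ((shiftFunctorZero D ℤ).app Y).symm
  | m + 1 => shiftNat X Y m ≪≫ Ψ.shiftOne _ _ ≪≫
      Ψ.mapIso ((shiftFunctorAdd' C (m : ℤ) 1 ((m + 1 : ℕ) : ℤ) (by simp)).app X)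
        ((shiftFunctorAdd' D (m : ℤ) 1 ((m + 1 : ℕ) : ℤ) (by simp)).app Y).symm

/-- The isomorphism `Φ(X⟦-n⟧, Y) ≅ Φ(X, Y⟦n⟧)`. -/
def shiftIso (X : C) (Y : D) : (n : ℤ) → (Ψ.obj (X⟦-n⟧) Y ≅ Ψ.obj X (Y⟦n⟧))
  | .ofNat m => Ψ.shiftNat (X⟦-(m : ℤ)⟧) Y m ≪≫
      Ψ.mapIso ((shiftFunctorCompIsoId C (-(m : ℤ)) (m : ℤ) (by simp)).app X).symm (Iso.refl _)
  | .negSucc m =>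
      Ψ.mapIso (Iso.refl (X⟦((m + 1 : ℕ) : ℤ)⟧))
        ((shiftFunctorCompIsoId D (Int.negSucc m) ((m + 1 : ℕ) : ℤ) (by lia)).app Y).symm ≪≫
        (Ψ.shiftNat X (Y⟦Int.negSucc m⟧) (m + 1)).symm

open Triangulated in
/-- A weight structure `w` on `C` and a `t`-structure on `D` are orthogonal with respect to
a duality. -/
def Orthogonal (w : WeightStructure C) (t : TStructure D) : Prop :=
  ∀ (X : C) (Y : D), (w.le0 X ∧ t.ge 1 Y) ∨ (w.ge0 X ∧ t.le (-1) Y) → IsZero (Ψ.obj X Y)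

/-- For distinguished triangles `S` in `C` and `T` in `D`, the map
`Φ(S₃, T₃) ⟶ Φ(S₃⟦-1⟧, T₁)` induced by the third morphism of `T`. -/
def niceH (S : Triangle C) (T : Triangle D) :
    Ψ.obj S.obj₃ T.obj₃ ⟶ Ψ.obj (S.obj₃⟦(-1 : ℤ)⟧) T.obj₁ :=
  (Ψ.Φ.obj (op S.obj₃)).map T.mor₃ ≫
    (Ψ.Φ.map ((shiftFunctorCompIsoId C (-1 : ℤ) 1 (by simp)).hom.app S.obj₃).op).app _ ≫
    (Ψ.shiftOne (S.obj₃⟦(-1 : ℤ)⟧) T.obj₁).inv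

/-- For distinguished triangles `S` in `C` and `T` in `D`, the map
`Φ(S₁, T₁) ⟶ Φ(S₃⟦-1⟧, T₁)` induced by the third morphism of `S`. -/
def niceN (S : Triangle C) (T : Triangle D) :
    Ψ.obj S.obj₁ T.obj₁ ⟶ Ψ.obj (S.obj₃⟦(-1 : ℤ)⟧) T.obj₁ :=
  (Ψ.Φ.map (S.mor₃⟦(-1 : ℤ)⟧' ≫
    (shiftFunctorCompIsoId C (1 : ℤ) (-1) (by simp)).hom.app S.obj₁).op).app T.obj₁

/-- The `3 × 3`-matrix
`Φ(S₁,T₁) ⊞ (Φ(S₂,T₂) ⊞ Φ(S₃,T₃)) ⟶ Φ(S₁,T₂) ⊞ (Φ(S₂,T₃) ⊞ Φ(S₃⟦-1⟧,T₁))` whose rows are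
`(T.mor₁, -S.mor₁, 0)`, `(0, T.mor₂, -S.mor₂)` and `(-S.mor₃⟦-1⟧, 0, T.mor₃)`. -/
def niceMatrix (S : Triangle C) (T : Triangle D) :
    Ψ.obj S.obj₁ T.obj₁ ⊞ (Ψ.obj S.obj₂ T.obj₂ ⊞ Ψ.obj S.obj₃ T.obj₃) ⟶
      Ψ.obj S.obj₁ T.obj₂ ⊞ (Ψ.obj S.obj₂ T.obj₃ ⊞ Ψ.obj (S.obj₃⟦(-1 : ℤ)⟧) T.obj₁) :=
  biprod.desc
    (biprod.lift ((Ψ.Φ.obj (op S.obj₁)).map T.mor₁) (biprod.lift 0 (-Ψ.niceN S T)))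
    (biprod.desc
      (biprod.lift (-(Ψ.Φ.map S.mor₁.op).app T.obj₂)
        (biprod.lift ((Ψ.Φ.obj (op S.obj₂)).map T.mor₂) 0))
      (biprod.lift 0
        (biprod.lift (-(Ψ.Φ.map S.mor₂.op).app T.obj₃) (Ψ.niceH S T))))

/-- The map `Φ(S₁,T₁) ⊞ Φ(S₂,T₂) ⟶ Φ(S₁,T₂)` given by the row `(T.mor₁, -S.mor₁)`. -/
def niceRow (S : Triangle C) (T : Triangle D) :
    Ψ.obj S.obj₁ T.obj₁ ⊞ Ψ.obj S.obj₂ T.obj₂ ⟶ Ψ.obj S.obj₁ T.obj₂ :=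
  biprod.desc ((Ψ.Φ.obj (op S.obj₁)).map T.mor₁) (-(Ψ.Φ.map S.mor₁.op).app T.obj₂)

/-- The projection from the kernel of the matrix to the kernel of the first row. -/
def niceProj (S : Triangle C) (T : Triangle D) :
    kernel (Ψ.niceMatrix S T) ⟶ kernel (Ψ.niceRow S T) :=
  kernel.lift _ (kernel.ι _ ≫ biprod.map (𝟙 _) biprod.fst) (by
    have h : biprod.map (𝟙 _) biprod.fst ≫ Ψ.niceRow S T =
        Ψ.niceMatrix S T ≫ biprod.fst := by
      ext <;> simp [niceRow, niceMatrix]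
    rw [assoc, h, kernel.condition_assoc, zero_comp])

/-- A duality is nice if for any distinguished triangles `S` in `C` and `T` in `D` the projection
from the kernel of the matrix to the kernel of its first row is an epimorphism: a pair of
compatible elements of `Φ(S₁,T₁)` and `Φ(S₂,T₂)` extends (locally) to a triple. -/
def IsNice : Prop :=
  ∀ (S : Triangle C) (T : Triangle D), S ∈ distTriang C → T ∈ distTriang D →
    Epi (Ψ.niceProj S T)

end Duality

namespace WeightStructure.Tower

open Pretriangulated.Opposite

variable {C A : Type*} [Category* C] [Preadditive C] [HasZeroObject C]
  [HasShift C ℤ] [∀ n : ℤ, (shiftFunctor C n).Additive] [Pretriangulated C]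
  [Category* A] [Abelian A] {w : WeightStructure C} {X X' : C}

/-- The map `(gr p')⟦-n⟧ ⟶ (Y p)⟦-m⟧` for `p = p'`, `m + 1 = n`: the third morphism of the shift
by `-n` of the distinguished triangle `Y p ⟶ Y (p + 1) ⟶ gr p ⟶ (Y p)⟦1⟧`. -/
def shiftedConn (𝒯 : w.Tower X) (p p' m n : ℤ) (hp : p = p') (hn : m + 1 = n) :
    (𝒯.gr p')⟦-n⟧ ⟶ (𝒯.Y p)⟦-m⟧ :=
  n.negOnePow • (eqToHom (by rw [hp]) ≫ shiftConn (𝒯.conn p) (-n) (-m) (by lia))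

lemma shiftedConn_self (𝒯 : w.Tower X) (p m n : ℤ) (hn : m + 1 = n) :
    𝒯.shiftedConn p p m n rfl hn = n.negOnePow • shiftConn (𝒯.conn p) (-n) (-m) (by lia) := by
  rw [shiftedConn, eqToHom_refl, id_comp]

lemma Hom.comm_shiftedConn {𝒯 : w.Tower X} {𝒯' : w.Tower X'} {g : X ⟶ X'} (φ : Hom 𝒯 𝒯' g)
    (p p' m n : ℤ) (hp : p = p') (hn : m + 1 = n) :
    𝒯.shiftedConn p p' m n hp hn ≫ (φ.Y p)⟦-m⟧' =
      (φ.gr p')⟦-n⟧' ≫ 𝒯'.shiftedConn p p' m n hp hn := by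
  subst hp
  rw [shiftedConn_self, shiftedConn_self, Linear.units_smul_comp, Linear.comp_units_smul,
    shiftConn_naturality _ _ _ _ (φ.comm_conn p)]

lemma start₁ (𝒯 : w.Tower X) (p p' p'' m n : ℤ) (h : p + 1 = p') (hp : p = p'')
    (hn : m + 1 = n) :
    IsTriangleStart (𝒯.shiftedConn p p'' m n hp hn) ((𝒯.step p p' h)⟦-m⟧') := by
  subst hp
  rw [shiftedConn_self]
  exact isTriangleStart_shift₁ _ (𝒯.dist p p' h) n.negOnePow (-n) (-m) (by lia)

lemma start₂ (𝒯 : w.Tower X) (p p' n : ℤ) (h : p + 1 = p') :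
    IsTriangleStart ((𝒯.step p p' h)⟦-n⟧') ((𝒯.proj p p' h)⟦-n⟧') :=
  isTriangleStart_shift₂ _ (𝒯.dist p p' h) (-n)

lemma start₃ (𝒯 : w.Tower X) (p p' p'' m n : ℤ) (h : p'' + 1 = p') (hp : p = p'')
    (hn : m + 1 = n) :
    IsTriangleStart ((𝒯.proj p'' p' h)⟦-n⟧') (𝒯.shiftedConn p p'' m n hp hn) := by
  subst hp
  rw [shiftedConn_self]
  exact isTriangleStart_shift₃ _ (𝒯.dist p p' h) n.negOnePow (-n) (-m) (by lia)

/-- The exact couple of the weight spectral sequence of a cohomological functor `H`: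
`D_1^{p,q} = H((Y p)⟦1 - p - q⟧)` and `E_1^{p,q} = H((gr p)⟦-p - q⟧)`. -/
def couple (𝒯 : w.Tower X) (H : Cᵒᵖ ⥤ A) [H.IsHomological] : ExactCouple A 1 where
  D p m := H.obj (op ((𝒯.Y p)⟦-m⟧))
  E p n := H.obj (op ((𝒯.gr p)⟦-n⟧))
  i p p' m h := H.map ((𝒯.step p' p h)⟦-m⟧').op
  j p p' m n hp hn := H.map (𝒯.shiftedConn p p' m n (by lia) hn).op
  k p p' n h := H.map ((𝒯.proj p p' h)⟦-n⟧').op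
  i_j p p' p'' m n h hp hn := (𝒯.start₁ p' p p'' m n h (by lia) hn).op_map_comp_eq_zero H
  j_k p p' p'' m n hp hn h := (𝒯.start₃ p p'' p' m n h (by lia) hn).op_map_comp_eq_zero H
  k_i p p' n h := (𝒯.start₂ p p' n h).op_map_comp_eq_zero H
  exact_i_j p p' p'' m n h hp hn := (𝒯.start₁ p' p p'' m n h (by lia) hn).op_exact H
  exact_j_k p p' p'' m n hp hn h := (𝒯.start₃ p p'' p' m n h (by lia) hn).op_exact H
  exact_k_i p p' n h := (𝒯.start₂ p p' n h).op_exact H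

/-- The abutment `H^m(X) = H(X⟦-m⟧)` of the weight spectral sequence. -/
def abutment (𝒯 : w.Tower X) (H : Cᵒᵖ ⥤ A) [H.IsHomological] : (𝒯.couple H).Abutment where
  H m := H.obj (op (X⟦-m⟧))
  α p m := H.map ((𝒯.toX p)⟦-m⟧').op
  α_i p p' m h := by
    change _ ≫ H.map ((𝒯.step p' p h)⟦-m⟧').op = _
    rw [← H.map_comp, ← op_comp, ← Functor.map_comp, 𝒯.step_toX]

lemma nat_square {H H' : Cᵒᵖ ⥤ A} (η : H ⟶ H') {U U' V V' : C} (f : U ⟶ V) (f' : U' ⟶ V')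
    (u : U ⟶ U') (v : V ⟶ V') (h : f ≫ v = u ≫ f') :
    H.map f'.op ≫ H.map u.op ≫ η.app (op U) = (H.map v.op ≫ η.app (op V)) ≫ H'.map f.op := by
  rw [assoc, ← η.naturality, ← assoc, ← assoc, ← H.map_comp, ← H.map_comp, ← op_comp,
    ← op_comp, h]

/-- The morphism of exact couples induced by a morphism of towers and a morphism of functors. -/
def Hom.couple {𝒯 : w.Tower X} {𝒯' : w.Tower X'} {g : X ⟶ X'} (φ : Hom 𝒯 𝒯' g)
    {H H' : Cᵒᵖ ⥤ A} [H.IsHomological] [H'.IsHomological] (η : H ⟶ H') :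
    (𝒯'.couple H).Hom (𝒯.couple H') where
  D p m := H.map ((φ.Y p)⟦-m⟧').op ≫ η.app _
  E p n := H.map ((φ.gr p)⟦-n⟧').op ≫ η.app _
  comm_i p p' m h := nat_square η _ _ _ _ (by
    rw [← Functor.map_comp, ← Functor.map_comp, φ.comm_step])
  comm_j p p' m n hp hn := nat_square η _ _ _ _ (φ.comm_shiftedConn _ _ _ _ _ _)
  comm_k p p' n h := nat_square η _ _ _ _ (by
    rw [← Functor.map_comp, ← Functor.map_comp, φ.comm_proj])

end WeightStructure.Tower

section tTruncations

open Triangulated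

variable {D A : Type*} [Category* D] [Preadditive D] [HasZeroObject D]
  [HasShift D ℤ] [∀ n : ℤ, (shiftFunctor D n).Additive] [Pretriangulated D] [IsTriangulated D]
  [Category* A] [Abelian A] (t : TStructure D)

lemma coe_le_coe_add_one (q : ℤ) : (q : EInt) ≤ ((q + 1 : ℤ) : EInt) := by
  simp

/-- The functorial distinguished triangle formed by `t_{= q} Y` (the object `t_{≥ q} t_{≤ q} Y`),
`t_{≥ q} Y` and `t_{≥ q + 1} Y`. -/
def truncTriangle (q : ℤ) : D ⥤ Triangle D :=
  t.triangleω₁δ (q : EInt) ((q + 1 : ℤ) : EInt) ⊤ (coe_le_coe_add_one q) le_top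

lemma truncTriangle_distinguished (q : ℤ) (Y : D) :
    (truncTriangle t q).obj Y ∈ distTriang D :=
  t.triangleω₁δ_distinguished _ _ _ _ _ Y

/-- The map `t_{= q} Y ⟶ t_{≥ q} Y`. -/
def truncK (Y : D) (q q' : ℤ) (h : q = q') :
    (t.truncGELE q q).obj Y ⟶ (t.truncGE q').obj Y :=
  (t.truncGE q).map ((t.truncLEι q).app Y) ≫ eqToHom (by rw [h]; rfl)

/-- The map `t_{≥ q} Y ⟶ t_{≥ q'} Y`, `q + 1 = q'`. -/
def truncI (Y : D) (q q' : ℤ) (h : q + 1 = q') : (t.truncGE q).obj Y ⟶ (t.truncGE q').obj Y :=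
  (t.natTransTruncGEOfLE q q' (by lia)).app Y

/-- The connecting map `t_{≥ q'} Y ⟶ (t_{= q} Y)⟦1⟧`, `q + 1 = q'`. -/
def truncδ (Y : D) (q q' : ℤ) (h : q + 1 = q') :
    (t.truncGE q').obj Y ⟶ ((t.truncGELE q q).obj Y)⟦(1 : ℤ)⟧ :=
  eqToHom (by rw [← h]; rfl) ≫ ((truncTriangle t q).obj Y).mor₃

lemma truncTriangle_eq (Y : D) (q : ℤ) :
    (truncTriangle t q).obj Y =
      Triangle.mk (truncK t Y q q rfl) (truncI t Y q (q + 1) rfl) (truncδ t Y q (q + 1) rfl) := by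
  have h₁ : ((truncTriangle t q).obj Y).mor₁ = truncK t Y q q rfl := by
    refine Eq.trans ?_ (comp_id _).symm
    exact t.triangleω₁δ_obj_mor₁ (q : EInt) ((q + 1 : ℤ) : EInt) ⊤ (coe_le_coe_add_one q) le_top Y
  have h₂ : ((truncTriangle t q).obj Y).mor₂ = truncI t Y q (q + 1) rfl :=
    t.triangleω₁δ_obj_mor₂ (q : EInt) ((q + 1 : ℤ) : EInt) ⊤ (coe_le_coe_add_one q) le_top Y
  have h₃ : ((truncTriangle t q).obj Y).mor₃ = truncδ t Y q (q + 1) rfl := (id_comp _).symm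
  rw [← h₁, ← h₂, ← h₃]
  rfl

lemma dist_trunc (Y : D) (q q₁ q' : ℤ) (h : q = q₁) (h' : q₁ + 1 = q') (h'' : q + 1 = q') :
    Triangle.mk (truncK t Y q q₁ h) (truncI t Y q₁ q' h') (truncδ t Y q q' h'') ∈
      distTriang D := by
  subst h h'
  rw [← truncTriangle_eq]
  exact truncTriangle_distinguished t q Y

lemma truncK_naturality {Y Y' : D} (f : Y ⟶ Y') (q q' : ℤ) (h : q = q') :
    truncK t Y q q' h ≫ (t.truncGE q').map f = (t.truncGELE q q).map f ≫ truncK t Y' q q' h := by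
  subst h
  rw [truncK, truncK, eqToHom_refl, eqToHom_refl, comp_id, comp_id, Functor.comp_map,
    ← Functor.map_comp, ← Functor.map_comp]
  exact congrArg _ ((t.truncLEι q).naturality f).symm

lemma truncI_naturality {Y Y' : D} (f : Y ⟶ Y') (q q' : ℤ) (h : q + 1 = q') :
    truncI t Y q q' h ≫ (t.truncGE q').map f = (t.truncGE q).map f ≫ truncI t Y' q q' h :=
  ((t.natTransTruncGEOfLE q q' (by lia)).naturality f).symm

lemma truncδ_naturality {Y Y' : D} (f : Y ⟶ Y') (q q' : ℤ) (h : q + 1 = q') :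
    truncδ t Y q q' h ≫ ((t.truncGELE q q).map f)⟦(1 : ℤ)⟧' =
      (t.truncGE q').map f ≫ truncδ t Y' q q' h := by
  subst h
  have := ((truncTriangle t q).map f).comm₃
  refine (congrArg (· ≫ _) (id_comp _)).trans (this.trans ?_)
  exact congrArg (_ ≫ ·) (id_comp _).symm

lemma truncStart₁ (Y : D) (q q₁ q' m n : ℤ) (h : q = q₁) (h'' : q + 1 = q') (hn : m + 1 = n) :
    IsTriangleStart (shiftConn (truncδ t Y q q' h'') m n hn) ((truncK t Y q q₁ h)⟦n⟧') := by
  have := isTriangleStart_shift₁ _ (dist_trunc t Y q q₁ q' h (by lia) h'') 1 m n hn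
  rwa [one_smul] at this

lemma truncStart₂ (Y : D) (q q₁ q' n : ℤ) (h : q = q₁) (h' : q₁ + 1 = q') :
    IsTriangleStart ((truncK t Y q q₁ h)⟦n⟧') ((truncI t Y q₁ q' h')⟦n⟧') :=
  isTriangleStart_shift₂ _ (dist_trunc t Y q q₁ q' h h' (by lia)) n

lemma truncStart₃ (Y : D) (q q₁ q' m n : ℤ) (h' : q₁ + 1 = q') (h'' : q + 1 = q')
    (hn : m + 1 = n) :
    IsTriangleStart ((truncI t Y q₁ q' h')⟦m⟧') (shiftConn (truncδ t Y q q' h'') m n hn) := by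
  have := isTriangleStart_shift₃ _ (dist_trunc t Y q q₁ q' (by lia) h' h'') 1 m n hn
  rwa [one_smul] at this

/-- The exact couple coming from the `t`-truncations of `Y` and a homological functor `F`:
`D_2^{p,q} = F((t_{≥ q} Y)⟦p + q - 1⟧)` and `E_2^{p,q} = F((t_{= q} Y)⟦p + q⟧)`. -/
def truncCouple (F : D ⥤ A) [F.IsHomological] (Y : D) : ExactCouple A 2 where
  D p m := F.obj (((t.truncGE (m + 1 - p)).obj Y)⟦m⟧)
  E p n := F.obj (((t.truncGELE (n - p) (n - p)).obj Y)⟦n⟧)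
  i p p' m h := F.map ((truncI t Y (m + 1 - p) (m + 1 - p') (by lia))⟦m⟧')
  j p p' m n hp hn :=
    F.map (shiftConn (truncδ t Y (n - p') (m + 1 - p) (by push_cast at hp; lia)) m n hn)
  k p p' n h := F.map ((truncK t Y (n - p) (n + 1 - p') (by lia))⟦n⟧')
  i_j p p' p'' m n h hp hn := (truncStart₃ t Y (n - p'') (m + 1 - p) (m + 1 - p') m n (by lia)
    (by push_cast at hp; lia) hn).map_comp_eq_zero F
  j_k p p' p'' m n hp hn h := (truncStart₁ t Y (n - p') (n + 1 - p'') (m + 1 - p) m n (by lia)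
    (by push_cast at hp; lia) hn).map_comp_eq_zero F
  k_i p p' n h := (truncStart₂ t Y (n - p) (n + 1 - p') (n + 1 - p) n (by lia)
    (by lia)).map_comp_eq_zero F
  exact_i_j p p' p'' m n h hp hn := (truncStart₃ t Y (n - p'') (m + 1 - p) (m + 1 - p') m n
    (by lia) (by push_cast at hp; lia) hn).exact F
  exact_j_k p p' p'' m n hp hn h := (truncStart₁ t Y (n - p') (n + 1 - p'') (m + 1 - p) m n
    (by lia) (by push_cast at hp; lia) hn).exact F
  exact_k_i p p' n h := (truncStart₂ t Y (n - p) (n + 1 - p') (n + 1 - p) n (by lia)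
    (by lia)).exact F

/-- The abutment `F(Y⟦m⟧)` of the spectral sequence coming from the `t`-truncations of `Y`. -/
def truncAbutment (F : D ⥤ A) [F.IsHomological] (Y : D) : (truncCouple t F Y).Abutment where
  H m := F.obj (Y⟦m⟧)
  α p m := F.map (((t.truncGEπ (m + 1 - p)).app Y)⟦m⟧')
  α_i p p' m h := by
    have : (t.truncGEπ (m + 1 - p)).app Y ≫ truncI t Y (m + 1 - p) (m + 1 - p') (by lia) =
      (t.truncGEπ (m + 1 - p')).app Y := t.π_natTransTruncGEOfLE_app _ _ _ _
    change _ ≫ F.map ((truncI t Y (m + 1 - p) (m + 1 - p') (by lia))⟦m⟧') = _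
    rw [← F.map_comp, ← Functor.map_comp, this]

lemma trunc_nat_square {F F' : D ⥤ A} (η : F ⟶ F') {U U' V V' : D} (f : U ⟶ V) (f' : U' ⟶ V')
    (u : U ⟶ U') (v : V ⟶ V') (h : f ≫ v = u ≫ f') :
    F.map f ≫ η.app V ≫ F'.map v = (η.app U ≫ F'.map u) ≫ F'.map f' := by
  rw [assoc, ← F'.map_comp, ← h, F'.map_comp, ← assoc, ← assoc, η.naturality]

/-- The morphism between the exact couples coming from `t`-truncations which is induced by a
morphism of functors and a morphism `f : Y ⟶ Y'`. -/
def truncCoupleMap {F F' : D ⥤ A} [F.IsHomological] [F'.IsHomological] (η : F ⟶ F') {Y Y' : D}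
    (f : Y ⟶ Y') : (truncCouple t F Y).Hom (truncCouple t F' Y') where
  D p m := η.app _ ≫ F'.map (((t.truncGE (m + 1 - p)).map f)⟦m⟧')
  E p n := η.app _ ≫ F'.map (((t.truncGELE (n - p) (n - p)).map f)⟦n⟧')
  comm_i p p' m h := trunc_nat_square η _ _ _ _ (by
    rw [← Functor.map_comp, ← Functor.map_comp, truncI_naturality])
  comm_j p p' m n hp hn := trunc_nat_square η _ _ _ _
    (shiftConn_naturality _ _ _ _ (truncδ_naturality t f _ _ _) _ _ _)
  comm_k p p' n h := trunc_nat_square η _ _ _ _ (by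
    rw [← Functor.map_comp, ← Functor.map_comp, truncK_naturality])

end tTruncations

namespace Duality

open Triangulated

variable {C D A : Type*} [Category* C] [Preadditive C] [HasZeroObject C]
  [HasShift C ℤ] [∀ n : ℤ, (shiftFunctor C n).Additive] [Pretriangulated C]
  [Category* D] [Preadditive D] [HasZeroObject D]
  [HasShift D ℤ] [∀ n : ℤ, (shiftFunctor D n).Additive] [Pretriangulated D] [IsTriangulated D]
  [Category* A] [Abelian A]
  (Ψ : Duality C D A) {w : WeightStructure C} (t : TStructure D)

/-- The exact couple of the weight spectral sequence of the functor `Φ(-, Y)`. -/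
def weightCouple {X : C} (𝒯 : w.Tower X) (Y : D) : ExactCouple A 1 :=
  𝒯.couple (Ψ.Φ.flip.obj Y)

/-- The map of exact couples induced by a morphism of towers and a morphism `f : Y ⟶ Y'`. -/
def weightCoupleMap {X X' : C} {g : X ⟶ X'} {𝒯 : w.Tower X} {𝒯' : w.Tower X'} (φ : 𝒯.Hom 𝒯' g)
    {Y Y' : D} (f : Y ⟶ Y') : (Ψ.weightCouple 𝒯' Y).Hom (Ψ.weightCouple 𝒯 Y') :=
  φ.couple (Ψ.Φ.flip.map f)

/-- The weight spectral sequence `T` of the functor `Φ(-, Y)`, from its second page on. -/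
def T {X : C} (𝒯 : w.Tower X) (Y : D) : CohomologicalSpectralSequence A 2 :=
  (Ψ.weightCouple 𝒯 Y).spectralSequence 2 (by norm_num)

/-- The functoriality of the weight spectral sequence. -/
def TMap {X X' : C} {g : X ⟶ X'} {𝒯 : w.Tower X} {𝒯' : w.Tower X'} (φ : 𝒯.Hom 𝒯' g)
    {Y Y' : D} (f : Y ⟶ Y') : Ψ.T 𝒯' Y ⟶ Ψ.T 𝒯 Y' :=
  (Ψ.weightCoupleMap φ f).spectralSequence 2 (by norm_num)

/-- The abutment `H^m(X) = Φ(X⟦-m⟧, Y)` of the weight spectral sequence. -/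
def weightAbutment {X : C} (𝒯 : w.Tower X) (Y : D) : (Ψ.weightCouple 𝒯 Y).Abutment :=
  𝒯.abutment (Ψ.Φ.flip.obj Y)

/-- The exact couple coming from the `t`-truncations of `Y`. -/
def tCouple (X : C) (Y : D) : ExactCouple A 2 := truncCouple t (Ψ.Φ.obj (op X)) Y

/-- The map of exact couples induced by `g : X ⟶ X'` and `f : Y ⟶ Y'`. -/
def tCoupleMap {X X' : C} (g : X ⟶ X') {Y Y' : D} (f : Y ⟶ Y') :
    (Ψ.tCouple t X' Y).Hom (Ψ.tCouple t X Y') :=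
  truncCoupleMap t (Ψ.Φ.map g.op) f

/-- The spectral sequence `S` coming from the `t`-truncations of `Y`. -/
def S (X : C) (Y : D) : CohomologicalSpectralSequence A 2 :=
  (Ψ.tCouple t X Y).spectralSequence 2 (by norm_num)

/-- The functoriality of the spectral sequence coming from `t`-truncations. -/
def SMap {X X' : C} (g : X ⟶ X') {Y Y' : D} (f : Y ⟶ Y') : Ψ.S t X' Y ⟶ Ψ.S t X Y' :=
  (Ψ.tCoupleMap t g f).spectralSequence 2 (by norm_num)

/-- The abutment `Φ(X, Y⟦m⟧)` of the spectral sequence coming from `t`-truncations. -/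
def tAbutment (X : C) (Y : D) : (Ψ.tCouple t X Y).Abutment :=
  truncAbutment t (Ψ.Φ.obj (op X)) Y

/-- The functoriality of the abutment `Φ(X, Y⟦m⟧)`. -/
def tAbutmentMap {X X' : C} (g : X ⟶ X') {Y Y' : D} (f : Y ⟶ Y') (m : ℤ) :
    (Ψ.tAbutment t X' Y).H m ⟶ (Ψ.tAbutment t X Y').H m :=
  Ψ.map g (f⟦m⟧')

/-- The identification of the abutments `Φ(X⟦-m⟧, Y)` and `Φ(X, Y⟦m⟧)`. -/
def abutmentIso {X : C} (𝒯 : w.Tower X) (Y : D) (m : ℤ) :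
    (Ψ.weightAbutment 𝒯 Y).H m ≅ (Ψ.tAbutment t X Y).H m :=
  Ψ.shiftIso X Y m

/-- The map `Φ(X, t_{≤ k} (Y⟦m⟧)) ⟶ Φ(X, Y⟦m⟧)`. -/
def truncLEMap (X : C) (Y : D) (k m : ℤ) :
    Ψ.obj X ((t.truncLE k).obj (Y⟦m⟧)) ⟶ (Ψ.tAbutment t X Y).H m :=
  (Ψ.Φ.obj (op X)).map ((t.truncLEι k).app (Y⟦m⟧))

/-- Convergence of the spectral sequence `S` to `Φ(X, Y⟦p + q⟧)`. -/
abbrev SConvergence (X : C) (Y : D) :=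
  (Ψ.tAbutment t X Y).Convergence 2 (by norm_num)

/-- The complex `Φ(X^{1-j}, Y) ⟶ Φ(X^{-j}, Y) ⟶ Φ(X^{-1-j}, Y)` for a weight complex `X^*`. -/
def weightSc {X : C} (𝒯 : w.Tower X) (Y : D) (j : ℤ) : ShortComplex A where
  X₁ := Ψ.obj (𝒯.weightComplex.X (1 - j)) Y
  X₂ := Ψ.obj (𝒯.weightComplex.X (-j)) Y
  X₃ := Ψ.obj (𝒯.weightComplex.X (-1 - j)) Y
  f := (Ψ.Φ.map (𝒯.weightComplex.d (-j) (1 - j)).op).app Y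
  g := (Ψ.Φ.map (𝒯.weightComplex.d (-1 - j) (-j)).op).app Y
  zero := by
    change (Ψ.Φ.flip.obj Y).map _ ≫ (Ψ.Φ.flip.obj Y).map _ = 0
    rw [← Functor.map_comp, ← op_comp, HomologicalComplex.d_comp_d, op_zero, Functor.map_zero]

lemma map_square {U U' V V' : C} (f : U ⟶ V) (f' : U' ⟶ V') (u : U ⟶ U') (v : V ⟶ V')
    (h : u ≫ f' = f ≫ v) {Y Y' : D} (y : Y ⟶ Y') :
    Ψ.map v y ≫ (Ψ.Φ.map f.op).app Y' = (Ψ.Φ.map f'.op).app Y ≫ Ψ.map u y := by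
  rw [map, map, assoc, (Ψ.Φ.map f.op).naturality, ← assoc, ← assoc, ← NatTrans.comp_app,
    ← NatTrans.comp_app, ← Functor.map_comp, ← Functor.map_comp, ← op_comp, ← op_comp, h]

/-- The functoriality of the complex `Φ(X^{1-j}, Y) ⟶ Φ(X^{-j}, Y) ⟶ Φ(X^{-1-j}, Y)`. -/
def weightScMap {X X' : C} {g : X ⟶ X'} {𝒯 : w.Tower X} {𝒯' : w.Tower X'} (φ : 𝒯.Hom 𝒯' g)
    {Y Y' : D} (f : Y ⟶ Y') (j : ℤ) : Ψ.weightSc 𝒯' Y j ⟶ Ψ.weightSc 𝒯 Y' j where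
  τ₁ := Ψ.map (φ.weightComplex.f (1 - j)) f
  τ₂ := Ψ.map (φ.weightComplex.f (-j)) f
  τ₃ := Ψ.map (φ.weightComplex.f (-1 - j)) f
  comm₁₂ := Ψ.map_square _ _ _ _ (φ.weightComplex.comm _ _) f
  comm₂₃ := Ψ.map_square _ _ _ _ (φ.weightComplex.comm _ _) f

end Duality

end WeightDuality

end

open Triangulated WeightDuality

open CategoryTheory Category Limits Opposite

noncomputable section

set_option linter.unusedSectionVars false

namespace WeightDuality

open Pretriangulated

universe v u

/-! ### Maps of exact couples that respect `i` and `k`, but `j` only on kernels of iterates of `i`.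
-/

namespace ExactCouple

variable {A : Type u} [Category.{v} A] [Abelian A] {s s' s'' : ℕ}

namespace Hom

/-! Both spectral sequences come from exact couples, and the comparison takes place between the
derived couple of the weight couple and the couple of `t`-truncations. The derived `D`-term at `(p,
m)` is the image of `Φ(Y_{p+1}[-m], Y) → Φ(Y_p[-m], Y)`. By orthogonality this image does not change
when `Y` is replaced by `t_{≥ m+1-p} Y`, and for an object `V` of `D^{t ≥ m+1-p}` it is all of
`Φ(X[-m], V)` (`Orthogonal.isIso_coupleMap_derived_D`, `Orthogonal.isIso_edgeMap`). Hence it is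
`Φ(X, (t_{≥ m+1-p} Y)[m])`, a `D`-term of the other couple (`Orthogonal.dIso`). In the same way
`gr_p[-n]` is orthogonal to everything strictly above or strictly below `t`-degree `n - p`, so the
second page at `(p, n)` sees only `t_{= n-p} Y`, and `k` identifies it with `Φ(X, (t_{= n-p} Y)[n])`
(`Orthogonal.eIso`). These isomorphisms commute with `i` and `k` by naturality.

Without niceness there is no reason for them to commute with `j`, which involves the connecting
morphisms of triangles in `C` on one side and in `D` on the other. The pages agree nevertheless: for
a couple starting at `E_2`, the term `E_r` is the quotient of `k^{-1}(Im i^{r-2})` by `j(Ker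
i^{r-2})`, so it suffices that the subobjects `j(Ker i^a)` correspond. This is the notion `KHom`; it
passes to derived couples, and the resulting maps on later pages depend only on those on the first
one (`KHom.derived_E_ext`), which gives inverses and naturality at once. The correspondence of the
`j(Ker i^a)` is obtained by truncation: an element killed by `i^a` comes from the couple of some
`t_{< b} Y` whose `D`-term `a` steps further is zero. There the image of `j` is the kernel of `k`,
which is respected, and every preimage under `j` is automatically killed by `i^a`
(`exists_j_of_lift`, `tCouple_exists_lift`).

Since the identification of `D`-terms also matches the maps from the abutments
(`Orthogonal.α'_dIso_hom`), filtrations and representing elements correspond. If `X` is bounded, the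
`D`-terms of `S` vanish for small `p` and equal the abutment for large `p`, which forces
convergence. For a nice duality, extending a compatible pair to a triple yields exactly the missing
compatibility with `j` (`IsNice.comp_connecting`). Finally, the first page of `T` is, up to signs,
`Φ` applied to the weight complex, so its homology is computed by the same identification of the
second page. -/

@[ext]
lemma ext' {c c' : ExactCouple A s} {f g : Hom c c'} (hD : ∀ p m, f.D p m = g.D p m)
    (hE : ∀ p n, f.E p n = g.E p n) : f = g := by
  cases f; cases g
  obtain rfl : _ = _ := funext fun p => funext fun m => hD p m
  obtain rfl : _ = _ := funext fun p => funext fun m => hE p m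
  rfl

/-- The composition of morphisms of exact couples. -/
@[simps]
def comp {c c' c'' : ExactCouple A s} (f : Hom c c') (g : Hom c' c'') : Hom c c'' where
  D p m := f.D p m ≫ g.D p m
  E p n := f.E p n ≫ g.E p n
  comm_i p p' m h := by rw [← assoc, f.comm_i, assoc, g.comm_i, assoc]
  comm_j p p' m n hp hn := by rw [← assoc, f.comm_j, assoc, g.comm_j, assoc]
  comm_k p p' n h := by rw [← assoc, f.comm_k, assoc, g.comm_k, assoc]

lemma derived_comp {c c' c'' : ExactCouple A s} (f : Hom c c') (g : Hom c' c'') :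
    (f.comp g).derived = f.derived.comp g.derived := by
  ext p m
  · change (f.comp g).D' p m = f.D' p m ≫ g.D' p m
    rw [← cancel_mono (c''.ι p m), assoc, D'_ι, D'_ι, ← assoc, D'_ι, assoc]
    rfl
  · exact ShortComplex.homologyMap_comp (f.scAt p m) (g.scAt p m)

end Hom

/-- A generalized element of `D p m` is killed by the `a`-th iterate of `i`. -/
def Killed (c : ExactCouple A s) : (a : ℕ) → (p m : ℤ) → {Z : A} → (Z ⟶ c.D p m) → Prop
  | 0, _, _, _, x => x = 0
  | a + 1, p, m, _, x => ∀ p' (h : p' + 1 = p), Killed c a p' m (x ≫ c.i p p' m h)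

lemma killed_comp (c : ExactCouple A s) {a : ℕ} {p m : ℤ} {Z Z' : A} (f : Z' ⟶ Z)
    {x : Z ⟶ c.D p m} (hx : c.Killed a p m x) : c.Killed a p m (f ≫ x) := by
  induction a generalizing p with
  | zero => exact (congrArg (f ≫ ·) hx).trans comp_zero
  | succ a ih => intro p' h; rw [assoc]; exact ih (hx p' h)

/-- The inclusion of the derived `D`-terms is a monomorphism commuting with `i`, so nothing changes
when the iterates are formed in the original couple. -/
lemma killed_derived_iff (c : ExactCouple A s) {a : ℕ} {p m : ℤ} {Z : A} (x : Z ⟶ c.D' p m) :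
    c.derived.Killed a p m x ↔ c.Killed a p m (x ≫ c.ι p m) := by
  induction a generalizing p with
  | zero =>
    change x = 0 ↔ x ≫ c.ι p m = 0
    rw [← cancel_mono (c.ι p m), zero_comp]
  | succ a ih =>
    refine forall₂_congr fun p' h => ?_
    refine (ih (x ≫ c.i' p p' m h)).trans ?_
    rw [assoc, assoc, i'_ι]

lemma killed_map {c : ExactCouple A s} {c' : ExactCouple A s'} (δ : ∀ p m, c.D p m ⟶ c'.D p m)
    (hδ : ∀ p p' m h, c.i p p' m h ≫ δ p' m = δ p m ≫ c'.i p p' m h) {a : ℕ} {p m : ℤ} {Z : A}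
    {x : Z ⟶ c.D p m} (hx : c.Killed a p m x) : c'.Killed a p m (x ≫ δ p m) := by
  induction a generalizing p with
  | zero => exact (congrArg (· ≫ δ p m) hx).trans zero_comp
  | succ a ih =>
    intro p' h
    have := ih (hx p' h)
    rwa [assoc, hδ, ← assoc] at this

lemma killed_one_iff (c : ExactCouple A s) {p p' m : ℤ} (h : p' + 1 = p) {Z : A}
    (x : Z ⟶ c.D p m) : c.Killed 1 p m x ↔ x ≫ c.i p p' m h = 0 := by
  refine ⟨fun hx => hx p' h, fun hx p'' h' => ?_⟩
  obtain rfl : p' = p'' := by lia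
  exact hx

lemma d_eq (c : ExactCouple A s) (p p₁ p' n n' : ℤ) (h₁ : p + 1 = p₁) (hp : p + s = p')
    (hn : n + 1 = n') :
    c.d p p' n n' hp hn = c.k p p₁ n h₁ ≫ c.j p₁ p' n n' (by lia) hn := by
  subst h₁; rfl

/-- Maps between the terms of two exact couples which are compatible with the maps `i` and `k`,
and which are compatible with the images under `j` of the kernels of all iterates of `i`. -/
structure KHom (c : ExactCouple A s) (c' : ExactCouple A s') where
  D (p m : ℤ) : c.D p m ⟶ c'.D p m
  E (p n : ℤ) : c.E p n ⟶ c'.E p n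
  comm_i (p p' m : ℤ) (h : p' + 1 = p) : c.i p p' m h ≫ D p' m = D p m ≫ c'.i p p' m h
  comm_k (p p' n : ℤ) (h : p + 1 = p') : c.k p p' n h ≫ D p' n = E p n ≫ c'.k p p' n h
  -- Only a propositional equality: for the iterates below, starting pages such as `s + (a + 1)` and
  -- `s + 1 + a` have to be compared.
  eq_s : s = s'
  -- The element `x'` is not required to be the image of `x`: only the subobjects `j(Ker i^a)` have
  -- to be matched, and these are what is divided out on later pages. All `a` are needed together
  -- because one derivation consumes one of them.
  exists_j (a : ℕ) (p p' m n : ℤ) (hp : p' + 1 = p + s) (hn : m + 1 = n) {Z : A}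
    (x : Z ⟶ c.D p m) (hx : c.Killed a p m x) :
    ∃ (Z' : A) (π : Z' ⟶ Z) (_ : Epi π) (x' : Z' ⟶ c'.D p m), c'.Killed a p m x' ∧
      π ≫ x ≫ c.j p p' m n hp hn ≫ E p' n = x' ≫ c'.j p p' m n (eq_s ▸ hp) hn

namespace KHom

variable {c : ExactCouple A s} {c' : ExactCouple A s'} (F : KHom c c')

lemma ι_D_j (p p' m n : ℤ) (hp : p' + 1 = p + s') (hn : m + 1 = n) :
    c.ι p m ≫ F.D p m ≫ c'.j p p' m n hp hn = 0 := by
  rw [← cancel_epi (c.ε p m), ← assoc, ε_ι, ← assoc, F.comm_i, assoc, i_j, comp_zero, comp_zero]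

/-- The map between the `D`-terms of the derived couples. -/
def D' (p m : ℤ) : c.D' p m ⟶ c'.D' p m :=
  c'.liftι (c.ι p m ≫ F.D p m) (by rw [assoc, F.ι_D_j])

lemma D'_ι (p m : ℤ) : F.D' p m ≫ c'.ι p m = c.ι p m ≫ F.D p m :=
  c'.liftι_ι _ _

lemma ε_D' (p m : ℤ) : c.ε p m ≫ F.D' p m = F.D (p + 1) m ≫ c'.ε p m := by
  rw [← cancel_mono (c'.ι p m), assoc, assoc, D'_ι, ε_ι, ← assoc, ε_ι, F.comm_i]

/-- An element is a cycle if and only if its image under `k` lies in the kernel of `j`, that is, in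
the image of `i`, and `D` preserves the latter. So cycles go to cycles although `E` need not commute
with the differentials. -/
lemma iCycles_E_g (p n : ℤ) : ((c.scAt p n).iCycles ≫ F.E p n) ≫ (c'.scAt p n).g = 0 := by
  have h : ((c.scAt p n).iCycles ≫ c.k p (p + 1) n rfl) ≫
      c.j (p + 1) (p + s) n (n + 1) (by lia) rfl = 0 := by
    rw [assoc]
    exact (c.scAt p n).iCycles_g
  have h' := (c.exact_ι_j (p + 1) (p + s) n (n + 1) (by lia) rfl).lift_f _ h
  dsimp only at h' ⊢
  rw [c'.d_eq p (p + 1) _ n _ rfl, assoc, ← assoc (F.E p n), ← F.comm_k, ← assoc, ← assoc,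
    ← h', assoc, assoc, F.ι_D_j, comp_zero]

/-- The map between the cycles. -/
def cyclesMap (p n : ℤ) : (c.scAt p n).cycles ⟶ (c'.scAt p n).cycles :=
  (c'.scAt p n).liftCycles _ (F.iCycles_E_g p n)

lemma cyclesMap_i (p n : ℤ) :
    F.cyclesMap p n ≫ (c'.scAt p n).iCycles = (c.scAt p n).iCycles ≫ F.E p n :=
  ShortComplex.liftCycles_i _ _ _

/-- A boundary is `j` of an element in the image of `k`, hence of one killed by `i`. The case `a =
1` of `exists_j` turns it into `j` of another element killed by `i`, which by exactness comes from
`k`; so the image is a boundary again. -/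
lemma toCycles_cyclesMap_π (p n : ℤ) :
    (c.scAt p n).toCycles ≫ F.cyclesMap p n ≫ (c'.scAt p n).homologyπ = 0 := by
  obtain rfl := F.eq_s
  rw [← assoc, ShortComplex.comp_homologyπ_eq_zero_iff_up_to_refinements]
  obtain ⟨Z, π, hπ, x, hx, hx'⟩ := F.exists_j 1 (p - s + 1) p (n - 1) n (by lia) (by lia)
    (c.k (p - s) (p - s + 1) (n - 1) rfl) ((c.killed_one_iff rfl _).2 (c.k_i _ _ _ _))
  rw [c'.killed_one_iff (p' := p - s) rfl] at hx
  obtain ⟨Z', π', hπ', y, hy⟩ :=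
    (c'.exact_k_i (p - s) (p - s + 1) (n - 1) rfl).exact_up_to_refinements x hx
  refine ⟨Z', π' ≫ π, inferInstance, y, ?_⟩
  rw [← cancel_mono (c'.scAt p n).iCycles, assoc, assoc, assoc, cyclesMap_i, assoc,
    ShortComplex.toCycles_i, ShortComplex.toCycles_i_assoc]
  dsimp only at hy ⊢
  rw [d_eq _ _ _ _ _ _ rfl, d_eq _ _ _ _ _ _ rfl, assoc, hx', ← assoc, ← assoc, hy]

/-- The map between the `E`-terms of the derived couples. -/
def E' (p n : ℤ) : (c.scAt p n).homology ⟶ (c'.scAt p n).homology :=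
  (c.scAt p n).descHomology (F.cyclesMap p n ≫ (c'.scAt p n).homologyπ)
    (F.toCycles_cyclesMap_π p n)

lemma π_E' (p n : ℤ) : (c.scAt p n).homologyπ ≫ F.E' p n =
    F.cyclesMap p n ≫ (c'.scAt p n).homologyπ :=
  ShortComplex.π_descHomology _ _ _

lemma j_E_g (p p' m n : ℤ) (hp : p' + 1 = p + s) (hn : m + 1 = n) :
    (c.j p p' m n hp hn ≫ F.E p' n) ≫ (c'.scAt p' n).g = 0 := by
  rw [← (c.scAt p' n).liftCycles_i (c.j p p' m n hp hn) (c.j_d _ _ _ _ _ _ _ _ rfl rfl), assoc,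
    assoc, ← assoc (c.scAt p' n).iCycles, F.iCycles_E_g, comp_zero]

lemma j'_E' (p p' m n : ℤ) (hp : p' + 1 = p + (s + 1 : ℕ)) (hn : m + 1 = n) :
    c.ε p m ≫ c.j' p p' m n hp hn ≫ F.E' p' n =
      (c'.scAt p' n).liftCycles (c.j (p + 1) p' m n (by lia) hn ≫ F.E p' n)
        (F.j_E_g _ _ _ _ _ _) ≫ (c'.scAt p' n).homologyπ := by
  rw [← assoc, ε_j', assoc, π_E', ← assoc]
  congr 1
  rw [← cancel_mono (c'.scAt p' n).iCycles, assoc, cyclesMap_i, ShortComplex.liftCycles_i,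
    ShortComplex.liftCycles_i_assoc]

/-- The map `j` of the derived couple is `j` of a preimage under `i`, so the condition for `a` on
the derived couples is the condition for `a + 1` on the original ones. -/
lemma exists_j' (a : ℕ) (p p' m n : ℤ) (hp : p' + 1 = p + (s + 1 : ℕ)) (hn : m + 1 = n) {Z : A}
    (x : Z ⟶ c.D' p m) (hx : c.derived.Killed a p m x) :
    ∃ (Z' : A) (π : Z' ⟶ Z) (_ : Epi π) (x' : Z' ⟶ c'.D' p m), c'.derived.Killed a p m x' ∧
      π ≫ x ≫ c.j' p p' m n hp hn ≫ F.E' p' n =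
        x' ≫ c'.j' p p' m n (by have := F.eq_s; lia) hn := by
  obtain ⟨Z₁, π₁, hπ₁, x₁, hx₁⟩ := surjective_up_to_refinements_of_epi (c.ε p m) x
  -- The preimage sits at `p + 1`, and one application of `i` brings it back to `x`.
  have hk : c.Killed (a + 1) (p + 1) m x₁ := by
    intro p'' h
    obtain rfl : p = p'' := by lia
    rw [← ε_ι, ← assoc, ← hx₁, assoc]
    exact c.killed_comp _ ((c.killed_derived_iff x).1 hx)
  obtain ⟨Z₂, π₂, hπ₂, x₂, hx₂, h₂⟩ :=
    F.exists_j (a + 1) (p + 1) p' m n (by lia) hn x₁ hk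
  refine ⟨Z₂, π₂ ≫ π₁, inferInstance, x₂ ≫ c'.ε p m, ?_, ?_⟩
  · have := hx₂ p rfl
    rw [← ε_ι, ← assoc] at this
    exact (c'.killed_derived_iff _).2 this
  · rw [assoc, ← assoc π₁, hx₁, assoc, j'_E', assoc, ε_j', ← assoc, ← assoc, ← assoc]
    congr 1
    rw [← cancel_mono (c'.scAt p' n).iCycles]
    simp only [assoc, ShortComplex.liftCycles_i]
    exact h₂

/-- The maps between the terms of the derived couples. -/
def derived : KHom c.derived c'.derived where
  D := F.D'
  E := F.E'
  eq_s := congrArg (· + 1) F.eq_s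
  comm_i p p' m h := by
    change c.i' p p' m h ≫ _ = _ ≫ c'.i' p p' m h
    rw [← cancel_mono (c'.ι p' m), assoc, assoc, D'_ι, i'_ι, ← assoc, i'_ι, ← assoc, D'_ι,
      assoc, assoc, F.comm_i]
  comm_k p p' n h := by
    change c.k' p p' n h ≫ _ = _ ≫ c'.k' p p' n h
    rw [← cancel_mono (c'.ι p' n), assoc, assoc, D'_ι, k'_ι, ← assoc, k'_ι,
      ← cancel_epi (c.scAt p n).homologyπ, ← assoc, π_kD, ← assoc, π_E', assoc, assoc, π_kD,
      ← assoc (F.cyclesMap p n), cyclesMap_i, assoc, F.comm_k]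
  exists_j _ _ _ _ _ hp hn _ x hx := F.exists_j' _ _ _ _ _ hp hn x hx

/-- The maps `D` and the choices in `exists_j` leave no trace in the map on homology. Identities
between the maps `E` on one page therefore propagate to all later pages. -/
lemma derived_E_ext {F G : KHom c c'} (h : ∀ p n, F.E p n = G.E p n) (p n : ℤ) :
    F.derived.E p n = G.derived.E p n := by
  change F.E' p n = G.E' p n
  rw [← cancel_epi (c.scAt p n).homologyπ, π_E', π_E']
  congr 1
  rw [← cancel_mono (c'.scAt p n).iCycles, cyclesMap_i, cyclesMap_i, h]

/-- The identity maps. -/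
def id (c : ExactCouple A s) : KHom c c where
  D _ _ := 𝟙 _
  E _ _ := 𝟙 _
  comm_i := by simp
  comm_k := by simp
  eq_s := rfl
  exists_j a p p' m n hp hn Z x hx := ⟨Z, 𝟙 Z, inferInstance, x, hx, by simp⟩

lemma derived_id_E (c : ExactCouple A s) (p n : ℤ) : (id c).derived.E p n = 𝟙 _ := by
  change (id c).E' p n = 𝟙 _
  rw [← cancel_epi (c.scAt p n).homologyπ, π_E', comp_id]
  conv_rhs => rw [← id_comp (c.scAt p n).homologyπ]
  congr 1
  rw [← cancel_mono (c.scAt p n).iCycles, cyclesMap_i]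
  exact (comp_id _).trans (id_comp _).symm

/-- The maps between the terms of exact couples which are given by a morphism. -/
def ofHom {c c' : ExactCouple A s} (f : Hom c c') : KHom c c' where
  D := f.D
  E := f.E
  comm_i := f.comm_i
  comm_k := f.comm_k
  eq_s := rfl
  exists_j a p p' m n hp hn Z x hx :=
    ⟨Z, 𝟙 Z, inferInstance, x ≫ f.D p m, killed_map f.D f.comm_i hx, by
      rw [id_comp, f.comm_j, assoc]⟩

lemma derived_ofHom_E {c c' : ExactCouple A s} (f : Hom c c') (p n : ℤ) :
    (ofHom f).derived.E p n = (ofHom f.derived).E p n := by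
  change (ofHom f).E' p n = ShortComplex.homologyMap (f.scAt p n)
  rw [← cancel_epi (c.scAt p n).homologyπ, π_E', ShortComplex.homologyπ_naturality]
  congr 1

/-- The composition of compatible maps. -/
@[simps D E]
def comp {c : ExactCouple A s} {c' : ExactCouple A s'} {c'' : ExactCouple A s''} (F : KHom c c')
    (G : KHom c' c'') : KHom c c'' where
  D p m := F.D p m ≫ G.D p m
  E p n := F.E p n ≫ G.E p n
  comm_i p p' m h := by rw [← assoc, F.comm_i, assoc, G.comm_i, assoc]
  comm_k p p' n h := by rw [← assoc, F.comm_k, assoc, G.comm_k, assoc]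
  eq_s := F.eq_s.trans G.eq_s
  exists_j a p p' m n hp hn Z x hx := by
    obtain ⟨Z₁, π₁, hπ₁, x₁, hx₁, h₁⟩ := F.exists_j a p p' m n hp hn x hx
    obtain ⟨Z₂, π₂, hπ₂, x₂, hx₂, h₂⟩ := G.exists_j a p p' m n (F.eq_s ▸ hp) hn x₁ hx₁
    refine ⟨Z₂, π₂ ≫ π₁, inferInstance, x₂, hx₂, ?_⟩
    rw [← h₂, ← assoc x₁, ← h₁]
    simp only [assoc]

lemma derived_comp_E {c : ExactCouple A s} {c' : ExactCouple A s'} {c'' : ExactCouple A s''}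
    (F : KHom c c') (G : KHom c' c'') (p n : ℤ) :
    (F.comp G).derived.E p n = F.derived.E p n ≫ G.derived.E p n := by
  change (F.comp G).E' p n = F.E' p n ≫ G.E' p n
  rw [← cancel_epi (c.scAt p n).homologyπ, π_E', ← assoc, π_E', assoc, π_E', ← assoc]
  congr 1
  rw [← cancel_mono (c''.scAt p n).iCycles, cyclesMap_i, assoc, cyclesMap_i, ← assoc,
    cyclesMap_i, assoc, comp_E]

/-- Compatibility with the maps `j`. -/
def CommJ : Prop := ∀ (p p' m n : ℤ) (hp : p' + 1 = p + s) (hp' : p' + 1 = p + s')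
  (hn : m + 1 = n), c.j p p' m n hp hn ≫ F.E p' n = F.D p m ≫ c'.j p p' m n hp' hn

lemma CommJ.derived {F : KHom c c'} (hF : F.CommJ) : F.derived.CommJ := by
  intro p p' m n hp hp' hn
  change c.j' p p' m n hp hn ≫ F.E' p' n = F.D' p m ≫ c'.j' p p' m n hp' hn
  rw [← cancel_epi (c.ε p m), j'_E', ← assoc, ε_D', assoc, ε_j', ← assoc]
  congr 1
  rw [← cancel_mono (c'.scAt p' n).iCycles, assoc, ShortComplex.liftCycles_i,
    ShortComplex.liftCycles_i]
  exact hF _ _ _ _ _ _ _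

lemma CommJ.comm_d {F : KHom c c'} (hF : F.CommJ) (p p' n n' : ℤ) (hp : p + s = p')
    (hp' : p + s' = p') (hn : n + 1 = n') :
    c.d p p' n n' hp hn ≫ F.E p' n' = F.E p n ≫ c'.d p p' n n' hp' hn := by
  rw [d_eq _ _ _ _ _ _ rfl, d_eq _ _ _ _ _ _ rfl, assoc, hF _ _ _ _ _ (by lia), ← assoc,
    F.comm_k, assoc]

end KHom

end ExactCouple

/-! ### From compatible maps of couples to the pages of their spectral sequences. -/

namespace ExactCouple

variable {A : Type u} [Category.{v} A] [Abelian A] {s s' s'' : ℕ}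

section pages

variable (c : ExactCouple A s)

lemma scIso_hom_τ₂ (p₀ p p₁ n₀ n n₁ : ℤ) (h₀ : p₀ + s = p) (h₁ : p + s = p₁) (hn₀ : n₀ + 1 = n)
    (hn₁ : n + 1 = n₁) : (c.scIso p₀ p p₁ n₀ n n₁ h₀ h₁ hn₀ hn₁).hom.τ₂ = 𝟙 (c.E p n) := by
  obtain rfl : p₀ = p - s := by lia
  obtain rfl : n₀ = n - 1 := by lia
  subst h₁ hn₁
  rfl

lemma pageScIso_hom_τ₂ (r : ℤ) (hr : (s : ℤ) = r) (a : ℤ × ℤ) :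
    (c.pageScIso r hr a).hom.τ₂ = 𝟙 (c.E a.1 (a.1 + a.2)) := by
  refine (congrArg (fun φ => 𝟙 (c.E a.1 (a.1 + a.2)) ≫ 𝟙 _ ≫ φ)
    (c.scIso_hom_τ₂ _ _ _ _ _ _ _ _ _ _)).trans ?_
  rw [id_comp, id_comp]

/-- The comparison of the cycles of a page with the cycles in an exact couple. -/
def pageCycles (r : ℤ) (hr : (s : ℤ) = r) (a : ℤ × ℤ) :
    (c.page r hr).cycles a ⟶ (c.scAt a.1 (a.1 + a.2)).cycles :=
  ShortComplex.cyclesMap (c.pageScIso r hr a).hom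

/-- The comparison of short complexes is the identity in the middle, so cycles of the page and
cycles in the couple have the same inclusion. -/
lemma pageCycles_i (r : ℤ) (hr : (s : ℤ) = r) (a : ℤ × ℤ) :
    c.pageCycles r hr a ≫ (c.scAt a.1 (a.1 + a.2)).iCycles = (c.page r hr).iCycles a := by
  refine (ShortComplex.cyclesMap_i (c.pageScIso r hr a).hom).trans ?_
  rw [pageScIso_hom_τ₂]
  exact comp_id _

lemma homologyπ_pageHomologyIso (r r' : ℤ) (hr : (s : ℤ) = r) (hr' : ((s + 1 : ℕ) : ℤ) = r')
    (a : ℤ × ℤ) : (c.page r hr).homologyπ a ≫ (c.pageHomologyIso r r' hr hr' a).hom =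
      c.pageCycles r hr a ≫ (c.scAt a.1 (a.1 + a.2)).homologyπ :=
  ShortComplex.homologyπ_naturality (c.pageScIso r hr a).hom

lemma iterIso_k_iterι {a b : ℕ} (h : a = b) (p p' n : ℤ) (hp : p + 1 = p') :
    (c.iterIso h p n).hom ≫ (c.iter b).k p p' n hp ≫ c.iterι p' n b =
      (c.iter a).k p p' n hp ≫ c.iterι p' n a := by
  subst h
  exact id_comp _

lemma iterIso_d {a b : ℕ} (h : a = b) (p p' n n' : ℤ) (hp : p + (s + a : ℕ) = p')
    (hp' : p + (s + b : ℕ) = p') (hn : n + 1 = n') :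
    (c.iter a).d p p' n n' hp hn ≫ (c.iterIso h p' n').hom =
      (c.iterIso h p n).hom ≫ (c.iter b).d p p' n n' hp' hn := by
  subst h
  exact (comp_id _).trans (id_comp _).symm

/-- Since `k` of a derived couple is induced by the previous `k` on cycles, passing to the next page
does not change the image of a cycle in the original `D`-terms. -/
lemma homologyπ_iso_pageK (r₀ : ℤ) (h₀ : (s : ℤ) ≤ r₀) (r r' : ℤ) (h : r + 1 = r') (hr : r₀ ≤ r)
    (a : ℤ × ℤ) :
    HomologicalComplex.homologyπ _ a ≫ ((c.spectralSequence r₀ h₀).iso r r' a h hr).hom ≫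
      c.pageK r₀ h₀ r' (by lia) a =
        HomologicalComplex.iCycles _ a ≫ c.pageK r₀ h₀ r hr a := by
  have h₁ := (c.iter (r - s).toNat).homologyπ_pageHomologyIso r r' (by lia) (by lia) a
  have h₂ := c.iterIso_k_iterι (a := (r - s).toNat + 1) (b := (r' - s).toNat) (by lia)
    a.1 (a.1 + 1) (a.1 + a.2) rfl
  have h₃ := (c.iter (r - s).toNat).pageCycles_i r (by lia) a
  refine (congrArg (_ ≫ ·) ((assoc _ _ _).trans (congrArg (_ ≫ ·) h₂))).trans ?_
  refine ((assoc _ _ _).symm.trans (congrArg (· ≫ _) h₁)).trans ?_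
  refine Eq.trans ?_ (congrArg (· ≫ c.pageK r₀ h₀ r hr a) h₃)
  change (_ ≫ _) ≫ (c.iter (r - s).toNat).k' _ _ _ _ ≫ (c.iter (r - s).toNat).ι _ _ ≫ _ =
    (_ ≫ _) ≫ (c.iter (r - s).toNat).k _ _ _ _ ≫ _
  rw [← assoc ((c.iter (r - s).toNat).k' _ _ _ _), k'_ι, assoc, ← assoc _ _ (c.iterι _ _ _), π_kD,
    assoc, assoc]

end pages

namespace KHom

variable {c : ExactCouple A s} {c' : ExactCouple A s'} (F : KHom c.derived c')

/-- The couple `c` starts one page earlier than `c'`, whence the offset: `c.derived` is the first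
iterate of `c`. -/
def iterate : (a : ℕ) → KHom (c.iter (a + 1)) (c'.iter a)
  | 0 => F
  | a + 1 => (iterate a).derived

lemma CommJ.iterate {F : KHom c.derived c'} (hF : F.CommJ) : (a : ℕ) → (F.iterate a).CommJ
  | 0 => hF
  | a + 1 => (iterate hF a).derived

/-- By `derived_E_ext`, commutativity of the squares of `E`-terms at the start is enough; no square
of `D`-terms enters. -/
lemma iterate_E_naturality {c₁ c₂ : ExactCouple A s} {c₁' c₂' : ExactCouple A s'}
    (F₁ : KHom c₁.derived c₁') (F₂ : KHom c₂.derived c₂') (f : Hom c₁ c₂) (f' : Hom c₁' c₂')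
    (h : ∀ p n, f.derived.E p n ≫ F₂.E p n = F₁.E p n ≫ f'.E p n) (a : ℕ) (p n : ℤ) :
    (f.iter (a + 1)).E p n ≫ (F₂.iterate a).E p n =
      (F₁.iterate a).E p n ≫ (f'.iter a).E p n := by
  induction a generalizing p n with
  | zero => exact h p n
  | succ a ih =>
    have := derived_E_ext (F := (ofHom (f.iter (a + 1))).comp (F₂.iterate a))
      (G := (F₁.iterate a).comp (ofHom (f'.iter a))) ih p n
    rw [derived_comp_E, derived_comp_E, derived_ofHom_E, derived_ofHom_E] at this
    exact this

/-- The iterated derivation of compatible maps in the other direction. -/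
def iterate' (G : KHom c' c.derived) : (a : ℕ) → KHom (c'.iter a) (c.iter (a + 1))
  | 0 => G
  | a + 1 => (iterate' G a).derived

lemma CommJ.iterate' {G : KHom c' c.derived} (hG : G.CommJ) : (a : ℕ) → (G.iterate' a).CommJ
  | 0 => hG
  | a + 1 => (iterate' hG a).derived

lemma iterate_E_iterate'_E (G : KHom c' c.derived) (h : ∀ p n, F.E p n ≫ G.E p n = 𝟙 _) (a : ℕ)
    (p n : ℤ) : (F.iterate a).E p n ≫ (G.iterate' a).E p n = 𝟙 _ := by
  induction a generalizing p n with
  | zero => exact h p n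
  | succ a ih =>
    have := derived_E_ext (F := (F.iterate a).comp (G.iterate' a)) (G := id _) ih p n
    rw [derived_comp_E, derived_id_E] at this
    exact this

lemma iterate'_E_iterate_E (G : KHom c' c.derived) (h : ∀ p n, G.E p n ≫ F.E p n = 𝟙 _) (a : ℕ)
    (p n : ℤ) : (G.iterate' a).E p n ≫ (F.iterate a).E p n = 𝟙 _ := by
  induction a generalizing p n with
  | zero => exact h p n
  | succ a ih =>
    have := derived_E_ext (F := (G.iterate' a).comp (F.iterate a)) (G := id _) ih p n
    rw [derived_comp_E, derived_id_E] at this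
    exact this

/-- The inclusion of the `D`-terms of an iterated derived couple into those of the derived
couple. -/
def iterιDerived (c : ExactCouple A s) (p m : ℤ) : (a : ℕ) → ((c.iter (a + 1)).D p m ⟶ c.derived.D p m)
  | 0 => 𝟙 _
  | a + 1 => (c.iter (a + 1)).ι p m ≫ iterιDerived c p m a

lemma iterιDerived_ι (c : ExactCouple A s) (p m : ℤ) (a : ℕ) :
    iterιDerived c p m a ≫ c.ι p m = c.iterι p m (a + 1) := by
  induction a with
  | zero => exact (id_comp _).trans (comp_id _).symm
  | succ a ih => exact (assoc _ _ _).trans (congrArg (_ ≫ ·) ih)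

lemma iterate_D_iterι (a : ℕ) (p m : ℤ) :
    (F.iterate a).D p m ≫ c'.iterι p m a = iterιDerived c p m a ≫ F.D p m := by
  induction a with
  | zero => exact (comp_id _).trans (id_comp _).symm
  | succ a ih =>
    have h := (F.iterate a).D'_ι p m
    refine (assoc _ _ _).symm.trans ((congrArg (· ≫ _) h).trans ((assoc _ _ _).trans ?_))
    exact (congrArg (_ ≫ ·) ih).trans (assoc _ _ _).symm

section spectralSequence

variable {c : ExactCouple A s} {c' : ExactCouple A (s + 1)} (F : KHom c.derived c')
  (G : KHom c' c.derived) (r₀ : ℤ) (h₀ : ((s + 1 : ℕ) : ℤ) ≤ r₀)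

/-- The map between the terms of the spectral sequences of `c` and `c'`. -/
def ssMap (r : ℤ) (hr : r₀ ≤ r) (a : ℤ × ℤ) :
    ((c.spectralSequence r₀ (by lia)).page r hr).X a ⟶ ((c'.spectralSequence r₀ h₀).page r hr).X a :=
  (c.iterIso (b := (r - (s + 1 : ℕ)).toNat + 1) (by lia) a.1 (a.1 + a.2)).hom ≫
    (F.iterate (r - (s + 1 : ℕ)).toNat).E a.1 (a.1 + a.2)

/-- The map between the terms of the spectral sequences of `c'` and `c`. -/
def ssInv (r : ℤ) (hr : r₀ ≤ r) (a : ℤ × ℤ) :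
    ((c'.spectralSequence r₀ h₀).page r hr).X a ⟶ ((c.spectralSequence r₀ (by lia)).page r hr).X a :=
  (G.iterate' (r - (s + 1 : ℕ)).toNat).E a.1 (a.1 + a.2) ≫
    (c.iterIso (b := (r - (s + 1 : ℕ)).toNat + 1) (by lia) a.1 (a.1 + a.2)).inv

/-- The isomorphism between the terms of the spectral sequences of `c` and `c'`. -/
def ssIso (h : ∀ p n, F.E p n ≫ G.E p n = 𝟙 _) (h' : ∀ p n, G.E p n ≫ F.E p n = 𝟙 _)
    (r : ℤ) (hr : r₀ ≤ r) (a : ℤ × ℤ) :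
    ((c.spectralSequence r₀ (by lia)).page r hr).X a ≅
      ((c'.spectralSequence r₀ h₀).page r hr).X a where
  hom := F.ssMap r₀ h₀ r hr a
  inv := G.ssInv r₀ h₀ r hr a
  hom_inv_id := by
    refine (assoc _ _ _).trans ((congrArg (_ ≫ ·) ((assoc _ _ _).symm.trans
      ((congrArg (· ≫ _) (iterate_E_iterate'_E F G h _ _ _)).trans (id_comp _)))).trans ?_)
    exact Iso.hom_inv_id _
  inv_hom_id := by
    refine (assoc _ _ _).trans ((congrArg (_ ≫ ·) (Iso.inv_hom_id_assoc _ _)).trans ?_)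
    exact iterate'_E_iterate_E F G h' _ _ _

lemma ssMap_naturality {c₁ c₂ : ExactCouple A s} {c₁' c₂' : ExactCouple A (s + 1)}
    (F₁ : KHom c₁.derived c₁') (F₂ : KHom c₂.derived c₂') (f : Hom c₁ c₂) (f' : Hom c₁' c₂')
    (h : ∀ p n, f.derived.E p n ≫ F₂.E p n = F₁.E p n ≫ f'.E p n)
    (r : ℤ) (hr : r₀ ≤ r) (a : ℤ × ℤ) :
    ((f.spectralSequence r₀ (by lia)).hom r hr).f a ≫ F₂.ssMap r₀ h₀ r hr a =
      F₁.ssMap r₀ h₀ r hr a ≫ ((f'.spectralSequence r₀ h₀).hom r hr).f a := by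
  change (f.iter (r - s).toNat).E a.1 (a.1 + a.2) ≫ _ ≫ _ =
    (_ ≫ _) ≫ (f'.iter (r - (s + 1 : ℕ)).toNat).E a.1 (a.1 + a.2)
  rw [← assoc, ← f.iterIso_naturality, assoc, iterate_E_naturality F₁ F₂ f f' h, assoc]

lemma iterate_E_k (a b : ℕ) (h : a = b + 1) (p p' n : ℤ) (hp : p + 1 = p') :
    ((c.iterIso h p n).hom ≫ (F.iterate b).E p n) ≫ (c'.iter b).k p p' n hp ≫ c'.iterι p' n b =
      ((c.iterIso h p n).hom ≫ (c.iter (b + 1)).k p p' n hp ≫ iterιDerived c p' n b) ≫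
        F.D p' n := by
  rw [assoc, ← assoc ((F.iterate _).E _ _), ← comm_k, assoc, iterate_D_iterι, assoc, assoc]

/-- From page `s + 1` on, the map induced by `k` factors through the derived `D`-terms, which is
where `F.D` is defined. The factor `κ` makes it possible to compare the images in the `D`-terms of
both couples. -/
lemma ssMap_pageK (r : ℤ) (hr : r₀ ≤ r) (a : ℤ × ℤ) :
    ∃ κ : ((c.spectralSequence r₀ (by lia)).page r hr).X a ⟶ c.D' (a.1 + 1) (a.1 + a.2),
      c.pageK r₀ (by lia) r hr a = κ ≫ c.ι _ _ ∧
      F.ssMap r₀ h₀ r hr a ≫ c'.pageK r₀ h₀ r hr a = κ ≫ F.D _ _ := by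
  refine ⟨(c.iterIso (b := (r - (s + 1 : ℕ)).toNat + 1) (by lia) a.1 (a.1 + a.2)).hom ≫
    (c.iter ((r - (s + 1 : ℕ)).toNat + 1)).k a.1 (a.1 + 1) (a.1 + a.2) rfl ≫
    iterιDerived c _ _ _, ?_, ?_⟩
  · refine Eq.trans (c.iterIso_k_iterι (b := (r - (s + 1 : ℕ)).toNat + 1)
      (by lia) _ _ _ _).symm ?_
    refine Eq.trans (congrArg (fun φ => _ ≫ _ ≫ φ) (iterιDerived_ι c _ _ _).symm) ?_
    exact (congrArg (_ ≫ ·) (assoc _ _ _).symm).trans (assoc _ _ _).symm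
  · exact F.iterate_E_k _ _ _ _ _ _ _

lemma CommJ.iterIso_comm_d {F : KHom c.derived c'} (hF : F.CommJ) (a b : ℕ) (h : a = b + 1)
    (p p' n n' : ℤ) (hp : p + (s + a : ℕ) = p') (hp' : p + (s + 1 + b : ℕ) = p')
    (hn : n + 1 = n') :
    ((c.iterIso h p n).hom ≫ (F.iterate b).E p n) ≫ (c'.iter b).d p p' n n' hp' hn =
      (c.iter a).d p p' n n' hp hn ≫ (c.iterIso h p' n').hom ≫ (F.iterate b).E p' n' := by
  rw [assoc, ← (hF.iterate b).comm_d _ _ _ _ (by lia) hp' hn, ← assoc, ← assoc,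
    c.iterIso_d h _ _ _ _ hp (by lia) hn]

lemma CommJ.iterIso'_comm_d {G : KHom c' c.derived} (hG : G.CommJ) (a b : ℕ) (h : a = b + 1)
    (p p' n n' : ℤ) (hp : p + (s + a : ℕ) = p') (hp' : p + (s + 1 + b : ℕ) = p')
    (hn : n + 1 = n') :
    ((G.iterate' b).E p n ≫ (c.iterIso h p n).inv) ≫ (c.iter a).d p p' n n' hp hn =
      (c'.iter b).d p p' n n' hp' hn ≫ (G.iterate' b).E p' n' ≫ (c.iterIso h p' n').inv := by
  rw [← assoc, (hG.iterate' b).comm_d _ _ _ _ hp' (by lia) hn, assoc, assoc]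
  congr 1
  rw [Iso.inv_comp_eq, ← assoc, ← c.iterIso_d h _ _ _ _ hp (by lia) hn, assoc, Iso.hom_inv_id,
    comp_id]

lemma CommJ.page_d_ssMap {F : KHom c.derived c'} (hF : F.CommJ) (r : ℤ) (hr : r₀ ≤ r)
    (a b : ℤ × ℤ) (hab : a + (r, 1 - r) = b) :
    F.ssMap r₀ h₀ r hr a ≫ ((c'.spectralSequence r₀ h₀).page r hr).d a b =
      ((c.spectralSequence r₀ (by lia)).page r hr).d a b ≫ F.ssMap r₀ h₀ r hr b := by
  refine (congrArg (_ ≫ ·) ((c'.iter _).page_d r (by lia) a b hab)).trans ?_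
  refine Eq.trans ?_ (congrArg (· ≫ F.ssMap r₀ h₀ r hr b)
    ((c.iter (r - s).toNat).page_d r (by lia) a b hab)).symm
  exact hF.iterIso_comm_d _ _ _ _ _ _ _ _ _ _

lemma CommJ.page_d_ssInv {G : KHom c' c.derived} (hG : G.CommJ) (r : ℤ) (hr : r₀ ≤ r)
    (a b : ℤ × ℤ) (hab : a + (r, 1 - r) = b) :
    G.ssInv r₀ h₀ r hr a ≫ ((c.spectralSequence r₀ (by lia)).page r hr).d a b =
      ((c'.spectralSequence r₀ h₀).page r hr).d a b ≫ G.ssInv r₀ h₀ r hr b := by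
  refine (congrArg (_ ≫ ·) ((c.iter _).page_d r (by lia) a b hab)).trans ?_
  refine Eq.trans ?_ (congrArg (· ≫ G.ssInv r₀ h₀ r hr b)
    ((c'.iter (r - (s + 1 : ℕ)).toNat).page_d r (by lia) a b hab)).symm
  exact hG.iterIso'_comm_d _ _ _ _ _ _ _ _ _ _

/-- On cycles, the map on the next page is the map on the present one followed by the class in
homology. The four numbers of derivations are independent variables because they will be expressions
in `r` that agree only propositionally; after substitution all transports are identities. -/
lemma homologyπ_iterate {a b b' a' : ℕ} (h₁ : a = b + 1) (h₂ : b + 1 = b')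
    (h₃ : a' = b' + 1) (h₄ : a + 1 = a') (p n : ℤ) {Z : A}
    (x : Z ⟶ ((c.iter a).scAt p n).cycles) (y : Z ⟶ ((c'.iter b).scAt p n).cycles)
    (h : (x ≫ ((c.iter a).scAt p n).iCycles) ≫ (c.iterIso h₁ p n).hom ≫ (F.iterate b).E p n =
      y ≫ ((c'.iter b).scAt p n).iCycles) :
    (x ≫ ((c.iter a).scAt p n).homologyπ) ≫ (c.iterIso h₄ p n).hom ≫ (c.iterIso h₃ p n).hom ≫
      (F.iterate b').E p n =
      (y ≫ ((c'.iter b).scAt p n).homologyπ) ≫ (c'.iterIso h₂ p n).hom := by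
  subst h₁ h₂ h₃
  have h' : (x ≫ ((c.iter (b + 1)).scAt p n).iCycles) ≫ (F.iterate b).E p n =
      y ≫ ((c'.iter b).scAt p n).iCycles :=
    (congrArg (fun φ => (x ≫ _) ≫ φ) (id_comp _)).symm.trans h
  have : y = x ≫ (F.iterate b).cyclesMap p n := by
    rw [← cancel_mono ((c'.iter b).scAt p n).iCycles, assoc, cyclesMap_i, ← h', assoc]
  subst this
  refine Eq.trans ?_ (comp_id _).symm
  refine (congrArg (fun φ => (x ≫ _) ≫ φ) ((id_comp _).trans (id_comp _))).trans ?_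
  exact (assoc _ _ _).trans ((congrArg (x ≫ ·) ((F.iterate b).π_E' p n)).trans (assoc _ _ _).symm)

lemma homologyπ_iterate' {a b b' a' : ℕ} (h₁ : a = b + 1) (h₂ : b + 1 = b')
    (h₃ : a' = b' + 1) (h₄ : a + 1 = a') (p n : ℤ) {Z : A}
    (x : Z ⟶ ((c.iter a).scAt p n).cycles) (y : Z ⟶ ((c'.iter b).scAt p n).cycles)
    (h : x ≫ ((c.iter a).scAt p n).iCycles =
      (y ≫ ((c'.iter b).scAt p n).iCycles) ≫ (G.iterate' b).E p n ≫ (c.iterIso h₁ p n).inv) :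
    (x ≫ ((c.iter a).scAt p n).homologyπ) ≫ (c.iterIso h₄ p n).hom =
      (y ≫ ((c'.iter b).scAt p n).homologyπ) ≫ (c'.iterIso h₂ p n).hom ≫ (G.iterate' b').E p n ≫
        (c.iterIso h₃ p n).inv := by
  subst h₁ h₂ h₃
  have h' : x ≫ ((c.iter (b + 1)).scAt p n).iCycles =
      (y ≫ ((c'.iter b).scAt p n).iCycles) ≫ (G.iterate' b).E p n :=
    h.trans (congrArg (fun φ => (y ≫ _) ≫ φ) (comp_id _))
  have : x = y ≫ (G.iterate' b).cyclesMap p n := by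
    rw [← cancel_mono ((c.iter (b + 1)).scAt p n).iCycles, assoc, cyclesMap_i, h', assoc]
  subst this
  refine (comp_id _).trans ?_
  refine Eq.trans ?_ (congrArg (fun φ => (y ≫ _) ≫ φ) ((id_comp _).trans (comp_id _))).symm
  exact (assoc _ _ _).trans
    ((congrArg (y ≫ ·) ((G.iterate' b).π_E' p n)).symm.trans (assoc _ _ _).symm)

/-- The map of pages given by compatible maps which commute with `j`. -/
def CommJ.pageMap {F : KHom c.derived c'} (hF : F.CommJ) (r : ℤ) (hr : r₀ ≤ r) :
    (c.spectralSequence r₀ (by lia)).page r hr ⟶ (c'.spectralSequence r₀ h₀).page r hr where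
  f := F.ssMap r₀ h₀ r hr
  comm' a b hab := hF.page_d_ssMap r₀ h₀ r hr a b hab

/-- The map of pages given by compatible maps in the other direction which commute with `j`. -/
def CommJ.pageInv {G : KHom c' c.derived} (hG : G.CommJ) (r : ℤ) (hr : r₀ ≤ r) :
    (c'.spectralSequence r₀ h₀).page r hr ⟶ (c.spectralSequence r₀ (by lia)).page r hr where
  f := G.ssInv r₀ h₀ r hr
  comm' a b hab := hG.page_d_ssInv r₀ h₀ r hr a b hab

/-- A map on homology is determined on cycles, and there both sides are the class of the image of
the cycle, by `homologyπ_iterate`. -/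
lemma CommJ.homologyMap_pageMap {F : KHom c.derived c'} (hF : F.CommJ) (r r' : ℤ) (a : ℤ × ℤ)
    (h : r + 1 = r') (hr : r₀ ≤ r) :
    HomologicalComplex.homologyMap (hF.pageMap r₀ h₀ r hr) a ≫
      ((c'.spectralSequence r₀ h₀).iso r r' a h hr).hom =
    ((c.spectralSequence r₀ (by lia)).iso r r' a h hr).hom ≫
      (hF.pageMap r₀ h₀ r' (by lia)).f a := by
  rw [← cancel_epi (HomologicalComplex.homologyπ _ a),
    HomologicalComplex.homologyπ_naturality_assoc]
  have h₁ := (c.iter (r - s).toNat).homologyπ_pageHomologyIso r r' (by lia) (by lia) a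
  have h₂ := (c'.iter (r - (s + 1 : ℕ)).toNat).homologyπ_pageHomologyIso r r' (by lia) (by lia) a
  have h₃ := (c.iter (r - s).toNat).pageCycles_i r (by lia) a
  have h₄ := (c'.iter (r - (s + 1 : ℕ)).toNat).pageCycles_i r (by lia) a
  have h₅ := F.homologyπ_iterate (a := (r - s).toNat) (b := (r - (s + 1 : ℕ)).toNat)
    (b' := (r' - (s + 1 : ℕ)).toNat) (a' := (r' - s).toNat) (by lia) (by lia) (by lia) (by lia)
    a.1 (a.1 + a.2) ((c.iter (r - s).toNat).pageCycles r (by lia) a)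
    (HomologicalComplex.cyclesMap (hF.pageMap r₀ h₀ r hr) a ≫
      (c'.iter (r - (s + 1 : ℕ)).toNat).pageCycles r (by lia) a) (by
      refine (congrArg (· ≫ F.ssMap r₀ h₀ r hr a) h₃).trans ?_
      refine Eq.trans ?_ (assoc _ _ _).symm
      refine Eq.trans ?_ (congrArg (HomologicalComplex.cyclesMap (hF.pageMap r₀ h₀ r hr) a ≫ ·)
        h₄).symm
      exact (HomologicalComplex.cyclesMap_i (hF.pageMap r₀ h₀ r hr) a).symm)
  refine Eq.trans ?_ (h₅.symm.trans ?_)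
  · refine (congrArg (_ ≫ ·) ((assoc _ _ _).symm.trans (congrArg (· ≫ _) h₂))).trans ?_
    refine (assoc _ _ _).symm.trans (congrArg (· ≫ _) (assoc _ _ _).symm)
  · refine (congrArg (· ≫ _) h₁.symm).trans ((assoc _ _ _).trans (congrArg (_ ≫ ·) ?_))
    exact (assoc _ _ _).symm

lemma CommJ.homologyMap_pageInv {G : KHom c' c.derived} (hG : G.CommJ) (r r' : ℤ) (a : ℤ × ℤ)
    (h : r + 1 = r') (hr : r₀ ≤ r) :
    HomologicalComplex.homologyMap (hG.pageInv r₀ h₀ r hr) a ≫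
      ((c.spectralSequence r₀ (by lia)).iso r r' a h hr).hom =
    ((c'.spectralSequence r₀ h₀).iso r r' a h hr).hom ≫
      (hG.pageInv r₀ h₀ r' (by lia)).f a := by
  rw [← cancel_epi (HomologicalComplex.homologyπ _ a),
    HomologicalComplex.homologyπ_naturality_assoc]
  have h₁ := (c.iter (r - s).toNat).homologyπ_pageHomologyIso r r' (by lia) (by lia) a
  have h₂ := (c'.iter (r - (s + 1 : ℕ)).toNat).homologyπ_pageHomologyIso r r' (by lia) (by lia) a
  have h₃ := (c.iter (r - s).toNat).pageCycles_i r (by lia) a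
  have h₄ := (c'.iter (r - (s + 1 : ℕ)).toNat).pageCycles_i r (by lia) a
  have h₅ := G.homologyπ_iterate' (a := (r - s).toNat) (b := (r - (s + 1 : ℕ)).toNat)
    (b' := (r' - (s + 1 : ℕ)).toNat) (a' := (r' - s).toNat) (by lia) (by lia) (by lia) (by lia)
    a.1 (a.1 + a.2)
    (HomologicalComplex.cyclesMap (hG.pageInv r₀ h₀ r hr) a ≫
      (c.iter (r - s).toNat).pageCycles r (by lia) a)
    ((c'.iter (r - (s + 1 : ℕ)).toNat).pageCycles r (by lia) a) (by
      refine Eq.trans ?_ (congrArg (· ≫ G.ssInv r₀ h₀ r hr a) h₄).symm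
      refine (assoc _ _ _).trans ?_
      refine (congrArg (HomologicalComplex.cyclesMap (hG.pageInv r₀ h₀ r hr) a ≫ ·) h₃).trans ?_
      exact HomologicalComplex.cyclesMap_i (hG.pageInv r₀ h₀ r hr) a)
  refine Eq.trans ?_ (h₅.trans ?_)
  · refine (congrArg (_ ≫ ·) ((assoc _ _ _).symm.trans (congrArg (· ≫ _) h₁))).trans ?_
    refine (assoc _ _ _).symm.trans (congrArg (· ≫ _) (assoc _ _ _).symm)
  · refine (congrArg (· ≫ _) h₂.symm).trans ((assoc _ _ _).trans (congrArg (_ ≫ ·) ?_))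
    exact (assoc _ _ _).symm

/-- The isomorphism of spectral sequences given by mutually inverse compatible maps which commute
with `j`. -/
def CommJ.spectralSequenceIso {F : KHom c.derived c'} {G : KHom c' c.derived} (hF : F.CommJ)
    (hG : G.CommJ) (h : ∀ p n, F.E p n ≫ G.E p n = 𝟙 _) (h' : ∀ p n, G.E p n ≫ F.E p n = 𝟙 _) :
    c.spectralSequence r₀ (by lia) ≅ c'.spectralSequence r₀ h₀ where
  hom :=
    { hom := hF.pageMap r₀ h₀
      comm := fun r r' a h hr => hF.homologyMap_pageMap r₀ h₀ r r' a h hr }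
  inv :=
    { hom := hG.pageInv r₀ h₀
      comm := fun r r' a h hr => hG.homologyMap_pageInv r₀ h₀ r r' a h hr }
  hom_inv_id := by
    ext r hr a
    exact (ssIso F G r₀ h₀ h h' r hr a).hom_inv_id
  inv_hom_id := by
    ext r hr a
    exact (ssIso F G r₀ h₀ h h' r hr a).inv_hom_id

end spectralSequence

end KHom

end ExactCouple

/-! ### Degeneration and convergence to an abutment. -/

namespace ExactCouple

variable {A : Type u} [Category.{v} A] [Abelian A] {s : ℕ}

instance mono_iterι (c : ExactCouple A s) (p m : ℤ) : (a : ℕ) → Mono (c.iterι p m a)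
  | 0 => inferInstanceAs (Mono (𝟙 (c.D p m)))
  | a + 1 => by
    have := mono_iterι c p m a
    exact mono_comp ((c.iter a).ι p m) (c.iterι p m a)

namespace Abutment

variable {c : ExactCouple A s} (h : c.Abutment)

lemma filtration_factors_iff {p m : ℤ} {Z : A} (x : Z ⟶ h.H m) :
    (h.filtration p m).Factors x ↔ x ≫ h.α p m = 0 :=
  ⟨fun hx => kernelSubobject_factors_iff _ _ |>.1 hx,
    fun hx => kernelSubobject_factors_iff _ _ |>.2 hx⟩

lemma filtration_eq_top {p m : ℤ} (hα : h.α p m = 0) : h.filtration p m = ⊤ := by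
  have hx := (h.filtration_factors_iff (p := p) (⊤ : Subobject (h.H m)).arrow).2
    (by rw [hα, comp_zero])
  exact top_unique (Subobject.le_of_comm (Subobject.factorThru _ _ hx)
    (Subobject.factorThru_arrow _ _ hx))

lemma filtration_eq_bot {p m : ℤ} (hα : Mono (h.α p m)) : h.filtration p m = ⊥ :=
  Subobject.mk_eq_bot_iff_zero.2 (kernel.ι_of_mono _)

/-- The maps from the abutment to the `D`-terms of the iterated derived couples. -/
def iterα : (a : ℕ) → (p m : ℤ) → (h.H m ⟶ (c.iter a).D p m)
  | 0, p, m => h.α p m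
  | a + 1, p, m => iterα a (p + 1) m ≫ (c.iter a).ε p m

lemma iterα_iterι (a : ℕ) (p m : ℤ) : h.iterα a p m ≫ c.iterι p m a = h.α p m := by
  induction a generalizing p with
  | zero => exact comp_id _
  | succ a ih =>
    have h₁ := h.α_i (p + 1) p m rfl
    have h₂ : ∀ b, c.iterι (p + 1) m b ≫ c.i (p + 1) p m rfl =
        (c.iter b).i (p + 1) p m rfl ≫ c.iterι p m b := by
      intro b
      induction b with
      | zero => exact (id_comp _).trans (comp_id _).symm
      | succ b ihb =>
        refine (assoc _ _ _).trans ((congrArg (_ ≫ ·) ihb).trans ?_)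
        refine (assoc _ _ _).symm.trans ((congrArg (· ≫ _) ((c.iter b).i'_ι _ _ _ _).symm).trans ?_)
        exact assoc _ _ _
    change (h.iterα a (p + 1) m ≫ (c.iter a).ε p m) ≫ (c.iter a).ι p m ≫ c.iterι p m a = _
    rw [assoc, ← assoc ((c.iter a).ε p m), ε_ι, ← h₂, ← assoc, ih, h₁]

lemma iterα_i (a : ℕ) (p p' m : ℤ) (hp : p' + 1 = p) :
    h.iterα a p m ≫ (c.iter a).i p p' m hp = h.iterα a p' m := by
  induction a generalizing p p' with
  | zero => exact h.α_i p p' m hp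
  | succ a ih =>
    subst hp
    refine (assoc _ _ _).trans ((congrArg (_ ≫ ·) ((c.iter a).ε_i' p' m)).trans ?_)
    exact (assoc _ _ _).symm.trans (congrArg (· ≫ _) (ih _ _ rfl))

/-- The `D`-term at `p` of the `a`-th derived couple is a quotient of the original one at `p + a`,
where the abutment already surjects. -/
lemma epi_iterα {P : ℤ} (hP : ∀ p m, P ≤ p → Epi (h.α p m)) (a : ℕ) (p m : ℤ) (hp : P ≤ p + a) :
    Epi (h.iterα a p m) := by
  induction a generalizing p with
  | zero => exact hP p m (by simpa using hp)
  | succ a ih =>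
    have := ih (p + 1) (by push_cast at hp; lia)
    exact epi_comp (h.iterα a (p + 1) m) ((c.iter a).ε p m)

/-- Either the `D`-term at `p` is zero, or `p > Q`, and then `p + a` is in the range where the
abutment surjects. -/
lemma epi_iterα_of_isZero {P Q : ℤ} (hP : ∀ p m, P ≤ p → Epi (h.α p m))
    (hQ : ∀ p m, p ≤ Q → IsZero (c.D p m)) (a : ℕ) (ha : P ≤ Q + a) (p m : ℤ) :
    Epi (h.iterα a p m) := by
  by_cases hp : p ≤ Q
  · have hz : IsZero ((c.iter a).D p m) :=
      IsZero.of_mono (c.iterι p m a) (hQ p m hp)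
    exact ⟨fun _ _ _ => hz.eq_of_src _ _⟩
  · exact h.epi_iterα hP a p m (by lia)

section

variable {a : ℕ} (ha : ∀ p m, Epi (h.iterα a p m))
include ha

/-- Every element of the `D`-term comes from the abutment, hence lifts along `i`, and `j` kills the
image of `i`. -/
lemma iter_j_eq_zero (p p' m n : ℤ) (hp : p' + 1 = p + (s + a : ℕ)) (hn : m + 1 = n) :
    (c.iter a).j p p' m n hp hn = 0 := by
  have := ha p m
  rw [← cancel_epi (h.iterα a p m), comp_zero, ← h.iterα_i a (p + 1) p m rfl, assoc, i_j,
    comp_zero]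

lemma iter_d_eq_zero (p p' n n' : ℤ) (hp : p + (s + a : ℕ) = p') (hn : n + 1 = n') :
    (c.iter a).d p p' n n' hp hn = 0 := by
  rw [d, h.iter_j_eq_zero ha, comp_zero]

lemma mono_iter_k (p p' n : ℤ) (hp : p + 1 = p') : Mono ((c.iter a).k p p' n hp) :=
  ((c.iter a).exact_j_k (p + 1 - (s + a : ℕ)) p p' (n - 1) n (by lia) (by lia) hp).mono_g
    (h.iter_j_eq_zero ha _ _ _ _ _ _)

lemma filtration_arrow_iterα_i (p n : ℤ) :
    ((h.filtration p n).arrow ≫ h.iterα a (p + 1) n) ≫ (c.iter a).i (p + 1) p n rfl = 0 := by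
  rw [assoc, iterα_i, ← cancel_mono (c.iterι p n a), assoc, iterα_iterι, zero_comp]
  exact kernelSubobject_arrow_comp _

/-- The map from the filtration of the abutment to the terms of the derived couple. -/
def iterEdge (p n : ℤ) : (h.filtration p n : A) ⟶ (c.iter a).E p n :=
  have : Mono ((c.iter a).k p (p + 1) n rfl) := h.mono_iter_k ha _ _ _ _
  have : Mono (ShortComplex.mk _ _ ((c.iter a).k_i p (p + 1) n rfl)).f := this
  ((c.iter a).exact_k_i p (p + 1) n rfl).lift _ (h.filtration_arrow_iterα_i ha p n)

lemma iterEdge_k (p n : ℤ) : h.iterEdge ha p n ≫ (c.iter a).k p (p + 1) n rfl =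
    (h.filtration p n).arrow ≫ h.iterα a (p + 1) n :=
  have : Mono ((c.iter a).k p (p + 1) n rfl) := h.mono_iter_k ha _ _ _ _
  have : Mono (ShortComplex.mk _ _ ((c.iter a).k_i p (p + 1) n rfl)).f := this
  ((c.iter a).exact_k_i p (p + 1) n rfl).lift_f _ _

/-- Lift the image of `y` under `k` locally to the abutment; the lift lies in `F^p` because `k`
followed by `i` is zero, and it maps to `y` because `k` is now a monomorphism. -/
lemma epi_iterEdge (p n : ℤ) : Epi (h.iterEdge ha p n) := by
  rw [epi_iff_surjective_up_to_refinements]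
  intro Z y
  have := ha (p + 1) n
  obtain ⟨Z', π, hπ, x, hx⟩ := surjective_up_to_refinements_of_epi (h.iterα a (p + 1) n)
    (y ≫ (c.iter a).k p (p + 1) n rfl)
  have hx' : x ≫ h.α p n = 0 := by
    rw [← h.iterα_iterι a, ← h.iterα_i a (p + 1) p n rfl, assoc, ← assoc, ← hx, assoc, assoc,
      ← assoc ((c.iter a).k _ _ _ _), k_i, zero_comp, comp_zero, comp_zero]
  have hx'' := (h.filtration_factors_iff x).2 hx'
  refine ⟨Z', π, hπ, Subobject.factorThru _ x hx'', ?_⟩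
  have := h.mono_iter_k ha p (p + 1) n rfl
  rw [← cancel_mono ((c.iter a).k p (p + 1) n rfl), assoc, assoc, hx, iterEdge_k, ← assoc,
    Subobject.factorThru_arrow]

end

section

variable (r₀ : ℤ) (h₀ : (s : ℤ) ≤ r₀)

lemma mono_pageK (r : ℤ) (hr : r₀ ≤ r) (ha : ∀ p m, Epi (h.iterα (r - s).toNat p m))
    (a : ℤ × ℤ) : Mono (c.pageK r₀ h₀ r hr a) := by
  have := h.mono_iter_k ha a.1 (a.1 + 1) (a.1 + a.2) rfl
  exact mono_comp ((c.iter (r - s).toNat).k a.1 (a.1 + 1) (a.1 + a.2) rfl) (c.iterι _ _ _)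

/-- Convergence of the spectral sequence of an exact couple whose `D`-terms vanish for small `p`
and are isomorphic to the abutment for large `p`. -/
def convergence (P Q : ℤ) (hP : ∀ p m, P ≤ p → IsIso (h.α p m))
    (hQ : ∀ p m, p ≤ Q → IsZero (c.D p m)) : h.Convergence r₀ h₀ :=
  have hepi (r : ℤ) (hr : max r₀ (P - Q + s) ≤ r) (p m : ℤ) : Epi (h.iterα (r - s).toNat p m) :=
    h.epi_iterα_of_isZero (fun p m hp => have := hP p m hp; inferInstance) hQ _ (by lia) p m
  have hrep (r : ℤ) (hr : max r₀ (P - Q + s) ≤ r) (a : ℤ × ℤ) :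
      h.Represents r₀ h₀ r ((le_max_left _ _).trans hr) a (Subobject.arrow _)
        (h.iterEdge (hepi r hr) a.1 (a.1 + a.2)) := by
    refine Eq.trans ?_ (assoc _ _ _)
    refine Eq.trans ?_ (congrArg (· ≫ c.iterι _ _ _)
      (h.iterEdge_k (hepi r hr) a.1 (a.1 + a.2)).symm)
    rw [assoc, iterα_iterι]
  have hd (r : ℤ) (hr : max r₀ (P - Q + s) ≤ r) (a b : ℤ × ℤ) :
      ((c.spectralSequence r₀ h₀).page r ((le_max_left _ _).trans hr)).d a b = 0 := by
    by_cases hab : a + (r, 1 - r) = b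
    · refine ((c.iter (r - s).toNat).page_d r (by lia) a b hab).trans ?_
      exact h.iter_d_eq_zero (hepi r hr) _ _ _ _ _ _
    · exact HomologicalComplex.shape _ _ _ hab
  -- From here on the number `a = r - s` of derivations satisfies `P ≤ Q + a`, which makes the
  -- abutment surject onto all `D`-terms.
  { r₁ := max r₀ (P - Q + s)
    le := le_max_left _ _
    exists_top := fun m => 
      ⟨Q, h.filtration_eq_top ((hQ Q m le_rfl).eq_of_tgt _ _)⟩
    exists_bot := fun m => ⟨P, by
      have := hP P m le_rfl
      exact h.filtration_eq_bot inferInstance⟩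
    d_eq_zero := hd
    edge := fun r hr a => h.iterEdge (hepi r hr) a.1 (a.1 + a.2)
    epi_edge := fun r hr a => h.epi_iterEdge (hepi r hr) a.1 (a.1 + a.2)
    edge_eq_zero_iff := fun r hr a Z x => by
      have := h.mono_pageK r₀ h₀ r ((le_max_left _ _).trans hr) (hepi r hr) a
      have h₁ := congrArg (x ≫ ·) (hrep r hr a)
      refine Iff.trans ?_ (h.filtration_factors_iff _).symm
      rw [assoc]
      constructor
      · intro h₂
        refine h₁.trans ((assoc _ _ _).symm.trans ((congrArg (· ≫ _) h₂).trans zero_comp))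
      · intro h₂
        refine (cancel_mono (c.pageK r₀ h₀ r ((le_max_left _ _).trans hr) a)).1 ?_
        exact (assoc _ _ _).trans (h₁.symm.trans (h₂.trans zero_comp.symm))
    represents := hrep
    edge_iso := fun r hr a => by
      have hr₀ : r₀ ≤ r := (le_max_left _ _).trans hr
      have := h.mono_pageK r₀ h₀ (r + 1) (by lia) (hepi (r + 1) (by lia)) a
      let K := (c.spectralSequence r₀ h₀).page r hr₀
      let x : (h.filtration a.1 (a.1 + a.2) : A) ⟶ K.X a := h.iterEdge (hepi r hr) a.1 (a.1 + a.2)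
      have hx : x ≫ K.d a ((ComplexShape.up' (⟨r, 1 - r⟩ : ℤ × ℤ)).next a) = 0 :=
        (congrArg (x ≫ ·) (hd r hr _ _)).trans comp_zero
      refine ⟨K.liftCycles x _ rfl hx, K.liftCycles_i _ _ _ _, ?_⟩
      -- A class on a stationary page is determined by its image in the `D`-term, and both classes
      -- represent the same element of the abutment.
      refine (cancel_mono (c.pageK r₀ h₀ (r + 1) _ a)).1 ?_
      refine Eq.trans ?_ (hrep (r + 1) (by lia) a)
      refine Eq.trans ?_ (hrep r hr a).symm
      refine (assoc _ _ _).trans ((congrArg (_ ≫ ·) (assoc _ _ _)).trans ?_)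
      refine (congrArg (_ ≫ ·) (c.homologyπ_iso_pageK r₀ h₀ r (r + 1) rfl hr₀ a)).trans ?_
      refine (assoc _ _ _).symm.trans (congrArg (· ≫ _) (K.liftCycles_i _ _ _ _)) }

lemma mono_pageK_of_convergence (P Q : ℤ) (hP : ∀ p m, P ≤ p → IsIso (h.α p m))
    (hQ : ∀ p m, p ≤ Q → IsZero (c.D p m)) (r : ℤ) (hr : (h.convergence r₀ h₀ P Q hP hQ).r₁ ≤ r)
    (a : ℤ × ℤ) :
    Mono (c.pageK r₀ h₀ r ((h.convergence r₀ h₀ P Q hP hQ).le.trans hr) a) := by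
  have hr' : max r₀ (P - Q + s) ≤ r := hr
  exact h.mono_pageK r₀ h₀ r _ (h.epi_iterα_of_isZero
    (fun p m hp => have := hP p m hp; inferInstance) hQ _ (by lia)) a

lemma pageK_naturality {c' : ExactCouple A s} (f : Hom c c') (r : ℤ) (hr : r₀ ≤ r) (a : ℤ × ℤ) :
    ((f.spectralSequence r₀ h₀).hom r hr).f a ≫ c'.pageK r₀ h₀ r hr a =
      c.pageK r₀ h₀ r hr a ≫ f.D _ _ := by
  have h₁ : ∀ b p m, (f.iter b).D p m ≫ c'.iterι p m b = c.iterι p m b ≫ f.D p m := by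
    intro b p m
    induction b with
    | zero => exact (comp_id _).trans (id_comp _).symm
    | succ b ih =>
      refine (assoc _ _ _).symm.trans ((congrArg (· ≫ _) ((f.iter b).D'_ι p m)).trans ?_)
      refine (assoc _ _ _).trans ((congrArg (_ ≫ ·) ih).trans (assoc _ _ _).symm)
  refine (assoc _ _ _).symm.trans ((congrArg (· ≫ _)
    ((f.iter (r - s).toNat).comm_k a.1 (a.1 + 1) (a.1 + a.2) rfl).symm).trans ?_)
  refine (assoc _ _ _).trans ((congrArg (_ ≫ ·) (h₁ _ _ _)).trans (assoc _ _ _).symm)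

/-- Where `pageK` is a monomorphism, a class is determined by what it represents, and representing
elements is preserved by morphisms of couples with abutments. -/
lemma edge_naturality {c' : ExactCouple A s} {h' : c'.Abutment} (f : Hom c c')
    (β : ∀ m, h.H m ⟶ h'.H m) (hβ : ∀ p m, h.α p m ≫ f.D p m = β m ≫ h'.α p m)
    (K : h.Convergence r₀ h₀) (K' : h'.Convergence r₀ h₀) (r : ℤ) (hr : K.r₁ ≤ r)
    (hr' : K'.r₁ ≤ r) (a : ℤ × ℤ) (hm : Mono (c'.pageK r₀ h₀ r (K'.le.trans hr') a)) {Z : A}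
    (x : Z ⟶ (h.filtration a.1 (a.1 + a.2) : A)) (x' : Z ⟶ (h'.filtration a.1 (a.1 + a.2) : A))
    (hx : x ≫ Subobject.arrow _ ≫ β (a.1 + a.2) = x' ≫ Subobject.arrow _) :
    x ≫ K.edge r hr a ≫ ((f.spectralSequence r₀ h₀).hom r (K.le.trans hr)).f a =
      x' ≫ K'.edge r hr' a := by
  rw [← cancel_mono (c'.pageK r₀ h₀ r (K'.le.trans hr') a)]
  have h₁ := K.represents r hr a
  have h₂ := K'.represents r hr' a
  dsimp only [Represents] at h₁ h₂
  rw [assoc, assoc, pageK_naturality, assoc, ← h₂, ← assoc (K.edge r hr a), ← h₁, assoc, hβ,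
    ← assoc, ← assoc, assoc x, hx, assoc]

end

end Abutment

end ExactCouple

/-! ### Coherence of shifts. -/

section shiftIsos

variable {C : Type*} [Category* C] [HasShift C ℤ]

/-- The isomorphism `X⟦0⟧ ≅ X`. -/
def zeroIso (X : C) : X⟦(0 : ℤ)⟧ ≅ X := (shiftFunctorZero C ℤ).app X

/-- The isomorphism `X⟦c⟧ ≅ X⟦a⟧⟦b⟧` for `a + b = c`. -/
def addIso (X : C) (a b c : ℤ) (h : a + b = c) : X⟦c⟧ ≅ X⟦a⟧⟦b⟧ := (shiftFunctorAdd' C a b c h).app X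

lemma zeroIso_naturality {X Y : C} (f : X ⟶ Y) :
    f⟦(0 : ℤ)⟧' ≫ (zeroIso Y).hom = (zeroIso X).hom ≫ f :=
  (shiftFunctorZero C ℤ).hom.naturality f

lemma zeroIso_inv_naturality {X Y : C} (f : X ⟶ Y) :
    (zeroIso X).inv ≫ f⟦(0 : ℤ)⟧' = f ≫ (zeroIso Y).inv :=
  ((shiftFunctorZero C ℤ).inv.naturality f).symm

lemma addIso_naturality {X Y : C} (f : X ⟶ Y) (a b c : ℤ) (h : a + b = c) :
    f⟦c⟧' ≫ (addIso Y a b c h).hom = (addIso X a b c h).hom ≫ f⟦a⟧'⟦b⟧' :=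
  (shiftFunctorAdd' C a b c h).hom.naturality f

lemma addIso_inv_naturality {X Y : C} (f : X ⟶ Y) (a b c : ℤ) (h : a + b = c) :
    (addIso X a b c h).inv ≫ f⟦c⟧' = f⟦a⟧'⟦b⟧' ≫ (addIso Y a b c h).inv :=
  ((shiftFunctorAdd' C a b c h).inv.naturality f).symm

lemma addIso_zero_left (X : C) (a : ℤ) (h : 0 + a = a) :
    (addIso X 0 a a h).inv = (zeroIso X).hom⟦a⟧' :=
  shiftFunctorAdd'_zero_add_inv_app a X

lemma addIso_zero_right (X : C) (a : ℤ) (h : a + 0 = a) :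
    (addIso X a 0 a h).inv = (zeroIso (X⟦a⟧)).hom :=
  shiftFunctorAdd'_add_zero_inv_app a X

lemma addIso_assoc (X : C) (a b c ab bc abc : ℤ) (hab : a + b = ab) (hbc : b + c = bc)
    (h₁ : ab + c = abc) (h₂ : a + bc = abc) :
    (addIso X ab c abc h₁).hom ≫ (addIso X a b ab hab).hom⟦c⟧' =
      (addIso X a bc abc h₂).hom ≫ (addIso (X⟦a⟧) b c bc hbc).hom :=
  shiftFunctorAdd'_assoc_hom_app a b c ab bc abc hab hbc (by lia) X

lemma addIso_assoc_inv (X : C) (a b c ab bc abc : ℤ) (hab : a + b = ab) (hbc : b + c = bc)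
    (h₁ : ab + c = abc) (h₂ : a + bc = abc) :
    (addIso X a b ab hab).inv⟦c⟧' ≫ (addIso X ab c abc h₁).inv =
      (addIso (X⟦a⟧) b c bc hbc).inv ≫ (addIso X a bc abc h₂).inv :=
  shiftFunctorAdd'_assoc_inv_app a b c ab bc abc hab hbc (by lia) X

lemma addIso_congr (X : C) (a b c c' : ℤ) (h : a + b = c) (h' : a + b = c') (hc : c' = c) :
    (addIso X a b c' h').hom = eqToHom (by rw [hc]) ≫ (addIso X a b c h).hom := by
  subst hc
  exact (id_comp _).symm

lemma shift_eqToHom {X Y : C} (f : X ⟶ Y) (a b : ℤ) (h : a = b) :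
    f⟦a⟧' ≫ eqToHom (by rw [h]) = eqToHom (by rw [h]) ≫ f⟦b⟧' := by
  subst h
  exact (comp_id _).trans (id_comp _).symm

lemma addIso_zero_left_hom (X : C) (a : ℤ) (h : 0 + a = a) :
    (addIso X 0 a a h).hom = (zeroIso X).inv⟦a⟧' :=
  shiftFunctorAdd'_zero_add_hom_app a X

end shiftIsos

/-! ### The iterated shift isomorphisms of a duality. -/

namespace Duality

variable {C D A : Type*} [Category* C] [Preadditive C] [HasZeroObject C]
    [HasShift C ℤ] [∀ n : ℤ, (shiftFunctor C n).Additive] [Pretriangulated C]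
    [Category* D] [Preadditive D] [HasZeroObject D]
    [HasShift D ℤ] [∀ n : ℤ, (shiftFunctor D n).Additive] [Pretriangulated D]
    [Category* A] [Abelian A]
    (Ψ : Duality C D A)

lemma map_map {X X' X'' : C} (g : X ⟶ X') (g' : X' ⟶ X'') {Y Y' Y'' : D} (f : Y ⟶ Y')
    (f' : Y' ⟶ Y'') : Ψ.map g' f ≫ Ψ.map g f' = Ψ.map (g ≫ g') (f ≫ f') := by
  rw [map, map, map, op_comp, Functor.map_comp, Functor.map_comp, NatTrans.comp_app, assoc, assoc,
    (Ψ.Φ.map g.op).naturality_assoc]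

@[simp]
lemma map_id (X : C) (Y : D) : Ψ.map (𝟙 X) (𝟙 Y) = 𝟙 _ := by
  simp [map]

lemma map_eq_left {X X' : C} (g : X ⟶ X') (Y : D) : (Ψ.Φ.map g.op).app Y = Ψ.map g (𝟙 Y) := by
  simp [map]

lemma map_eq_right (X : C) {Y Y' : D} (f : Y ⟶ Y') :
    (Ψ.Φ.obj (op X)).map f = Ψ.map (𝟙 X) f := by
  simp [map]

instance isIso_map {X X' : C} (g : X ⟶ X') {Y Y' : D} (f : Y ⟶ Y') [IsIso g] [IsIso f] :
    IsIso (Ψ.map g f) :=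
  inferInstanceAs (IsIso (Ψ.mapIso (asIso g) (asIso f)).hom)

lemma shiftOne_naturality {X X' : C} (g : X ⟶ X') {Y Y' : D} (f : Y ⟶ Y') :
    Ψ.map g f ≫ (Ψ.shiftOne X Y').hom =
      (Ψ.shiftOne X' Y).hom ≫ Ψ.map (g⟦(1 : ℤ)⟧') (f⟦(1 : ℤ)⟧') := by
  have h₁ := (Ψ.shift.hom.app (op X)).naturality f
  have h₂ := NatTrans.congr_app (Ψ.shift.hom.naturality g.op) Y
  rw [map, map, assoc]
  refine (congrArg (_ ≫ ·) h₁).trans ?_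
  rw [← assoc, ← assoc]
  exact congrArg (· ≫ _) h₂

lemma shiftNat_naturality {X X' : C} (g : X ⟶ X') {Y Y' : D} (f : Y ⟶ Y') (m : ℕ) :
    Ψ.map g f ≫ (Ψ.shiftNat X Y' m).hom =
      (Ψ.shiftNat X' Y m).hom ≫ Ψ.map (g⟦(m : ℤ)⟧') (f⟦(m : ℤ)⟧') := by
  induction m with
  | zero =>
    change _ ≫ Ψ.map (zeroIso X).hom (zeroIso Y').inv =
      Ψ.map (zeroIso X').hom (zeroIso Y).inv ≫ Ψ.map (g⟦(0 : ℤ)⟧') (f⟦(0 : ℤ)⟧')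
    rw [map_map, map_map, zeroIso_naturality, zeroIso_inv_naturality]
  | succ m ih =>
    change _ ≫ (Ψ.shiftNat X Y' m).hom ≫ (Ψ.shiftOne _ _).hom ≫
      Ψ.map (addIso X (m : ℤ) 1 ((m + 1 : ℕ) : ℤ) (by simp)).hom
        (addIso Y' (m : ℤ) 1 ((m + 1 : ℕ) : ℤ) (by simp)).inv =
      ((Ψ.shiftNat X' Y m).hom ≫ (Ψ.shiftOne _ _).hom ≫
      Ψ.map (addIso X' (m : ℤ) 1 ((m + 1 : ℕ) : ℤ) (by simp)).hom
        (addIso Y (m : ℤ) 1 ((m + 1 : ℕ) : ℤ) (by simp)).inv) ≫ _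
    rw [← assoc, ih, assoc, ← assoc (Ψ.map _ _), shiftOne_naturality, assoc, assoc, assoc,
      map_map, map_map, addIso_naturality, addIso_inv_naturality]

/-- The isomorphism `Φ(X⟦a⟧, Y⟦b⟧) ≅ Φ(X⟦a'⟧, Y⟦b'⟧)` for `a + m = a'`, `b + m = b'`. -/
def diagIso (X : C) (Y : D) (m : ℕ) (a b a' b' : ℤ) (ha : a + m = a') (hb : b + m = b') :
    Ψ.obj (X⟦a⟧) (Y⟦b⟧) ≅ Ψ.obj (X⟦a'⟧) (Y⟦b'⟧) :=
  Ψ.shiftNat (X⟦a⟧) (Y⟦b⟧) m ≪≫ Ψ.mapIso (addIso X a m a' ha) (addIso Y b m b' hb).symm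

/-- The isomorphism `Φ(X⟦a⟧, Y⟦b⟧) ≅ Φ(X⟦a + 1⟧, Y⟦b + 1⟧)`. -/
def diagStep (X : C) (Y : D) (a b a' b' : ℤ) (ha : a + 1 = a') (hb : b + 1 = b') :
    Ψ.obj (X⟦a⟧) (Y⟦b⟧) ⟶ Ψ.obj (X⟦a'⟧) (Y⟦b'⟧) :=
  (Ψ.shiftOne (X⟦a⟧) (Y⟦b⟧)).hom ≫ Ψ.map (addIso X a 1 a' ha).hom (addIso Y b 1 b' hb).inv

lemma diagIso_hom (X : C) (Y : D) (m : ℕ) (a b a' b' : ℤ) (ha : a + m = a') (hb : b + m = b') :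
    (Ψ.diagIso X Y m a b a' b' ha hb).hom = (Ψ.shiftNat (X⟦a⟧) (Y⟦b⟧) m).hom ≫
      Ψ.map (addIso X a m a' ha).hom (addIso Y b m b' hb).inv := rfl

lemma shiftNat_zero_hom (X : C) (Y : D) :
    (Ψ.shiftNat X Y 0).hom = Ψ.map (zeroIso X).hom (zeroIso Y).inv := rfl

lemma shiftNat_succ_hom (X : C) (Y : D) (m : ℕ) :
    (Ψ.shiftNat X Y (m + 1)).hom = (Ψ.shiftNat X Y m).hom ≫ (Ψ.shiftOne _ _).hom ≫
      Ψ.map (addIso X (m : ℤ) 1 ((m + 1 : ℕ) : ℤ) (by simp)).hom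
        (addIso Y (m : ℤ) 1 ((m + 1 : ℕ) : ℤ) (by simp)).inv := rfl

lemma diagIso_zero (X : C) (Y : D) (a b : ℤ) (ha : a + (0 : ℕ) = a) (hb : b + (0 : ℕ) = b) :
    (Ψ.diagIso X Y 0 a b a b ha hb).hom = 𝟙 _ := by
  rw [diagIso_hom, shiftNat_zero_hom, map_map]
  have h₁ := addIso_zero_right X a (by simp)
  have h₂ := addIso_zero_right Y b (by simp)
  change Ψ.map ((addIso X a 0 a (by simp)).hom ≫ (zeroIso (X⟦a⟧)).hom)
    ((zeroIso (Y⟦b⟧)).inv ≫ (addIso Y b 0 b (by simp)).inv) = _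
  rw [← h₁, h₂, Iso.hom_inv_id, Iso.inv_hom_id, map_id]

lemma diagIso_succ (X : C) (Y : D) (m : ℕ) (a b a' b' a'' b'' : ℤ) (ha : a + m = a')
    (hb : b + m = b') (ha' : a' + 1 = a'') (hb' : b' + 1 = b'') (ha'' : a + (m + 1 : ℕ) = a'')
    (hb'' : b + (m + 1 : ℕ) = b'') :
    (Ψ.diagIso X Y (m + 1) a b a'' b'' ha'' hb'').hom =
      (Ψ.diagIso X Y m a b a' b' ha hb).hom ≫ Ψ.diagStep X Y a' b' a'' b'' ha' hb' := by
  rw [diagIso_hom, diagIso_hom, shiftNat_succ_hom, diagStep, assoc, assoc, assoc,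
    ← assoc (Ψ.map _ _) (Ψ.shiftOne _ _).hom, shiftOne_naturality, assoc, map_map, map_map,
    addIso_assoc X a m 1 a' ((m + 1 : ℕ) : ℤ) a'' ha (by simp) ha' ha'',
    addIso_assoc_inv Y b m 1 b' ((m + 1 : ℕ) : ℤ) b'' hb (by simp) hb' hb'']

/-- The isomorphism is a composite of single steps along a diagonal, so a step can be split off at
the front as well as at the back. -/
lemma diagIso_succ' (X : C) (Y : D) (m : ℕ) (a b a' b' a'' b'' : ℤ) (ha : a + 1 = a')
    (hb : b + 1 = b') (ha' : a' + m = a'') (hb' : b' + m = b'') (ha'' : a + (m + 1 : ℕ) = a'')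
    (hb'' : b + (m + 1 : ℕ) = b'') :
    (Ψ.diagIso X Y (m + 1) a b a'' b'' ha'' hb'').hom =
      Ψ.diagStep X Y a b a' b' ha hb ≫ (Ψ.diagIso X Y m a' b' a'' b'' ha' hb').hom := by
  induction m generalizing a'' b'' with
  | zero =>
    obtain rfl : a' = a'' := by simpa using ha'
    obtain rfl : b' = b'' := by simpa using hb'
    rw [Ψ.diagIso_succ X Y 0 a b a b a' b' (by simp) (by simp) ha hb, diagIso_zero, diagIso_zero,
      id_comp, comp_id]
  | succ m ih =>
    rw [Ψ.diagIso_succ X Y (m + 1) a b (a' + m) (b' + m) a'' b'' (by push_cast; lia)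
      (by push_cast; lia) (by push_cast at ha'; lia) (by push_cast at hb'; lia),
      ih (a' + m) (b' + m) rfl rfl (by push_cast; lia) (by push_cast; lia),
      Ψ.diagIso_succ X Y m a' b' (a' + m) (b' + m) a'' b'' rfl rfl (by push_cast at ha'; lia)
        (by push_cast at hb'; lia), assoc]

lemma shiftIso_natCast_hom (X : C) (Y : D) (m : ℕ) :
    (Ψ.shiftIso X Y m).hom = (Ψ.shiftNat (X⟦-(m : ℤ)⟧) Y m).hom ≫
      Ψ.map ((zeroIso X).inv ≫ (addIso X (-(m : ℤ)) m 0 (by simp)).hom) (𝟙 _) := rfl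

/-- For negative `n` the isomorphism is defined through the inverse of `shiftNat`; the formula is
phrased as a cancellation so that only the natural direction of `shiftNat` appears. -/
lemma shiftIso_negSucc_hom (X : C) (Y : D) (m : ℕ) (n : ℤ) (hn : n = Int.negSucc m) (k : ℤ)
    (hk : k = -n) (hk' : k = (m + 1 : ℕ)) :
    (Ψ.shiftNat X (Y⟦n⟧) (m + 1)).hom ≫
      Ψ.map (eqToHom (by rw [← hk, hk'])) ((addIso Y n (m + 1 : ℕ) 0 (by lia)).inv ≫
        (zeroIso Y).hom) ≫
      (Ψ.shiftIso X Y n).hom = 𝟙 _ := by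
  subst hn
  change (Ψ.shiftNat X (Y⟦Int.negSucc m⟧) (m + 1)).hom ≫
      Ψ.map (𝟙 _) ((addIso Y (Int.negSucc m) (m + 1 : ℕ) 0 (by lia)).inv ≫
        (zeroIso Y).hom) ≫ Ψ.map (𝟙 _) ((zeroIso Y).inv ≫
          (addIso Y (Int.negSucc m) (m + 1 : ℕ) 0 (by lia)).hom) ≫
            (Ψ.shiftNat X (Y⟦Int.negSucc m⟧) (m + 1)).inv = 𝟙 _
  rw [← assoc (Ψ.map _ _), map_map]
  simp

lemma shiftIso_naturality {X X' : C} (g : X ⟶ X') {Y Y' : D} (f : Y ⟶ Y') (n : ℤ) :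
    Ψ.map (g⟦-n⟧') f ≫ (Ψ.shiftIso X Y' n).hom =
      (Ψ.shiftIso X' Y n).hom ≫ Ψ.map g (f⟦n⟧') := by
  obtain ⟨m, rfl | hn⟩ : ∃ m : ℕ, n = m ∨ n = Int.negSucc m := by
    cases n with
    | ofNat m => exact ⟨m, Or.inl rfl⟩
    | negSucc m => exact ⟨m, Or.inr rfl⟩
  · rw [shiftIso_natCast_hom, shiftIso_natCast_hom, ← assoc, shiftNat_naturality, assoc, assoc,
      map_map, map_map, assoc, ← addIso_naturality, ← assoc, zeroIso_inv_naturality, assoc,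
      comp_id, id_comp]
  · have h := Ψ.shiftIso_negSucc_hom X Y' m n hn (m + 1 : ℕ) (by lia) rfl
    have h' := Ψ.shiftIso_negSucc_hom X' Y m n hn (m + 1 : ℕ) (by lia) rfl
    rw [← assoc] at h h'
    rw [← Iso.eq_comp_inv] at h h'
    rw [id_comp] at h h'
    rw [← Iso.inv_comp_eq, ← assoc, ← h', ← cancel_mono (Ψ.shiftIso X Y' n).inv, assoc,
      Iso.hom_inv_id, comp_id, ← h, ← assoc (Ψ.map g _), shiftNat_naturality, assoc, assoc,
      map_map, map_map, shift_eqToHom, ← assoc (_⟦_⟧'), ← addIso_inv_naturality, assoc,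
      assoc, zeroIso_naturality]
    lia

/-- For `n ≥ 0`, the identification moves along the diagonal from `(-n, b)` to `(0, b + n)`. The
next lemma says that for `n ≤ 0` it undoes such a move; together they put both halves of the
definition by cases into one form. -/
lemma shiftIso_hom_eq_diagIso (X : C) (Y : D) (m : ℕ) (n b b' : ℤ) (hn : n = m) (hb : b + n = b') :
    (Ψ.shiftIso X (Y⟦b⟧) n).hom ≫ Ψ.map (𝟙 X) (addIso Y b n b' hb).inv =
      (Ψ.diagIso X Y m (-n) b 0 b' (by lia) (by lia)).hom ≫ Ψ.map (zeroIso X).inv (𝟙 _) := by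
  subst hn
  rw [shiftIso_natCast_hom, diagIso_hom, assoc, assoc, map_map, map_map, id_comp, id_comp, comp_id]

lemma diagIso_shiftIso_hom (X : C) (Y : D) (m : ℕ) (n b b' : ℤ) (hn : n + m = 0)
    (hb : b + n = b') :
    (Ψ.diagIso X Y m 0 b' (-n) b (by lia) (by lia)).hom ≫ (Ψ.shiftIso X (Y⟦b⟧) n).hom ≫
      Ψ.map (𝟙 X) (addIso Y b n b' hb).inv = Ψ.map (zeroIso X).inv (𝟙 _) := by
  cases m with
  | zero =>
    rw [Ψ.shiftIso_hom_eq_diagIso X Y 0 n b b' (by simpa using hn) hb]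
    generalize_proofs h₁ h₂ h₃ h₄
    obtain rfl : b = b' := by simpa using h₄
    revert h₁ h₃
    generalize -n = a
    intro h₁ h₃
    obtain rfl : a = 0 := by simpa using h₃
    rw [diagIso_zero, id_comp, id_comp]
  | succ m =>
    have h := Ψ.shiftIso_negSucc_hom X (Y⟦b⟧) m n (by lia) (m + 1 : ℕ) (by lia) rfl
    have h₁ : (Ψ.diagIso X Y (m + 1) 0 b' (-n) b (by lia) (by lia)).hom =
        Ψ.map (zeroIso X).inv (addIso Y b n b' hb).hom ≫ (Ψ.shiftNat X (Y⟦b⟧⟦n⟧) (m + 1)).hom ≫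
          Ψ.map (eqToHom (by rw [show -n = ((m + 1 : ℕ) : ℤ) by lia])) ((addIso (Y⟦b⟧) n (m + 1 : ℕ) 0 (by lia)).inv ≫
            (zeroIso (Y⟦b⟧)).hom) := by
      rw [diagIso_hom, ← assoc (Ψ.map _ _), shiftNat_naturality, assoc, map_map,
        addIso_congr X 0 (m + 1 : ℕ) (m + 1 : ℕ) (-n) (by simp) (by lia) (by lia),
        addIso_zero_left_hom, ← addIso_zero_right Y b (by simp),
        ← addIso_assoc_inv Y b n (m + 1 : ℕ) b' 0 b hb (by lia) (by lia) (by simp), ← assoc,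
        ← Functor.map_comp, Iso.hom_inv_id, CategoryTheory.Functor.map_id, id_comp]
    rw [h₁, assoc, assoc, reassoc_of% h, map_map, id_comp, Iso.hom_inv_id]

lemma map_zeroIso_diagStep (X : C) (Y : D) (a a' : ℤ) (ha : a + 1 = a') :
    Ψ.map (𝟙 _) (zeroIso Y).inv ≫ Ψ.diagStep X Y a 0 a' 1 ha (by simp) =
      (Ψ.shiftOne (X⟦a⟧) Y).hom ≫ Ψ.map (addIso X a 1 a' ha).hom (𝟙 _) := by
  rw [diagStep, ← assoc, shiftOne_naturality, assoc, map_map, addIso_zero_left, CategoryTheory.Functor.map_id,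
    comp_id, ← Functor.map_comp, Iso.inv_hom_id, CategoryTheory.Functor.map_id]

/-- Passing from `n` to `n + 1` costs one application of `σ`, also across zero, where the definition
changes form. This is what makes the identification compatible with connecting morphisms. -/
lemma shiftIso_succ_hom (X : C) (Y : D) (n n' : ℤ) (hn : n + 1 = n') :
    (Ψ.shiftIso X Y n').hom = (Ψ.shiftOne (X⟦-n'⟧) Y).hom ≫
      Ψ.map (addIso X (-n') 1 (-n) (by lia)).hom (𝟙 _) ≫ (Ψ.shiftIso X (Y⟦(1 : ℤ)⟧) n).hom ≫
        Ψ.map (𝟙 X) (addIso Y 1 n n' (by lia)).inv := by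
  -- Writing `Y` as `Y⟦0⟧` turns both sides into moves along one diagonal.
  have h₀ : (Ψ.shiftIso X Y n').hom = Ψ.map (𝟙 _) (zeroIso Y).inv ≫
      (Ψ.shiftIso X (Y⟦(0 : ℤ)⟧) n').hom ≫ Ψ.map (𝟙 X) (addIso Y 0 n' n' (by simp)).inv := by
    have h := Ψ.shiftIso_naturality (𝟙 X) (zeroIso Y).hom n'
    rw [addIso_zero_left, ← h, ← assoc, map_map, CategoryTheory.Functor.map_id, id_comp, Iso.inv_hom_id, map_id,
      id_comp]
  rw [h₀, ← assoc (Ψ.shiftOne _ _).hom, ← Ψ.map_zeroIso_diagStep, assoc]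
  congr 1
  obtain ⟨m, hm | hm⟩ : ∃ m : ℕ, n = m ∨ n = Int.negSucc m := by
    cases n with
    | ofNat m => exact ⟨m, Or.inl rfl⟩
    | negSucc m => exact ⟨m, Or.inr rfl⟩
  -- For `n ≥ 0` the extra step is the first one of the move; for `n < 0`, in the next case, it is
  -- the last step of the inverse move.
  · rw [Ψ.shiftIso_hom_eq_diagIso X Y (m + 1) n' 0 n' (by push_cast; lia) (by simp),
      Ψ.shiftIso_hom_eq_diagIso X Y m n 1 n' hm (by lia),
      Ψ.diagIso_succ' X Y m (-n') 0 (-n) 1 0 n' (by lia) (by simp) (by lia) (by lia), assoc]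
  · have h₁ := Ψ.diagIso_shiftIso_hom X Y m n' 0 n' (by lia) (by simp)
    have h₂ := Ψ.diagIso_shiftIso_hom X Y (m + 1) n 1 n' (by lia) (by lia)
    rw [Ψ.diagIso_succ X Y m 0 n' (-n') 0 (-n) 1 (by lia) (by lia) (by lia) (by simp), assoc] at h₂
    rw [← cancel_epi (Ψ.diagIso X Y m 0 n' (-n') 0 (by lia) (by lia)).hom, h₁, h₂]

/-- The isomorphism `Φ(X, Y) ≅ Φ(X⟦n⟧, Y⟦n⟧)`. -/
def shiftBoth (X : C) (Y : D) (n : ℤ) : Ψ.obj X Y ≅ Ψ.obj (X⟦n⟧) (Y⟦n⟧) :=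
  Ψ.mapIso ((addIso X n (-n) 0 (by simp)).symm ≪≫ zeroIso X) (Iso.refl Y) ≪≫
    Ψ.shiftIso (X⟦n⟧) Y n

end Duality

/-! ### Orthogonality in arbitrary weights and degrees. -/

section vanishing

open Triangulated

variable {C D A : Type*} [Category* C] [Preadditive C] [HasZeroObject C]
  [HasShift C ℤ] [∀ n : ℤ, (shiftFunctor C n).Additive] [Pretriangulated C]
  [Category* D] [Preadditive D] [HasZeroObject D]
  [HasShift D ℤ] [∀ n : ℤ, (shiftFunctor D n).Additive] [Pretriangulated D]
  [Category* A] [Abelian A]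

namespace WeightStructure

variable (w : WeightStructure C)

instance : w.le0.IsStableUnderRetracts := w.le0_retract

instance : w.ge0.IsStableUnderRetracts := w.ge0_retract

lemma le_shift {X : C} {a : ℤ} (hX : w.le a X) (b c : ℤ) (h : c + b = a) : w.le c (X⟦b⟧) :=
  w.le0.prop_of_iso (addIso X b c a (by lia)) hX

lemma ge_shift {X : C} {a : ℤ} (hX : w.ge a X) (b c : ℤ) (h : c + b = a) : w.ge c (X⟦b⟧) :=
  w.ge0.prop_of_iso (addIso X b c a (by lia)) hX

lemma le_mono {X : C} {a b : ℤ} (hX : w.le a X) (h : a ≤ b) : w.le b X := by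
  obtain ⟨k, rfl⟩ := Int.le.dest h
  induction k with
  | zero => simpa using hX
  | succ k ih =>
    exact w.le0.prop_of_iso (addIso X (a + k) 1 (a + (k + 1 : ℕ)) (by push_cast; ring)).symm
      (w.le0_shift _ (ih (by lia)))

/-- After shifting by `a`, the source has weight `≥ 0`, and the target is the shift by `1` of an
object of weight `≤ 0`. -/
lemma hom_eq_zero {X Y : C} {a b : ℤ} (hX : w.ge a X) (hY : w.le b Y) (h : b < a) (f : X ⟶ Y) :
    f = 0 := by
  have h₁ : w.ge0 (X⟦a⟧) := hX
  have h₂ : w.le0 (Y⟦a⟧⟦(-1 : ℤ)⟧) :=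
    w.le0.prop_of_iso (addIso Y a (-1) (a - 1) (by ring)) (w.le_mono hY (by lia))
  have h₃ := w.orthogonal _ _ h₁ h₂
    (f⟦a⟧' ≫ (zeroIso (Y⟦a⟧)).inv ≫ (addIso (Y⟦a⟧) (-1) 1 0 (by simp)).hom)
  rw [← assoc, Preadditive.IsIso.comp_right_eq_zero, Preadditive.IsIso.comp_right_eq_zero] at h₃
  exact (shiftFunctor C a).map_injective (h₃.trans (Functor.map_zero _ _ _).symm)

end WeightStructure

namespace Duality.Orthogonal

variable {Ψ : Duality C D A} {w : WeightStructure C} {t : TStructure D} (h : Ψ.Orthogonal w t)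
include h

/-- Shifting both arguments by `a` does not change `Φ` and reduces to the defining case of
orthogonality. -/
lemma isZero_of_le {X : C} {Y : D} {a b : ℤ} (hX : w.le a X) (hY : t.IsGE Y b) (hab : a < b) :
    IsZero (Ψ.obj X Y) := by
  refine (h (X⟦a⟧) (Y⟦a⟧) (Or.inl ⟨hX, ?_⟩)).of_iso (Ψ.shiftBoth X Y a)
  have := t.isGE_of_ge Y (a + 1) b (by lia)
  exact (t.isGE_shift Y (a + 1) a 1 (by lia)).ge

lemma isZero_of_ge {X : C} {Y : D} {a b : ℤ} (hX : w.ge a X) (hY : t.IsLE Y b) (hab : b < a) :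
    IsZero (Ψ.obj X Y) := by
  refine (h (X⟦a⟧) (Y⟦a⟧) (Or.inr ⟨hX, ?_⟩)).of_iso (Ψ.shiftBoth X Y a)
  have := t.isLE_of_le Y b (a - 1) (by lia)
  exact (t.isLE_shift Y (a - 1) a (-1) (by lia)).le

end Duality.Orthogonal

end vanishing

/-! ### Existence and weak functoriality of weight Postnikov towers. -/

namespace WeightStructure

variable {C : Type*} [Category* C] [Preadditive C] [HasZeroObject C]
  [HasShift C ℤ] [∀ n : ℤ, (shiftFunctor C n).Additive] [Pretriangulated C]

lemma exists_triangle (w : WeightStructure C) (X : C) (i : ℤ) :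
    ∃ (Y Z : C) (_ : w.ge (1 - i) Y) (_ : w.le (-i) Z) (f : Y ⟶ X) (g : X ⟶ Z)
      (h : Z ⟶ Y⟦(1 : ℤ)⟧), Triangle.mk f g h ∈ distTriang C := by
  obtain ⟨A, B, hA, hB, f, g, h, hT⟩ := w.exists_decomposition (X⟦-i⟧)
  -- Decompose `X[-i]`, rotate so that the part of large weight, now of weight `≥ 1`, comes first,
  -- and shift back by `i`.
  have hT' := Triangle.shift_distinguished _ (inv_rot_of_distTriang _ hT) i
  have hA' : w.le 0 A := w.le0.prop_of_iso (zeroIso A).symm hA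
  have hB' : w.ge 0 B := w.ge0.prop_of_iso (zeroIso B).symm hB
  let T := (Triangle.shiftFunctor C i).obj (Triangle.mk f g h).invRotate
  let e : T.obj₂ ≅ X := (addIso X (-i) i 0 (by simp)).symm ≪≫ zeroIso X
  refine ⟨B⟦(-1 : ℤ)⟧⟦i⟧, A⟦i⟧, w.ge_shift (w.ge_shift hB' (-1) 1 (by simp)) i _ (by simp),
    w.le_shift hA' i _ (by simp), T.mor₁ ≫ e.hom, e.inv ≫ T.mor₂, T.mor₃, ?_⟩
  exact isomorphic_distinguished _ hT' _
    (Triangle.isoMk _ _ (Iso.refl _) e.symm (Iso.refl _)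
      (show (T.mor₁ ≫ e.hom) ≫ e.inv = 𝟙 _ ≫ T.mor₁ by simp)
      (show (e.inv ≫ T.mor₂) ≫ 𝟙 _ = e.inv ≫ T.mor₂ by simp)
      (show T.mor₃ ≫ (𝟙 T.obj₁)⟦(1 : ℤ)⟧' = 𝟙 _ ≫ T.mor₃ by simp))

namespace Tower

variable {w : WeightStructure C} {X' : C} {X : C}

/-- A morphism from an object of sufficiently large weight lifts to the terms of a tower. -/
lemma exists_lift (𝒯 : w.Tower X) {U : C} {a i : ℤ} (hU : w.ge a U) (hi : -i < a) (u : U ⟶ X) :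
    ∃ v : U ⟶ 𝒯.Y i, v ≫ 𝒯.toX i = u := by
  obtain ⟨Z, hZ, f, g, hT⟩ := 𝒯.le i
  obtain ⟨v, hv⟩ := Triangle.coyoneda_exact₂ _ hT u (w.hom_eq_zero hU hZ hi _)
  exact ⟨v, hv.symm⟩

/-- The kernel of composition with `Y_i ⟶ X` comes from morphisms to `Cone(Y_i ⟶ X)[-1]`, which has
weight `≤ 1 - i`. -/
lemma eq_zero_of_toX (𝒯 : w.Tower X) {U : C} {a i : ℤ} (hU : w.ge a U) (hi : 1 - i < a)
    (u : U ⟶ 𝒯.Y i) (hu : u ≫ 𝒯.toX i = 0) : u = 0 := by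
  obtain ⟨Z, hZ, f, g, hT⟩ := 𝒯.le i
  obtain ⟨v, hv⟩ := Triangle.coyoneda_exact₂ _ (inv_rot_of_distTriang _ hT) u hu
  exact hv.trans ((congrArg (· ≫ _)
    (w.hom_eq_zero hU (w.le_shift hZ (-1) (1 - i) (by ring)) hi v)).trans zero_comp)

/-- The decompositions can be chosen independently for all `i`: the steps exist since there are no
nonzero morphisms from `Y_i` to the cone of `Y_{i+1} ⟶ X`. -/
lemma nonempty (w : WeightStructure C) (X : C) : Nonempty (w.Tower X) := by
  choose Y Z hY hZ f g h hT using w.exists_triangle X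
  have hs (i i' : ℤ) (hi : i + 1 = i') : ∃ s : Y i ⟶ Y i', s ≫ f i' = f i := by
    obtain ⟨v, hv⟩ := Triangle.coyoneda_exact₂ _ (hT i') (f i)
      (w.hom_eq_zero (hY i) (hZ i') (by lia) _)
    exact ⟨v, hv.symm⟩
  choose s hs using hs
  have hg (i : ℤ) := distinguished_cocone_triangle (s i (i + 1) rfl)
  choose gr p c hd using hg
  exact ⟨{
    Y := Y
    gr := gr
    step := s
    toX := f
    step_toX := hs
    proj i i' h := eqToHom (by rw [h]) ≫ p i
    conn := c
    dist i i' h := by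
      subst h
      rw [eqToHom_refl, id_comp]
      exact hd i
    ge := hY
    le i := ⟨Z i, hZ i, g i, h i, hT i⟩ }⟩

lemma Hom.nonempty (𝒯 : w.Tower X) (𝒯' : w.Tower X') (g : X ⟶ X') : Nonempty (𝒯.Hom 𝒯' g) := by
  have hY (i : ℤ) := 𝒯'.exists_lift (i := i) (𝒯.ge i) (by lia) (𝒯.toX i ≫ g)
  choose Y hY using hY
  -- Lifts to `Y'_i` need not be unique, but morphisms from `Y_i` to `Y'_{i+1}` are determined by
  -- their composites with the map to `X'`, so any choice of lifts commutes with the steps.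
  have hs (i i' : ℤ) (h : i + 1 = i') : 𝒯.step i i' h ≫ Y i' = Y i ≫ 𝒯'.step i i' h := by
    rw [← sub_eq_zero]
    refine 𝒯'.eq_zero_of_toX (𝒯.ge i) (by lia) _ ?_
    rw [Preadditive.sub_comp, assoc, assoc, hY, 𝒯'.step_toX, hY, ← assoc, 𝒯.step_toX, sub_self]
  have hg (i : ℤ) := complete_distinguished_triangle_morphism _ _ (𝒯.dist i (i + 1) rfl)
    (𝒯'.dist i (i + 1) rfl) (Y i) (Y (i + 1)) (hs i (i + 1) rfl)
  choose gr h₁ h₂ using hg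
  exact ⟨{
    Y := Y
    gr := gr
    comm_step := hs
    comm_toX i := (hY i).symm
    comm_proj i i' h := by
      subst h
      exact h₁ i
    comm_conn := h₂ }⟩

/-- The identity of a tower. -/
def Hom.id (𝒯 : w.Tower X) : 𝒯.Hom 𝒯 (𝟙 X) where
  Y i := 𝟙 _
  gr i := 𝟙 _
  comm_step i i' h := (comp_id _).trans (id_comp _).symm
  comm_toX i := (comp_id _).trans (id_comp _).symm
  comm_proj i i' h := (comp_id _).trans (id_comp _).symm
  comm_conn i := by rw [CategoryTheory.Functor.map_id, comp_id, id_comp]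

end Tower

end WeightStructure

/-! ### Vanishing and isomorphism criteria in exact couples. -/

namespace ExactCouple

variable {A : Type*} [Category* A] [Abelian A] {s : ℕ}

lemma isZero_E {c : ExactCouple A s} {p p₀ p₁ m n : ℤ} (hp : p + 1 = p₀ + s) (hn : m + 1 = n)
    (h : p + 1 = p₁) (h₀ : Epi (c.i (p₀ + 1) p₀ m rfl))
    (h₁ : Mono (c.i p₁ p n h)) : IsZero (c.E p n) := by
  have hj : c.j p₀ p m n hp hn = 0 := by
    rw [← cancel_epi (c.i (p₀ + 1) p₀ m rfl), i_j, comp_zero]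
  have hk : c.k p p₁ n h = 0 := by
    rw [← cancel_mono (c.i p₁ p n h), k_i, zero_comp]
  exact (c.exact_j_k p₀ p p₁ m n hp hn h).isZero_of_both_zeros hj hk

lemma isZero_E_of_isZero {c : ExactCouple A s} {p p₀ p₁ m n : ℤ} (hp : p + 1 = p₀ + s)
    (hn : m + 1 = n) (h : p + 1 = p₁) (h₀ : IsZero (c.D p₀ m)) (h₁ : IsZero (c.D p₁ n)) :
    IsZero (c.E p n) :=
  (c.exact_j_k p₀ p p₁ m n hp hn h).isZero_of_both_zeros (h₀.eq_of_src _ _) (h₁.eq_of_tgt _ _)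

lemma isIso_k {c : ExactCouple A s} {p p₀ p₁ m n : ℤ} (hp : p + 1 = p₀ + s) (hn : m + 1 = n)
    (h : p + 1 = p₁) (h₀ : IsZero (c.D p₀ m)) (h₁ : IsZero (c.D p n)) : IsIso (c.k p p₁ n h) := by
  have := (c.exact_j_k p₀ p p₁ m n hp hn h).mono_g (h₀.eq_of_src _ _)
  have := (c.exact_k_i p p₁ n h).epi_f (h₁.eq_of_tgt _ _)
  dsimp at *
  exact isIso_of_mono_of_epi _

lemma isZero_D' {c : ExactCouple A s} {p m : ℤ} (h : IsZero (c.D p m)) : IsZero (c.D' p m) :=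
  IsZero.of_mono (c.ι p m) h

lemma killed_of_isZero {c : ExactCouple A s} (a : ℕ) (p m : ℤ) (h : IsZero (c.D (p - a) m)) {Z : A}
    (x : Z ⟶ c.D p m) : c.Killed a p m x := by
  induction a generalizing p with
  | zero => exact IsZero.eq_of_tgt (by simpa using h) _ _
  | succ a ih =>
    intro p' hp
    refine ih p' ?_ _
    rwa [show p' - (a : ℤ) = p - (a + 1 : ℕ) by push_cast; lia]

namespace Hom

variable {c c' : ExactCouple A s} (f : Hom c c')

/-- The derived `D`-term is a subobject of the `D`-term at `p` and a quotient of the one at `p + 1`,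
so half of the information at each place suffices. -/
lemma isIso_D' (p m : ℤ) (h : Mono (f.D p m)) (h' : Epi (f.D (p + 1) m)) : IsIso (f.D' p m) := by
  have : Epi (f.D' p m) := by
    have : Epi (c.ε p m ≫ f.D' p m) := by rw [ε_D']; infer_instance
    exact epi_of_epi (c.ε p m) _
  have : Mono (f.D' p m) := by
    have : Mono (f.D' p m ≫ c'.ι p m) := by rw [D'_ι]; infer_instance
    exact mono_of_mono _ (c'.ι p m)
  exact isIso_of_mono_of_epi _

lemma isIso_derived_E (p n : ℤ) (h₀ : IsIso (f.E (p - s) (n - 1))) (h : IsIso (f.E p n))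
    (h₁ : IsIso (f.E (p + s) (n + 1))) : IsIso (f.derived.E p n) := by
  have : IsIso (f.scAt p n).τ₁ := h₀
  have : IsIso (f.scAt p n).τ₂ := h
  have : IsIso (f.scAt p n).τ₃ := h₁
  have : IsIso (f.scAt p n) := ShortComplex.isIso_of_isIso _
  exact inferInstanceAs (IsIso (ShortComplex.homologyMap (f.scAt p n)))

end Hom

namespace Abutment

variable {c : ExactCouple A s} (h : c.Abutment)

/-- The map from the abutment to the `D`-terms of the derived couple. -/
def α' (p m : ℤ) : h.H m ⟶ c.derived.D p m := h.α (p + 1) m ≫ c.ε p m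

lemma α'_ι (p m : ℤ) : h.α' p m ≫ c.ι p m = h.α p m := by
  have : (h.α (p + 1) m ≫ c.ε p m) ≫ c.ι p m = h.α p m := by rw [assoc, ε_ι, α_i]
  exact this

lemma eq_of_comp_ι {p m : ℤ} {Z : A} {x y : Z ⟶ c.derived.D p m}
    (h : x ≫ c.ι p m = y ≫ c.ι p m) : x = y :=
  (cancel_mono (c.ι p m)).1 h

lemma α'_i (p p' m : ℤ) (hp : p' + 1 = p) : h.α' p m ≫ c.derived.i p p' m hp = h.α' p' m := by
  refine eq_of_comp_ι ((assoc _ _ _).trans ((congrArg (_ ≫ ·) (c.i'_ι p p' m hp)).trans ?_))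
  exact (assoc _ _ _).symm.trans ((congrArg (· ≫ _) (h.α'_ι p m)).trans
    ((h.α_i p p' m hp).trans (h.α'_ι p' m).symm))

/-- As for `isIso_D'`: injectivity is tested at `p`, surjectivity at `p + 1`. -/
lemma isIso_α' (p m : ℤ) (h₀ : Mono (h.α p m)) (h₁ : Epi (h.α (p + 1) m)) :
    IsIso (h.α' p m) := by
  have : Mono (h.α' p m ≫ c.ι p m) := by rwa [α'_ι]
  have : Mono (h.α' p m) := mono_of_mono _ (c.ι p m)
  have : Epi (h.α' p m) := epi_comp (h.α (p + 1) m) (c.ε p m)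
  exact isIso_of_mono_of_epi _

lemma α'_naturality {c' : ExactCouple A s} {h' : c'.Abutment} (f : Hom c c')
    (β : ∀ m, h.H m ⟶ h'.H m) (hβ : ∀ p m, h.α p m ≫ f.D p m = β m ≫ h'.α p m) (p m : ℤ) :
    h.α' p m ≫ f.derived.D p m = β m ≫ h'.α' p m := by
  refine eq_of_comp_ι ((assoc _ _ _).trans ((congrArg (_ ≫ ·) (f.D'_ι p m)).trans ?_))
  refine (assoc _ _ _).symm.trans ((congrArg (· ≫ _) (h.α'_ι p m)).trans ((hβ p m).trans ?_))
  exact (congrArg (_ ≫ ·) (h'.α'_ι p m).symm).trans (assoc _ _ _).symm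

end Abutment

end ExactCouple

/-! ### Long exact sequences with a vanishing term. -/

section homological

variable {C A : Type*} [Category* C] [Preadditive C] [HasZeroObject C]
  [HasShift C ℤ] [∀ n : ℤ, (shiftFunctor C n).Additive] [Pretriangulated C]
  [Category* A] [Abelian A] (F : C ⥤ A) [F.IsHomological] {T : Triangle C} (hT : T ∈ distTriang C)

include hT

lemma mono_map_mor₂ (h : IsZero (F.obj T.obj₁)) : Mono (F.map T.mor₂) :=
  (F.map_distinguished_exact T hT).mono_g (h.eq_of_src _ _)

lemma epi_map_mor₁ (h : IsZero (F.obj T.obj₃)) : Epi (F.map T.mor₁) :=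
  (F.map_distinguished_exact T hT).epi_f (h.eq_of_tgt _ _)

lemma epi_map_mor₂ (h : IsZero (F.obj (T.obj₁⟦(1 : ℤ)⟧))) : Epi (F.map T.mor₂) :=
  epi_map_mor₁ F (rot_of_distTriang _ hT) h

lemma mono_map_mor₁ (h : IsZero (F.obj (T.obj₃⟦(-1 : ℤ)⟧))) : Mono (F.map T.mor₁) :=
  mono_map_mor₂ F (inv_rot_of_distTriang _ hT) h

lemma isIso_map_mor₂ (h : IsZero (F.obj T.obj₁)) (h' : IsZero (F.obj (T.obj₁⟦(1 : ℤ)⟧))) :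
    IsIso (F.map T.mor₂) := by
  have := mono_map_mor₂ F hT h
  have := epi_map_mor₂ F hT h'
  exact isIso_of_mono_of_epi _

lemma isIso_map_mor₁ (h : IsZero (F.obj T.obj₃)) (h' : IsZero (F.obj (T.obj₃⟦(-1 : ℤ)⟧))) :
    IsIso (F.map T.mor₁) := by
  have := mono_map_mor₁ F hT h'
  have := epi_map_mor₁ F hT h
  exact isIso_of_mono_of_epi _

end homological

section cohomological

open Pretriangulated.Opposite

variable {C A : Type*} [Category* C] [Preadditive C] [HasZeroObject C]
  [HasShift C ℤ] [∀ n : ℤ, (shiftFunctor C n).Additive] [Pretriangulated C]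
  [Category* A] [Abelian A] (F : Cᵒᵖ ⥤ A) [F.IsHomological]

lemma IsTriangleStart.mono_op {X Y Z : C} {f : X ⟶ Y} {g : Y ⟶ Z} (h : IsTriangleStart f g)
    (hZ : IsZero (F.obj (op Z))) : Mono (F.map f.op) :=
  (h.op_exact F).mono_g (hZ.eq_of_src _ _)

lemma IsTriangleStart.epi_op {X Y Z : C} {f : X ⟶ Y} {g : Y ⟶ Z} (h : IsTriangleStart f g)
    (hX : IsZero (F.obj (op X))) : Epi (F.map g.op) :=
  (h.op_exact F).epi_f (hX.eq_of_tgt _ _)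

end cohomological

/-! ### Functoriality of the weight couple in both arguments and its behaviour under orthogonality.
-/

namespace Duality

open Triangulated

variable {C D A : Type*} [Category* C] [Preadditive C] [HasZeroObject C]
  [HasShift C ℤ] [∀ n : ℤ, (shiftFunctor C n).Additive] [Pretriangulated C]
  [Category* D] [Preadditive D] [HasZeroObject D]
  [HasShift D ℤ] [∀ n : ℤ, (shiftFunctor D n).Additive] [Pretriangulated D] [IsTriangulated D]
  [Category* A] [Abelian A]
  {Ψ : Duality C D A} {w : WeightStructure C} {t : TStructure D}
  {X X' : C} {𝒯 : w.Tower X} {𝒯' : w.Tower X'}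

section

variable (Ψ)

lemma weightCoupleMap_D {g : X ⟶ X'} (φ : 𝒯.Hom 𝒯' g) {Y Y' : D} (f : Y ⟶ Y') (p m : ℤ) :
    (Ψ.weightCoupleMap φ f).D p m = Ψ.map ((φ.Y p)⟦-m⟧') f := rfl

lemma weightCoupleMap_E {g : X ⟶ X'} (φ : 𝒯.Hom 𝒯' g) {Y Y' : D} (f : Y ⟶ Y') (p n : ℤ) :
    (Ψ.weightCoupleMap φ f).E p n = Ψ.map ((φ.gr p)⟦-n⟧') f := rfl

/-- The functoriality of the exact couple of the weight spectral sequence of `Φ(-, Y)` in `Y`. -/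
def coupleMap (𝒯 : w.Tower X) {Y Y' : D} (f : Y ⟶ Y') :
    (Ψ.weightCouple 𝒯 Y).Hom (Ψ.weightCouple 𝒯 Y') :=
  Ψ.weightCoupleMap (WeightStructure.Tower.Hom.id 𝒯) f

lemma coupleMap_D (𝒯 : w.Tower X) {Y Y' : D} (f : Y ⟶ Y') (p m : ℤ) :
    (Ψ.coupleMap 𝒯 f).D p m = (Ψ.Φ.obj (op ((𝒯.Y p)⟦-m⟧))).map f := by
  refine (Ψ.weightCoupleMap_D _ f p m).trans ?_
  rw [map_eq_right]
  exact congrArg (fun φ => Ψ.map φ f) (CategoryTheory.Functor.map_id _ _)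

lemma coupleMap_E (𝒯 : w.Tower X) {Y Y' : D} (f : Y ⟶ Y') (p n : ℤ) :
    (Ψ.coupleMap 𝒯 f).E p n = (Ψ.Φ.obj (op ((𝒯.gr p)⟦-n⟧))).map f := by
  refine (Ψ.weightCoupleMap_E _ f p n).trans ?_
  rw [map_eq_right]
  exact congrArg (fun φ => Ψ.map φ f) (CategoryTheory.Functor.map_id _ _)

lemma map_comp_map_right {U U' : C} (g : U ⟶ U') {Y Y' Y'' : D} (f : Y ⟶ Y') (f' : Y' ⟶ Y'') :
    Ψ.map g f ≫ (Ψ.Φ.obj (op U)).map f' = Ψ.map g (f ≫ f') := by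
  rw [map_eq_right, map_map, id_comp]

lemma map_right_comp_map {U U' : C} (g : U ⟶ U') {Y Y' Y'' : D} (f : Y ⟶ Y') (f' : Y' ⟶ Y'') :
    (Ψ.Φ.obj (op U')).map f ≫ Ψ.map g f' = Ψ.map g (f ≫ f') := by
  rw [map_eq_right, map_map, comp_id]

/-- The maps of exact couples induced by a commutative square in `D`. -/
lemma coupleMap_comp_weightCoupleMap {g : X ⟶ X'} (φ : 𝒯.Hom 𝒯' g) {Y Y' U U' : D} (f : Y ⟶ Y')
    (f' : U ⟶ U') (u : U ⟶ Y) (u' : U' ⟶ Y') (h : u ≫ f = f' ≫ u') :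
    (Ψ.coupleMap 𝒯' u).comp (Ψ.weightCoupleMap φ f) =
      (Ψ.weightCoupleMap φ f').comp (Ψ.coupleMap 𝒯 u') := by
  refine ExactCouple.Hom.ext' (fun p m => ?_) (fun p n => ?_)
  · refine (congrArg (· ≫ _) (Ψ.coupleMap_D 𝒯' u p m)).trans ?_
    refine Eq.trans ?_ (congrArg (_ ≫ ·) (Ψ.coupleMap_D 𝒯 u' p m)).symm
    exact (Ψ.map_right_comp_map _ _ _).trans
      ((congrArg (Ψ.map _) h).trans (Ψ.map_comp_map_right _ _ _).symm)
  · refine (congrArg (· ≫ _) (Ψ.coupleMap_E 𝒯' u p n)).trans ?_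
    refine Eq.trans ?_ (congrArg (_ ≫ ·) (Ψ.coupleMap_E 𝒯 u' p n)).symm
    exact (Ψ.map_right_comp_map _ _ _).trans
      ((congrArg (Ψ.map _) h).trans (Ψ.map_comp_map_right _ _ _).symm)

lemma coupleMap_derived_D_comm {g : X ⟶ X'} (φ : 𝒯.Hom 𝒯' g) {Y Y' U U' : D} (f : Y ⟶ Y')
    (f' : U ⟶ U') (u : U ⟶ Y) (u' : U' ⟶ Y') (h : u ≫ f = f' ≫ u') (p m : ℤ) :
    (Ψ.coupleMap 𝒯' u).derived.D p m ≫ (Ψ.weightCoupleMap φ f).derived.D p m =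
      (Ψ.weightCoupleMap φ f').derived.D p m ≫ (Ψ.coupleMap 𝒯 u').derived.D p m := by
  have := congrArg (fun f => f.derived.D p m) (Ψ.coupleMap_comp_weightCoupleMap φ f f' u u' h)
  rwa [ExactCouple.Hom.derived_comp, ExactCouple.Hom.derived_comp] at this

lemma coupleMap_derived_E_comm {g : X ⟶ X'} (φ : 𝒯.Hom 𝒯' g) {Y Y' U U' : D} (f : Y ⟶ Y')
    (f' : U ⟶ U') (u : U ⟶ Y) (u' : U' ⟶ Y') (h : u ≫ f = f' ≫ u') (p n : ℤ) :
    (Ψ.coupleMap 𝒯' u).derived.E p n ≫ (Ψ.weightCoupleMap φ f).derived.E p n =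
      (Ψ.weightCoupleMap φ f').derived.E p n ≫ (Ψ.coupleMap 𝒯 u').derived.E p n := by
  have := congrArg (fun f => f.derived.E p n) (Ψ.coupleMap_comp_weightCoupleMap φ f f' u u' h)
  rwa [ExactCouple.Hom.derived_comp, ExactCouple.Hom.derived_comp] at this

lemma weightAbutment_naturality {g : X ⟶ X'} (φ : 𝒯.Hom 𝒯' g) {Y Y' : D} (f : Y ⟶ Y') (p m : ℤ) :
    (Ψ.weightAbutment 𝒯' Y).α p m ≫ (Ψ.weightCoupleMap φ f).D p m =
      Ψ.map (g⟦-m⟧') f ≫ (Ψ.weightAbutment 𝒯 Y').α p m := by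
  refine Ψ.map_square ((𝒯.toX p)⟦-m⟧') ((𝒯'.toX p)⟦-m⟧') ((φ.Y p)⟦-m⟧') (g⟦-m⟧') ?_ f |>.symm
  rw [← Functor.map_comp, ← Functor.map_comp, φ.comm_toX]

lemma α'_weightCoupleMap {g : X ⟶ X'} (φ : 𝒯.Hom 𝒯' g) {Y Y' : D} (f : Y ⟶ Y') (p m : ℤ) :
    (Ψ.weightAbutment 𝒯' Y).α' p m ≫ (Ψ.weightCoupleMap φ f).derived.D p m =
      Ψ.map (g⟦-m⟧') f ≫ (Ψ.weightAbutment 𝒯 Y').α' p m :=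
  (Ψ.weightAbutment 𝒯' Y).α'_naturality (h' := Ψ.weightAbutment 𝒯 Y') (Ψ.weightCoupleMap φ f)
    (fun m => Ψ.map (g⟦-m⟧') f)
    (Ψ.weightAbutment_naturality φ f) p m

lemma α_coupleMap (𝒯 : w.Tower X) {Y Y' : D} (f : Y ⟶ Y') (p m : ℤ) :
    (Ψ.weightAbutment 𝒯 Y).α p m ≫ (Ψ.coupleMap 𝒯 f).D p m =
      (Ψ.Φ.obj (op (X⟦-m⟧))).map f ≫ (Ψ.weightAbutment 𝒯 Y').α p m := by
  refine (Ψ.weightAbutment_naturality _ f p m).trans ?_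
  rw [CategoryTheory.Functor.map_id, ← map_eq_right]

lemma α'_coupleMap (𝒯 : w.Tower X) {Y Y' : D} (f : Y ⟶ Y') (p m : ℤ) :
    (Ψ.weightAbutment 𝒯 Y).α' p m ≫ (Ψ.coupleMap 𝒯 f).derived.D p m =
      (Ψ.Φ.obj (op (X⟦-m⟧))).map f ≫ (Ψ.weightAbutment 𝒯 Y').α' p m :=
  (Ψ.weightAbutment 𝒯 Y).α'_naturality (h' := Ψ.weightAbutment 𝒯 Y') (Ψ.coupleMap 𝒯 f)
    (fun m => (Ψ.Φ.obj (op (X⟦-m⟧))).map f)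
    (Ψ.α_coupleMap 𝒯 f) p m

end

namespace Orthogonal

variable (h : Ψ.Orthogonal w t) (𝒯)
include h

lemma isZero_weightCouple_D {V : D} {b : ℤ} (hV : t.IsLE V b) {p m : ℤ} (hb : b < m + 1 - p) :
    IsZero ((Ψ.weightCouple 𝒯 V).D p m) :=
  h.isZero_of_ge (w.ge_shift (𝒯.ge p) (-m) (m + 1 - p) (by ring)) hV hb

/-- The kernel comes from `Φ` of the cone of `Y_p ⟶ X` shifted by `-m`, an object of weight `≤ m -
p`. For surjectivity the cone is shifted once more, which makes the bound in the next lemma stricter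
by one. -/
lemma mono_weightAbutment_α {V : D} {b : ℤ} (hV : t.IsGE V b) {p m : ℤ} (hb : m - p < b) :
    Mono ((Ψ.weightAbutment 𝒯 V).α p m) := by
  obtain ⟨Z, hZ, f, g, hT⟩ := 𝒯.le p
  exact (isTriangleStart_shift₂ _ hT (-m)).mono_op (Ψ.Φ.flip.obj V)
    (h.isZero_of_le (w.le_shift hZ (-m) (m - p) (by ring)) hV hb)

lemma epi_weightAbutment_α {V : D} {b : ℤ} (hV : t.IsGE V b) {p m : ℤ} (hb : m - p + 1 < b) :
    Epi ((Ψ.weightAbutment 𝒯 V).α p m) := by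
  obtain ⟨Z, hZ, f, g, hT⟩ := 𝒯.le p
  exact (isTriangleStart_shift₂ _ (inv_rot_of_distTriang _ hT) (-m)).epi_op (Ψ.Φ.flip.obj V)
    (h.isZero_of_le (w.le_shift (w.le_shift hZ (-1) (1 - p) (by ring)) (-m) (m - p + 1) (by ring))
      hV hb)

/-- With the next lemma: `gr_p[-n]` pairs nontrivially only with `t`-degree `n - p`. Both vanishings
are read off from the neighbouring `D`-terms, so the weights of `gr_p` need not be determined. -/
lemma isZero_weightCouple_E_of_isLE {V : D} {b : ℤ} (hV : t.IsLE V b) {p n : ℤ} (hb : b < n - p) :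
    IsZero ((Ψ.weightCouple 𝒯 V).E p n) :=
  ExactCouple.isZero_E_of_isZero (p₀ := p) (p₁ := p + 1) (m := n - 1) (by simp) (by simp) rfl
    (h.isZero_weightCouple_D 𝒯 hV (by lia)) (h.isZero_weightCouple_D 𝒯 hV (by lia))

lemma isZero_weightCouple_E_of_isGE {V : D} {b : ℤ} (hV : t.IsGE V b) {p n : ℤ} (hb : n - p < b) :
    IsZero ((Ψ.weightCouple 𝒯 V).E p n) := by
  refine ExactCouple.isZero_E (p₀ := p) (p₁ := p + 1) (m := n - 1) (by simp) (by simp)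
    rfl ?_ ?_
  · have := h.epi_weightAbutment_α 𝒯 hV (p := p) (m := n - 1) (by lia)
    rw [← (Ψ.weightAbutment 𝒯 V).α_i (p + 1) p _ rfl] at this
    exact epi_of_epi ((Ψ.weightAbutment 𝒯 V).α (p + 1) (n - 1)) _
  · have h₁ := h.epi_weightAbutment_α 𝒯 hV (p := p + 1) (m := n) (by lia)
    have h₂ := h.mono_weightAbutment_α 𝒯 hV (p := p + 1) (m := n) (by lia)
    have h₃ := h.mono_weightAbutment_α 𝒯 hV (p := p) (m := n) (by lia)
    have := isIso_of_mono_of_epi ((Ψ.weightAbutment 𝒯 V).α (p + 1) n)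
    rw [← (Ψ.weightAbutment 𝒯 V).α_i (p + 1) p _ rfl] at h₃
    rwa [mono_comp_iff_of_isIso] at h₃

lemma isIso_α' {V : D} {b : ℤ} (hV : t.IsGE V b) {p m : ℤ} (hb : m - p < b) :
    IsIso ((Ψ.weightAbutment 𝒯 V).α' p m) :=
  ExactCouple.Abutment.isIso_α' _ p m (h.mono_weightAbutment_α 𝒯 hV hb)
    (h.epi_weightAbutment_α 𝒯 hV (by lia))

lemma mono_coupleMap_D {T : Triangle D} (hT : T ∈ distTriang D) {b : ℤ} (hb : t.IsLE T.obj₁ b)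
    {p m : ℤ} (hb' : b < m + 1 - p) : Mono ((Ψ.coupleMap 𝒯 T.mor₂).D p m) := by
  rw [coupleMap_D]
  exact mono_map_mor₂ (Ψ.Φ.obj _) hT (h.isZero_weightCouple_D 𝒯 hb hb')

lemma epi_coupleMap_D {T : Triangle D} (hT : T ∈ distTriang D) {b : ℤ} (hb : t.IsLE T.obj₁ b)
    {p m : ℤ} (hb' : b < m + 2 - p) : Epi ((Ψ.coupleMap 𝒯 T.mor₂).D p m) := by
  rw [coupleMap_D]
  exact epi_map_mor₂ (Ψ.Φ.obj _) hT
    (h.isZero_weightCouple_D 𝒯 (t.isLE_shift T.obj₁ b 1 (b - 1) (by ring)) (by lia))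

/-- Truncation can change the `D`-terms of the first couple, but not those of the derived one.
Surjectivity is obstructed by `T.obj₁⟦1⟧`, whose degree is lower by one; this compensates exactly
for testing it at `p + 1` instead of `p`, so both conditions become `b < m + 1 - p`. -/
lemma isIso_coupleMap_derived_D {T : Triangle D} (hT : T ∈ distTriang D) {b : ℤ} (hb : t.IsLE T.obj₁ b)
    {p m : ℤ} (hb' : b < m + 1 - p) : IsIso ((Ψ.coupleMap 𝒯 T.mor₂).derived.D p m) :=
  ExactCouple.Hom.isIso_D' (Ψ.coupleMap 𝒯 T.mor₂) p m (h.mono_coupleMap_D 𝒯 hT hb hb')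
    (h.epi_coupleMap_D 𝒯 hT hb (by lia))

lemma isIso_coupleMap_mor₂_E {T : Triangle D} (hT : T ∈ distTriang D) {b : ℤ}
    (hb : t.IsLE T.obj₁ b) {p n : ℤ} (hb' : b < n - p) : IsIso ((Ψ.coupleMap 𝒯 T.mor₂).E p n) := by
  rw [coupleMap_E]
  exact isIso_map_mor₂ (Ψ.Φ.obj (op ((𝒯.gr p)⟦-n⟧))) hT (h.isZero_weightCouple_E_of_isLE 𝒯 hb hb')
    (h.isZero_weightCouple_E_of_isLE 𝒯 (t.isLE_shift T.obj₁ b 1 (b - 1) (by ring))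
      (p := p) (n := n) (by lia))

lemma isIso_coupleMap_mor₁_E {T : Triangle D} (hT : T ∈ distTriang D) {b : ℤ}
    (hb : t.IsGE T.obj₃ b) {p n : ℤ} (hb' : n - p < b) : IsIso ((Ψ.coupleMap 𝒯 T.mor₁).E p n) := by
  rw [coupleMap_E]
  exact isIso_map_mor₁ (Ψ.Φ.obj (op ((𝒯.gr p)⟦-n⟧))) hT (h.isZero_weightCouple_E_of_isGE 𝒯 hb hb')
    (h.isZero_weightCouple_E_of_isGE 𝒯 (t.isGE_shift T.obj₃ b (-1) (b + 1) (by ring))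
      (p := p) (n := n) (by lia))

/-- The first differential goes from `(p, n)` to `(p + 1, n + 1)`, so the three terms involved share
the value `n - p` and satisfy the same bound. -/
lemma isIso_coupleMap_mor₂_derived_E {T : Triangle D} (hT : T ∈ distTriang D) {b : ℤ}
    (hb : t.IsLE T.obj₁ b) {p n : ℤ} (hb' : b < n - p) :
    IsIso ((Ψ.coupleMap 𝒯 T.mor₂).derived.E p n) :=
  ExactCouple.Hom.isIso_derived_E _ p n (h.isIso_coupleMap_mor₂_E 𝒯 hT hb (by push_cast; lia))
    (h.isIso_coupleMap_mor₂_E 𝒯 hT hb hb') (h.isIso_coupleMap_mor₂_E 𝒯 hT hb (by push_cast; lia))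

lemma isIso_coupleMap_mor₁_derived_E {T : Triangle D} (hT : T ∈ distTriang D) {b : ℤ}
    (hb : t.IsGE T.obj₃ b) {p n : ℤ} (hb' : n - p < b) :
    IsIso ((Ψ.coupleMap 𝒯 T.mor₁).derived.E p n) :=
  ExactCouple.Hom.isIso_derived_E _ p n (h.isIso_coupleMap_mor₁_E 𝒯 hT hb (by push_cast; lia))
    (h.isIso_coupleMap_mor₁_E 𝒯 hT hb hb') (h.isIso_coupleMap_mor₁_E 𝒯 hT hb (by push_cast; lia))

/-- The two derived `D`-terms adjacent to `k` in the exact sequence, at `(p - 1, n - 1)` and `(p,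
n)`, vanish by orthogonality. -/
lemma isIso_derived_k {V : D} {b : ℤ} (hV : t.IsLE V b) {p p' n : ℤ} (hp : p + 1 = p') (hb : b ≤ n - p) :
    IsIso ((Ψ.weightCouple 𝒯 V).derived.k p p' n hp) :=
  ExactCouple.isIso_k (c := (Ψ.weightCouple 𝒯 V).derived) (p₀ := p - 1) (m := n - 1)
    (by push_cast; ring) (by simp) hp
    (ExactCouple.isZero_D' (h.isZero_weightCouple_D 𝒯 hV (by lia)))
    (ExactCouple.isZero_D' (h.isZero_weightCouple_D 𝒯 hV (by lia)))

end Orthogonal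

end Duality

/-! ### Identification of the terms of the derived weight couple. -/

namespace Duality

open Triangulated

variable {C D A : Type*} [Category* C] [Preadditive C] [HasZeroObject C]
  [HasShift C ℤ] [∀ n : ℤ, (shiftFunctor C n).Additive] [Pretriangulated C]
  [Category* D] [Preadditive D] [HasZeroObject D]
  [HasShift D ℤ] [∀ n : ℤ, (shiftFunctor D n).Additive] [Pretriangulated D] [IsTriangulated D]
  [Category* A] [Abelian A]
  {Ψ : Duality C D A} {w : WeightStructure C} {t : TStructure D}
  {X X' : C} {𝒯 : w.Tower X} {𝒯' : w.Tower X'}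

section

variable (Ψ t)

/-- The map `Φ(X⟦-m⟧, V) ⟶ D'^{p,m}` to the derived couple of the weight spectral sequence. -/
def edgeMap (𝒯 : w.Tower X) (V : D) (p m : ℤ) :
    Ψ.obj (X⟦-m⟧) V ⟶ (Ψ.weightCouple 𝒯 V).derived.D p m :=
  (Ψ.weightAbutment 𝒯 V).α' p m

lemma edgeMap_weightCoupleMap {g : X ⟶ X'} (φ : 𝒯.Hom 𝒯' g) {Y Y' : D} (f : Y ⟶ Y') (p m : ℤ) :
    Ψ.edgeMap 𝒯' Y p m ≫ (Ψ.weightCoupleMap φ f).derived.D p m =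
      Ψ.map (g⟦-m⟧') f ≫ Ψ.edgeMap 𝒯 Y' p m :=
  Ψ.α'_weightCoupleMap φ f p m

lemma edgeMap_coupleMap (𝒯 : w.Tower X) {Y Y' : D} (f : Y ⟶ Y') (p m : ℤ) :
    Ψ.edgeMap 𝒯 Y p m ≫ (Ψ.coupleMap 𝒯 f).derived.D p m =
      (Ψ.Φ.obj (op (X⟦-m⟧))).map f ≫ Ψ.edgeMap 𝒯 Y' p m :=
  Ψ.α'_coupleMap 𝒯 f p m

lemma edgeMap_i (𝒯 : w.Tower X) (V : D) (p p' m : ℤ) (hp : p' + 1 = p) :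
    Ψ.edgeMap 𝒯 V p m ≫ (Ψ.weightCouple 𝒯 V).derived.i p p' m hp = Ψ.edgeMap 𝒯 V p' m :=
  (Ψ.weightAbutment 𝒯 V).α'_i p p' m (by exact hp)

/-- The morphism `Y ⟶ t_{≥ b} Y`. -/
def geπ (Y : D) (b : ℤ) : Y ⟶ (t.truncGE b).obj Y := (t.truncGEπ b).app Y

/-- The morphism `t_{≤ b} Y ⟶ Y`. -/
def leι (Y : D) (b : ℤ) : (t.truncLE b).obj Y ⟶ Y := (t.truncLEι b).app Y

lemma geπ_naturality {Y Y' : D} (f : Y ⟶ Y') (b : ℤ) :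
    geπ t Y b ≫ (t.truncGE b).map f = f ≫ geπ t Y' b :=
  t.truncGEπ_naturality b f

lemma leι_naturality {Y Y' : D} (f : Y ⟶ Y') (b : ℤ) :
    leι t Y b ≫ f = (t.truncLE b).map f ≫ leι t Y' b :=
  ((t.truncLEι b).naturality f).symm

lemma geπ_truncI (Y : D) (b b' : ℤ) (h : b + 1 = b') :
    geπ t Y b ≫ truncI t Y b b' h = geπ t Y b' :=
  t.π_natTransTruncGEOfLE_app _ _ _ _

lemma geπ_truncK (Y : D) (q q' : ℤ) (h : q = q') :
    geπ t ((t.truncLE q).obj Y) q ≫ truncK t Y q q' h = leι t Y q ≫ geπ t Y q' := by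
  subst h
  rw [truncK, eqToHom_refl, comp_id]
  exact t.truncGEπ_naturality q _

end

lemma Orthogonal.isIso_edgeMap (h : Ψ.Orthogonal w t) (𝒯 : w.Tower X) {V : D} {b : ℤ}
    (hV : t.IsGE V b) {p m : ℤ} (hb : m - p < b) : IsIso (Ψ.edgeMap 𝒯 V p m) :=
  h.isIso_α' 𝒯 hV hb

section zigzag

/-- The conditions on `U ⟶ Y` and `U ⟶ M` under which the term `E₂^{p,n-p}` of the weight spectral
sequence of `Φ(-, Y)` is identified with `Φ(X⟦-n⟧, M)`. -/
structure IsZigzag (Ψ : Duality C D A) (𝒯 : w.Tower X) {Y U M : D} (u : U ⟶ Y) (v : U ⟶ M)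
    (p n : ℤ) : Prop where
  isIso_u : IsIso ((Ψ.coupleMap 𝒯 u).derived.E p n)
  isIso_v : IsIso ((Ψ.coupleMap 𝒯 v).derived.E p n)
  isIso_k : IsIso ((Ψ.weightCouple 𝒯 M).derived.k p (p + 1) n rfl)
  isIso_edgeMap : IsIso (Ψ.edgeMap 𝒯 M (p + 1) n)

variable {Y U M Y' U' M' : D} {u : U ⟶ Y} {v : U ⟶ M} {u' : U' ⟶ Y'} {v' : U' ⟶ M'} {p n : ℤ}

/-- The identification of the term `E₂^{p,n-p}` of the weight spectral sequence of `Φ(-, Y)` with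
`Φ(X⟦-n⟧, M)`. -/
def IsZigzag.iso (z : IsZigzag Ψ 𝒯 u v p n) :
    (Ψ.weightCouple 𝒯 Y).derived.E p n ≅ Ψ.obj (X⟦-n⟧) M :=
  haveI := z.isIso_u
  haveI := z.isIso_v
  haveI := z.isIso_k
  haveI := z.isIso_edgeMap
  (asIso ((Ψ.coupleMap 𝒯 u).derived.E p n)).symm ≪≫ asIso ((Ψ.coupleMap 𝒯 v).derived.E p n) ≪≫
    asIso ((Ψ.weightCouple 𝒯 M).derived.k p (p + 1) n rfl) ≪≫
    (asIso (Ψ.edgeMap 𝒯 M (p + 1) n)).symm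

lemma IsZigzag.comp_iso_hom (z : IsZigzag Ψ 𝒯 u v p n) :
    (Ψ.coupleMap 𝒯 u).derived.E p n ≫ z.iso.hom ≫ Ψ.edgeMap 𝒯 M (p + 1) n =
      (Ψ.coupleMap 𝒯 v).derived.E p n ≫ (Ψ.weightCouple 𝒯 M).derived.k p (p + 1) n rfl := by
  simp [IsZigzag.iso]

lemma IsZigzag.iso_naturality (z : IsZigzag Ψ 𝒯' u v p n) (z' : IsZigzag Ψ 𝒯 u' v' p n)
    {g : X ⟶ X'} (φ : 𝒯.Hom 𝒯' g) (f : Y ⟶ Y') (fU : U ⟶ U') (fM : M ⟶ M')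
    (hu : u ≫ f = fU ≫ u') (hv : v ≫ fM = fU ≫ v') :
    (Ψ.weightCoupleMap φ f).derived.E p n ≫ z'.iso.hom = z.iso.hom ≫ Ψ.map (g⟦-n⟧') fM := by
  have := z.isIso_u
  have := z'.isIso_edgeMap
  rw [← cancel_epi ((Ψ.coupleMap 𝒯' u).derived.E p n),
    ← cancel_mono (Ψ.edgeMap 𝒯 M' (p + 1) n)]
  have h₁ := Ψ.coupleMap_derived_E_comm φ f fU u u' hu p n
  have h₂ := Ψ.coupleMap_derived_E_comm φ fM fU v v' hv p n
  have h₃ := Ψ.edgeMap_weightCoupleMap φ fM (p + 1) n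
  have h₄ := z.comp_iso_hom
  have h₅ := z'.comp_iso_hom
  have h₆ := (Ψ.weightCoupleMap φ fM).derived.comm_k p (p + 1) n rfl
  calc _ = ((Ψ.coupleMap 𝒯' u).derived.E p n ≫ (Ψ.weightCoupleMap φ f).derived.E p n) ≫
        z'.iso.hom ≫ Ψ.edgeMap 𝒯 M' (p + 1) n := by simp only [assoc]
    _ = (Ψ.weightCoupleMap φ fU).derived.E p n ≫ (Ψ.coupleMap 𝒯 v').derived.E p n ≫
        (Ψ.weightCouple 𝒯 M').derived.k p (p + 1) n rfl := by rw [h₁, assoc, h₅]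
    _ = ((Ψ.coupleMap 𝒯' u).derived.E p n ≫ z.iso.hom ≫ Ψ.edgeMap 𝒯' M (p + 1) n) ≫
        (Ψ.weightCoupleMap φ fM).derived.D (p + 1) n := by
      rw [← assoc, ← h₂, assoc, ← h₆, ← assoc, ← h₄]
    _ = (Ψ.coupleMap 𝒯' u).derived.E p n ≫ z.iso.hom ≫ Ψ.edgeMap 𝒯' M (p + 1) n ≫
        (Ψ.weightCoupleMap φ fM).derived.D (p + 1) n := by simp only [assoc]
    _ = _ := by
      rw [h₃]
      simp only [assoc]

end zigzag

lemma coupleMap_comp (𝒯 : w.Tower X) {Y Y' Y'' : D} (f : Y ⟶ Y') (f' : Y' ⟶ Y'') :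
    Ψ.coupleMap 𝒯 (f ≫ f') = (Ψ.coupleMap 𝒯 f).comp (Ψ.coupleMap 𝒯 f') := by
  refine ExactCouple.Hom.ext' (fun p m => ?_) (fun p n => ?_)
  · simp only [ExactCouple.Hom.comp_D, coupleMap_D]
    exact Functor.map_comp _ _ _
  · simp only [ExactCouple.Hom.comp_E, coupleMap_E]
    exact Functor.map_comp _ _ _

lemma coupleMap_comp_derived_D (𝒯 : w.Tower X) {Y Y' Y'' : D} (f : Y ⟶ Y') (f' : Y' ⟶ Y'')
    (p m : ℤ) : (Ψ.coupleMap 𝒯 (f ≫ f')).derived.D p m =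
      (Ψ.coupleMap 𝒯 f).derived.D p m ≫ (Ψ.coupleMap 𝒯 f').derived.D p m := by
  rw [coupleMap_comp, ExactCouple.Hom.derived_comp]
  rfl

namespace Orthogonal

variable (h : Ψ.Orthogonal w t)
include h

lemma isIso_edgeMap_truncGE (𝒯 : w.Tower X) (Y : D) (p m : ℤ) :
    IsIso (Ψ.edgeMap 𝒯 ((t.truncGE (m + 1 - p)).obj Y) p m) :=
  h.isIso_edgeMap 𝒯 (t.isGE_truncGE_obj Y (m + 1 - p) (m + 1 - p)) (by lia)

lemma isIso_coupleMap_truncGEπ (𝒯 : w.Tower X) (Y : D) (p m : ℤ) :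
    IsIso ((Ψ.coupleMap 𝒯 (geπ t Y (m + 1 - p))).derived.D p m) :=
  h.isIso_coupleMap_derived_D 𝒯 (t.triangleLTGE_distinguished (m + 1 - p) Y)
    (t.isLE_truncLT_obj Y (m + 1 - p) (m - p)) (by lia)

/-- The identification of the `D`-terms of the derived couple of the weight spectral sequence with
the groups `Φ(X⟦-m⟧, t_{≥ m + 1 - p} Y)`. -/
def dIso₀ (𝒯 : w.Tower X) (Y : D) (p m : ℤ) : (Ψ.weightCouple 𝒯 Y).derived.D p m ≅
    Ψ.obj (X⟦-m⟧) ((t.truncGE (m + 1 - p)).obj Y) :=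
  haveI := h.isIso_edgeMap_truncGE 𝒯 Y p m
  haveI := h.isIso_coupleMap_truncGEπ 𝒯 Y p m
  asIso ((Ψ.coupleMap 𝒯 (geπ t Y (m + 1 - p))).derived.D p m) ≪≫
    (asIso (Ψ.edgeMap 𝒯 ((t.truncGE (m + 1 - p)).obj Y) p m)).symm

lemma dIso₀_hom_comp (𝒯 : w.Tower X) (Y : D) (p m : ℤ) :
    (h.dIso₀ 𝒯 Y p m).hom ≫ Ψ.edgeMap 𝒯 ((t.truncGE (m + 1 - p)).obj Y) p m =
      (Ψ.coupleMap 𝒯 (geπ t Y (m + 1 - p))).derived.D p m := by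
  simp [dIso₀]

/-- Naturality of the edge map along `Y ⟶ t_{≥ m+1-p} Y`. It ties the filtration by the tower to the
filtration by truncations. -/
lemma edgeMap_dIso₀_hom (𝒯 : w.Tower X) (Y : D) (p m : ℤ) :
    Ψ.edgeMap 𝒯 Y p m ≫ (h.dIso₀ 𝒯 Y p m).hom =
      (Ψ.Φ.obj (op (X⟦-m⟧))).map (geπ t Y (m + 1 - p)) := by
  have := h.isIso_edgeMap_truncGE 𝒯 Y p m
  have h₁ := Ψ.edgeMap_coupleMap 𝒯 (geπ t Y (m + 1 - p)) p m
  rw [← cancel_mono (Ψ.edgeMap 𝒯 ((t.truncGE (m + 1 - p)).obj Y) p m), assoc,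
    dIso₀_hom_comp]
  exact h₁

lemma dIso₀_naturality {g : X ⟶ X'} (φ : 𝒯.Hom 𝒯' g) {Y Y' : D} (f : Y ⟶ Y') (p m : ℤ) :
    (Ψ.weightCoupleMap φ f).derived.D p m ≫ (h.dIso₀ 𝒯 Y' p m).hom =
      (h.dIso₀ 𝒯' Y p m).hom ≫ Ψ.map (g⟦-m⟧') ((t.truncGE (m + 1 - p)).map f) := by
  have := h.isIso_edgeMap_truncGE 𝒯 Y' p m
  have h₁ := Ψ.coupleMap_derived_D_comm φ ((t.truncGE (m + 1 - p)).map f) f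
    (geπ t Y (m + 1 - p)) (geπ t Y' (m + 1 - p))
    (geπ_naturality t f _) p m
  have h₂ := Ψ.edgeMap_weightCoupleMap φ ((t.truncGE (m + 1 - p)).map f) p m
  rw [← cancel_mono (Ψ.edgeMap 𝒯 ((t.truncGE (m + 1 - p)).obj Y') p m), assoc,
    dIso₀_hom_comp, ← h₁, ← dIso₀_hom_comp, assoc, h₂, assoc]

lemma dIso₀_i (𝒯 : w.Tower X) (Y : D) (p p' m : ℤ) (hp : p' + 1 = p) :
    (Ψ.weightCouple 𝒯 Y).derived.i p p' m hp ≫ (h.dIso₀ 𝒯 Y p' m).hom =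
      (h.dIso₀ 𝒯 Y p m).hom ≫ (Ψ.Φ.obj (op (X⟦-m⟧))).map
        (truncI t Y (m + 1 - p) (m + 1 - p') (by lia)) := by
  have := h.isIso_edgeMap_truncGE 𝒯 Y p' m
  have h₁ : geπ t Y (m + 1 - p) ≫ truncI t Y (m + 1 - p) (m + 1 - p') (by lia) =
      geπ t Y (m + 1 - p') := geπ_truncI t Y _ _ _
  have h₂ := Ψ.edgeMap_coupleMap 𝒯 (truncI t Y (m + 1 - p) (m + 1 - p') (by lia)) p' m
  have h₃ := Ψ.edgeMap_i 𝒯 ((t.truncGE (m + 1 - p)).obj Y) p p' m hp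
  have h₄ := (Ψ.coupleMap 𝒯 (geπ t Y (m + 1 - p))).derived.comm_i p p' m hp
  rw [← cancel_mono (Ψ.edgeMap 𝒯 ((t.truncGE (m + 1 - p')).obj Y) p' m), assoc,
    dIso₀_hom_comp, ← h₁, coupleMap_comp_derived_D, ← assoc, h₄, ← h.dIso₀_hom_comp, assoc, assoc,
    reassoc_of% h₃, h₂, assoc]

/-- Discarding the degrees above `n - p`, and then those below, does not affect the second page at
`(p, n)`. -/
lemma isZigzag_trunc (𝒯 : w.Tower X) (Y : D) (p n : ℤ) :
    IsZigzag Ψ 𝒯 (leι t Y (n - p))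
      (geπ t ((t.truncLE (n - p)).obj Y) (n - p)) p n where
  isIso_u := h.isIso_coupleMap_mor₁_derived_E 𝒯 (t.triangleLTGE_distinguished (n - p + 1) Y)
    (t.isGE_truncGE_obj Y (n - p + 1) (n - p + 1)) (by lia)
  isIso_v := h.isIso_coupleMap_mor₂_derived_E 𝒯
    (t.triangleLTGE_distinguished (n - p) ((t.truncLE (n - p)).obj Y))
    (t.isLE_truncLT_obj _ (n - p) (n - p - 1)) (by lia)
  isIso_k := h.isIso_derived_k 𝒯 (b := n - p) inferInstance rfl le_rfl
  isIso_edgeMap := h.isIso_edgeMap 𝒯 (b := n - p) inferInstance (by lia)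

/-- Both identifications come from truncations, so the square reduces to the equality of the two
composites `t_{≤ q} Y ⟶ t_{≥ q} Y`, one through `Y`, the other through `t_{= q} Y`. -/
lemma trunc_iso_k (𝒯 : w.Tower X) (Y : D) (p p' n : ℤ) (hp : p + 1 = p') :
    (Ψ.weightCouple 𝒯 Y).derived.k p p' n hp ≫ (h.dIso₀ 𝒯 Y p' n).hom =
      (h.isZigzag_trunc 𝒯 Y p n).iso.hom ≫ (Ψ.Φ.obj (op (X⟦-n⟧))).map
        (truncK t Y (n - p) (n + 1 - p') (by lia)) := by
  subst hp
  have := h.isIso_edgeMap_truncGE 𝒯 Y (p + 1) n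
  have := (h.isZigzag_trunc 𝒯 Y p n).isIso_u
  have h₁ := geπ_truncK t Y (n - p) (n + 1 - (p + 1)) (by lia)
  have h₂ := Ψ.edgeMap_coupleMap 𝒯 (truncK t Y (n - p) (n + 1 - (p + 1)) (by lia)) (p + 1) n
  have h₃ := (Ψ.coupleMap 𝒯 (leι t Y (n - p))).derived.comm_k p (p + 1) n rfl
  have h₄ := (Ψ.coupleMap 𝒯
    (geπ t ((t.truncLE (n - p)).obj Y) (n - p))).derived.comm_k p (p + 1) n rfl
  have h₅ := congrArg (fun f => (Ψ.coupleMap 𝒯 f).derived.D (p + 1) n) h₁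
  rw [coupleMap_comp_derived_D, coupleMap_comp_derived_D] at h₅
  have h₆ := (h.isZigzag_trunc 𝒯 Y p n).comp_iso_hom
  rw [← cancel_mono (Ψ.edgeMap 𝒯 ((t.truncGE (n + 1 - (p + 1))).obj Y) (p + 1) n),
    assoc, dIso₀_hom_comp, ← cancel_epi ((Ψ.coupleMap 𝒯 (leι t Y (n - p))).derived.E p n)]
  refine (assoc _ _ _).symm.trans ((congrArg (· ≫ _) h₃.symm).trans ((assoc _ _ _).trans ?_))
  refine (congrArg (_ ≫ ·) h₅.symm).trans ?_
  refine (assoc _ _ _).symm.trans ((congrArg (· ≫ _) h₄).trans ?_)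
  refine (congrArg (· ≫ _) h₆.symm).trans ?_
  simp only [assoc]
  refine congrArg (_ ≫ ·) (congrArg (_ ≫ ·) ?_)
  exact h₂

end Orthogonal

end Duality

/-! ### Comparison of the two couples on all pages. -/

namespace ExactCouple

variable {A : Type*} [Category* A] [Abelian A] {s' : ℕ} {s : ℕ}

/-- A criterion for the compatibility with the images under `j` of the kernels of the iterates
of `i`, using a lift to a further pair of exact couples. -/
lemma exists_j_of_lift {c c₀ : ExactCouple A s} {c' c₀' : ExactCouple A s'} (hs : s = s')
    (f : Hom c₀ c) (f' : Hom c₀' c') {a : ℕ} {p p' p'' m n : ℤ} (hp : p' + 1 = p + s)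
    (hn : m + 1 = n) (hp' : p' + 1 = p'') (E : c.E p' n ⟶ c'.E p' n) (E₀ : c₀.E p' n ⟶ c₀'.E p' n)
    (hE : f.E p' n ≫ E = E₀ ≫ f'.E p' n) (D₀ : c₀.D p'' n ⟶ c₀'.D p'' n)
    (hk : c₀.k p' p'' n hp' ≫ D₀ = E₀ ≫ c₀'.k p' p'' n hp')
    (h₀ : IsZero (c₀'.D (p - a) m)) {Z : A} (x : Z ⟶ c.D p m)
    (hx : ∃ (Z' : A) (π : Z' ⟶ Z) (_ : Epi π) (y : Z' ⟶ c₀.D p m), π ≫ x = y ≫ f.D p m) :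
    ∃ (Z' : A) (π : Z' ⟶ Z) (_ : Epi π) (x' : Z' ⟶ c'.D p m), c'.Killed a p m x' ∧
      π ≫ x ≫ c.j p p' m n hp hn ≫ E = x' ≫ c'.j p p' m n (hs ▸ hp) hn := by
  subst hs
  obtain ⟨Z₁, π₁, hπ₁, y, hy⟩ := hx
  -- Compatibility with `k` alone shows that the transported element is killed by `k`, hence is `j`
  -- of some `z`; the vanishing `h₀` then makes `z` killed by the `a`-th iterate of `i`, whatever
  -- the choice.
  obtain ⟨Z₂, π₂, hπ₂, z, hz⟩ := (c₀'.exact_j_k p p' p'' m n hp hn hp').exact_up_to_refinements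
    (y ≫ c₀.j p p' m n hp hn ≫ E₀) (by
      dsimp
      rw [assoc, assoc, ← hk, ← assoc (c₀.j _ _ _ _ _ _), c₀.j_k, zero_comp, comp_zero])
  dsimp at z hz
  refine ⟨Z₂, π₂ ≫ π₁, inferInstance, z ≫ f'.D p m,
    killed_map (fun p m => f'.D p m) (fun p p' m h => f'.comm_i p p' m h)
      (killed_of_isZero a p m h₀ z), ?_⟩
  rw [assoc, ← assoc π₁, hy, assoc, ← assoc (f.D p m), ← f.comm_j, assoc (c₀.j _ _ _ _ _ _),
    hE, assoc z, ← f'.comm_j, ← assoc z, ← hz]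
  simp only [assoc]

end ExactCouple

namespace Duality

open Triangulated

variable {C D A : Type*} [Category* C] [Preadditive C] [HasZeroObject C]
  [HasShift C ℤ] [∀ n : ℤ, (shiftFunctor C n).Additive] [Pretriangulated C]
  [Category* D] [Preadditive D] [HasZeroObject D]
  [HasShift D ℤ] [∀ n : ℤ, (shiftFunctor D n).Additive] [Pretriangulated D] [IsTriangulated D]
  [Category* A] [Abelian A]

section

variable (Ψ : Duality C D A) (t : TStructure D) (X : C)

/-- The `a`-th iterate of `i` is induced by `t_{≥ b} Y ⟶ t_{≥ b+a} Y`. -/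
lemma tCouple_map_eq_zero_of_killed {Y : D} (a : ℕ) (p p' m : ℤ) (hp : p' + a = p) {Z : A}
    (x : Z ⟶ (Ψ.tCouple t X Y).D p m) (hx : (Ψ.tCouple t X Y).Killed a p m x) :
    x ≫ (Ψ.Φ.obj (op X)).map (((t.natTransTruncGEOfLE (m + 1 - p) (m + 1 - p')
      (by lia)).app Y)⟦m⟧') = 0 := by
  induction a generalizing p with
  | zero => exact (congrArg (· ≫ _) hx).trans zero_comp
  | succ a ih =>
    have h₁ := ih (p' + a) rfl (x ≫ (Ψ.tCouple t X Y).i p (p' + a) m (by push_cast at hp; lia))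
      (hx (p' + a) (by push_cast at hp; lia))
    have h₂ : (t.natTransTruncGEOfLE (m + 1 - p) (m + 1 - (p' + a)) (by lia)).app Y ≫
        (t.natTransTruncGEOfLE (m + 1 - (p' + a)) (m + 1 - p') (by lia)).app Y =
        (t.natTransTruncGEOfLE (m + 1 - p) (m + 1 - p') (by lia)).app Y :=
      t.natTransTruncGEOfLE_trans_app _ _ _ _ _ Y
    rw [← h₂, Functor.map_comp, Functor.map_comp]
    exact (assoc _ _ _).symm.trans h₁

lemma dist_truncGE (Y : D) (b b' : ℤ) (hb : b ≤ b') :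
    ∃ δ, Triangle.mk ((t.truncGE b).map ((t.truncLTι b').app Y))
      ((t.natTransTruncGEOfLE b b' hb).app Y) δ ∈ distTriang D := by
  have hb' : (b : EInt) ≤ (b' : EInt) := by simpa using hb
  refine ⟨((t.triangleω₁δ (b : EInt) (b' : EInt) ⊤ hb' le_top).obj Y).mor₃, ?_⟩
  have h₁ : ((t.triangleω₁δ (b : EInt) (b' : EInt) ⊤ hb' le_top).obj Y).mor₁ =
      (t.truncGE b).map ((t.truncLTι b').app Y) :=
    t.triangleω₁δ_obj_mor₁ _ _ _ hb' le_top Y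
  have h₂ : ((t.triangleω₁δ (b : EInt) (b' : EInt) ⊤ hb' le_top).obj Y).mor₂ =
      (t.natTransTruncGEOfLE b b' hb).app Y :=
    t.triangleω₁δ_obj_mor₂ _ _ _ hb' le_top Y
  rw [← h₁, ← h₂]
  exact t.triangleω₁δ_distinguished _ _ _ hb' le_top Y

lemma tCoupleMap_D_id {Y Y' : D} (f : Y ⟶ Y') (p m : ℤ) :
    (Ψ.tCoupleMap t (𝟙 X) f).D p m =
      (Ψ.Φ.obj (op X)).map (((t.truncGE (m + 1 - p)).map f)⟦m⟧') :=
  (Ψ.map_eq_right X _).symm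

/-- The fibre of `t_{≥ b} Y ⟶ t_{≥ b'} Y` is `t_{≥ b} t_{< b'} Y`, so an element killed by the
`a`-th iterate of `i` comes from the couple of a truncation of `Y`. -/
lemma tCouple_exists_lift {Y : D} (a : ℕ) (p m : ℤ) {Z : A} (x : Z ⟶ (Ψ.tCouple t X Y).D p m)
    (hx : (Ψ.tCouple t X Y).Killed a p m x) :
    ∃ (Z' : A) (π : Z' ⟶ Z) (_ : Epi π)
      (y : Z' ⟶ (Ψ.tCouple t X ((t.truncLT (m + 1 - (p - a))).obj Y)).D p m),
      π ≫ x = y ≫ (Ψ.tCoupleMap t (𝟙 X) ((t.truncLTι (m + 1 - (p - a))).app Y)).D p m := by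
  obtain ⟨δ, hT⟩ := dist_truncGE t Y (m + 1 - p) (m + 1 - (p - a)) (by lia)
  obtain ⟨Z', π, hπ, y, hy⟩ :=
    ((isTriangleStart_shift₂ _ hT m).exact (Ψ.Φ.obj (op X))).exact_up_to_refinements x
      (Ψ.tCouple_map_eq_zero_of_killed t X a p (p - a) m (by lia) x hx)
  refine ⟨Z', π, hπ, y, hy.trans ?_⟩
  rw [tCoupleMap_D_id]
  rfl

lemma isZero_tCouple_D_truncLT (Y : D) (p m : ℤ) :
    IsZero ((Ψ.tCouple t X ((t.truncLT (m + 1 - p)).obj Y)).D p m) :=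
  Functor.map_isZero _ (Functor.map_isZero _
    ((t.isLE_iff_isZero_truncGE_obj (m - p) (m + 1 - p) (by lia) _).1
      (t.isLE_truncLT_obj Y (m + 1 - p) (m - p))))

end

namespace Orthogonal

variable {Ψ : Duality C D A} {w : WeightStructure C} {t : TStructure D}
  {X X' : C} {𝒯 : w.Tower X} {𝒯' : w.Tower X'} (h : Ψ.Orthogonal w t)

/-- The identification of the `D`-terms of the derived couple of the weight spectral sequence with
the `D`-terms of the spectral sequence coming from `t`-truncations. -/
def dIso (𝒯 : w.Tower X) (Y : D) (p m : ℤ) :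
    (Ψ.weightCouple 𝒯 Y).derived.D p m ≅ (Ψ.tCouple t X Y).D p m :=
  h.dIso₀ 𝒯 Y p m ≪≫ Ψ.shiftIso X ((t.truncGE (m + 1 - p)).obj Y) m

/-- The identification of the second page of the weight spectral sequence with the second page of
the spectral sequence coming from `t`-truncations. -/
def eIso (𝒯 : w.Tower X) (Y : D) (p n : ℤ) :
    (Ψ.weightCouple 𝒯 Y).derived.E p n ≅ (Ψ.tCouple t X Y).E p n :=
  (h.isZigzag_trunc 𝒯 Y p n).iso ≪≫ Ψ.shiftIso X ((t.truncGELE (n - p) (n - p)).obj Y) n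

lemma _root_.WeightDuality.Duality.map_shiftIso_hom (Ψ : Duality C D A) (X : C) {Y Y' : D}
    (f : Y ⟶ Y') (n : ℤ) :
    (Ψ.Φ.obj (op (X⟦-n⟧))).map f ≫ (Ψ.shiftIso X Y' n).hom =
      (Ψ.shiftIso X Y n).hom ≫ (Ψ.Φ.obj (op X)).map (f⟦n⟧') := by
  rw [map_eq_right, map_eq_right, ← shiftIso_naturality, CategoryTheory.Functor.map_id]

lemma dIso_i (𝒯 : w.Tower X) (Y : D) (p p' m : ℤ) (hp : p' + 1 = p) :
    (Ψ.weightCouple 𝒯 Y).derived.i p p' m hp ≫ (h.dIso 𝒯 Y p' m).hom =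
      (h.dIso 𝒯 Y p m).hom ≫ (Ψ.tCouple t X Y).i p p' m hp := by
  have : (Ψ.weightCouple 𝒯 Y).derived.i p p' m hp ≫ (h.dIso₀ 𝒯 Y p' m).hom ≫
      (Ψ.shiftIso X _ m).hom = ((h.dIso₀ 𝒯 Y p m).hom ≫ (Ψ.shiftIso X _ m).hom) ≫
        (Ψ.Φ.obj (op X)).map ((truncI t Y (m + 1 - p) (m + 1 - p') (by lia))⟦m⟧') := by
    rw [← assoc, dIso₀_i, assoc, assoc, map_shiftIso_hom]
  exact this

lemma dIso_k (𝒯 : w.Tower X) (Y : D) (p p' n : ℤ) (hp : p + 1 = p') :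
    (Ψ.weightCouple 𝒯 Y).derived.k p p' n hp ≫ (h.dIso 𝒯 Y p' n).hom =
      (h.eIso 𝒯 Y p n).hom ≫ (Ψ.tCouple t X Y).k p p' n hp := by
  have : (Ψ.weightCouple 𝒯 Y).derived.k p p' n hp ≫ (h.dIso₀ 𝒯 Y p' n).hom ≫
      (Ψ.shiftIso X _ n).hom = ((h.isZigzag_trunc 𝒯 Y p n).iso.hom ≫ (Ψ.shiftIso X _ n).hom) ≫
        (Ψ.Φ.obj (op X)).map ((truncK t Y (n - p) (n + 1 - p') (by lia))⟦n⟧') := by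
    rw [← assoc, trunc_iso_k, assoc, assoc, map_shiftIso_hom]
  exact this

lemma dIso_naturality {g : X ⟶ X'} (φ : 𝒯.Hom 𝒯' g) {Y Y' : D} (f : Y ⟶ Y') (p m : ℤ) :
    (Ψ.weightCoupleMap φ f).derived.D p m ≫ (h.dIso 𝒯 Y' p m).hom =
      (h.dIso 𝒯' Y p m).hom ≫ (Ψ.tCoupleMap t g f).D p m := by
  have : (Ψ.weightCoupleMap φ f).derived.D p m ≫ (h.dIso₀ 𝒯 Y' p m).hom ≫
      (Ψ.shiftIso X _ m).hom = ((h.dIso₀ 𝒯' Y p m).hom ≫ (Ψ.shiftIso X' _ m).hom) ≫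
        Ψ.map g (((t.truncGE (m + 1 - p)).map f)⟦m⟧') := by
    rw [← assoc, dIso₀_naturality, assoc, assoc, shiftIso_naturality]
  exact this

lemma eIso_naturality {g : X ⟶ X'} (φ : 𝒯.Hom 𝒯' g) {Y Y' : D} (f : Y ⟶ Y') (p n : ℤ) :
    (Ψ.weightCoupleMap φ f).derived.E p n ≫ (h.eIso 𝒯 Y' p n).hom =
      (h.eIso 𝒯' Y p n).hom ≫ (Ψ.tCoupleMap t g f).E p n := by
  have h₁ := (h.isZigzag_trunc 𝒯' Y p n).iso_naturality (h.isZigzag_trunc 𝒯 Y' p n) φ f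
    ((t.truncLE (n - p)).map f) ((t.truncGELE (n - p) (n - p)).map f)
    (leι_naturality t f _) (geπ_naturality t _ _)
  have : (Ψ.weightCoupleMap φ f).derived.E p n ≫ (h.isZigzag_trunc 𝒯 Y' p n).iso.hom ≫
      (Ψ.shiftIso X _ n).hom = ((h.isZigzag_trunc 𝒯' Y p n).iso.hom ≫ (Ψ.shiftIso X' _ n).hom) ≫
        Ψ.map g (((t.truncGELE (n - p) (n - p)).map f)⟦n⟧') := by
    rw [← assoc]
    refine (congrArg (· ≫ _) h₁).trans ?_
    rw [assoc, assoc]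
    exact congrArg (_ ≫ ·) (Ψ.shiftIso_naturality _ _ _)
  exact this

/-- The comparison of the derived couple of the weight spectral sequence with the couple coming
from `t`-truncations. -/
def kHom (𝒯 : w.Tower X) (Y : D) :
    (Ψ.weightCouple 𝒯 Y).derived.KHom (Ψ.tCouple t X Y : ExactCouple A (1 + 1)) where
  D p m := (h.dIso 𝒯 Y p m).hom
  E p n := (h.eIso 𝒯 Y p n).hom
  comm_i := h.dIso_i 𝒯 Y
  comm_k := h.dIso_k 𝒯 Y
  eq_s := rfl
  exists_j a p p' m n hp hn Z x hx := by
    -- The cut at `m + 1 - (p - a)` serves two purposes: `x` lifts to the truncated couple, and the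
    -- `D`-term of that couple at `p - a` is zero.
    refine ExactCouple.exists_j_of_lift (c' := Ψ.tCouple t X Y) rfl
      (Ψ.coupleMap 𝒯 ((t.truncLTι (m + 1 - (p - a))).app Y)).derived
      (Ψ.tCoupleMap t (𝟙 X) ((t.truncLTι (m + 1 - (p - a))).app Y)) hp hn rfl _
      (h.eIso 𝒯 _ p' n).hom (h.eIso_naturality _ _ p' n) (h.dIso 𝒯 _ _ n).hom
      (h.dIso_k 𝒯 _ p' _ n rfl) (Ψ.isZero_tCouple_D_truncLT t X Y _ m) x ?_
    obtain ⟨Z', π, hπ, y, hy⟩ := Ψ.tCouple_exists_lift t X a p m (x ≫ (h.dIso 𝒯 Y p m).hom)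
      (ExactCouple.killed_map (fun p m => (h.dIso 𝒯 Y p m).hom) (h.dIso_i 𝒯 Y) hx)
    refine ⟨Z', π, hπ, y ≫ (h.dIso 𝒯 _ p m).inv, ?_⟩
    rw [← cancel_mono (h.dIso 𝒯 Y p m).hom, assoc, hy, assoc, assoc]
    exact congrArg (y ≫ ·) ((Iso.eq_inv_comp _).2 (h.dIso_naturality _ _ p m).symm)

/-- The inverse of the comparison of the derived couple of the weight spectral sequence with the
couple coming from `t`-truncations. -/
def kHomInv (𝒯 : w.Tower X) (Y : D) :
    ExactCouple.KHom (Ψ.tCouple t X Y : ExactCouple A (1 + 1)) (Ψ.weightCouple 𝒯 Y).derived where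
  D p m := (h.dIso 𝒯 Y p m).inv
  E p n := (h.eIso 𝒯 Y p n).inv
  comm_i p p' m hp := by
    rw [Iso.eq_inv_comp, ← assoc, Iso.comp_inv_eq]
    exact (h.dIso_i 𝒯 Y p p' m hp).symm
  comm_k p p' m hp := by
    rw [Iso.eq_inv_comp, ← assoc, Iso.comp_inv_eq]
    exact (h.dIso_k 𝒯 Y p p' m hp).symm
  eq_s := rfl
  exists_j a p p' m n hp hn Z x hx := by
    -- The condition on `j` is not inherited by inverses, but the argument by truncation is
    -- symmetric in the two couples.
    refine ExactCouple.exists_j_of_lift (c := Ψ.tCouple t X Y) rfl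
      (Ψ.tCoupleMap t (𝟙 X) ((t.truncLTι (m + 1 - (p - a))).app Y))
      (Ψ.coupleMap 𝒯 ((t.truncLTι (m + 1 - (p - a))).app Y)).derived hp hn rfl _
      (h.eIso 𝒯 _ p' n).inv ?_ (h.dIso 𝒯 _ _ n).inv ?_
      ((Ψ.isZero_tCouple_D_truncLT t X Y _ m).of_iso (h.dIso 𝒯 _ _ m)) x
      (Ψ.tCouple_exists_lift t X a p m x hx)
    · rw [Iso.eq_inv_comp, ← assoc, Iso.comp_inv_eq]
      exact (h.eIso_naturality _ _ p' n).symm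
    · rw [Iso.eq_inv_comp, ← assoc, Iso.comp_inv_eq]
      exact (h.dIso_k 𝒯 _ p' _ n rfl).symm

end Orthogonal

end Duality

/-! ### Filtrations, representing elements and convergence for bounded objects. -/

namespace ExactCouple.Abutment

variable {A : Type*} [Category* A] [Abelian A] {s : ℕ}

/-- Both conditions can be tested in the derived `D`-terms: these inject into the original ones and,
by `F.D`, into the `D`-terms of the second couple. -/
lemma represents_iff {c : ExactCouple A s} {c' : ExactCouple A (s + 1)} (h : c.Abutment)
    (h' : c'.Abutment) (F : KHom c.derived c') (hF : ∀ p m, Mono (F.D p m))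
    (β : ∀ m, h.H m ⟶ h'.H m) (hβ : ∀ p m, h.α' p m ≫ F.D p m = β m ≫ h'.α p m)
    (r₀ : ℤ) (h₀ : ((s + 1 : ℕ) : ℤ) ≤ r₀) (r : ℤ) (hr : r₀ ≤ r) (a : ℤ × ℤ) {Z : A}
    (x : Z ⟶ h.H (a.1 + a.2)) (y : Z ⟶ ((c.spectralSequence r₀ (by lia)).page r hr).X a) :
    h.Represents r₀ (by lia) r hr a x y ↔
      h'.Represents r₀ h₀ r hr a (x ≫ β _) (y ≫ F.ssMap r₀ h₀ r hr a) := by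
  obtain ⟨κ, h₁, h₂⟩ := F.ssMap_pageK r₀ h₀ r hr a
  have h₃ : h.Represents r₀ (by lia) r hr a x y ↔ x ≫ h.α' (a.1 + 1) (a.1 + a.2) = y ≫ κ := by
    dsimp only [Represents]
    rw [h₁, ← h.α'_ι]
    constructor
    · intro h₄
      exact eq_of_comp_ι ((assoc _ _ _).trans (h₄.trans (assoc _ _ _).symm))
    · intro h₄
      exact (assoc _ _ _).symm.trans ((congrArg (· ≫ _) h₄).trans (assoc _ _ _))
  have := hF (a.1 + 1) (a.1 + a.2)
  have h₅ : h'.Represents r₀ h₀ r hr a (x ≫ β _) (y ≫ F.ssMap r₀ h₀ r hr a) ↔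
      (x ≫ h.α' (a.1 + 1) (a.1 + a.2)) ≫ F.D _ _ = (y ≫ κ) ≫ F.D _ _ := by
    dsimp only [Represents]
    rw [assoc, assoc, h₂, assoc, ← hβ]
    exact ⟨fun h => h.trans (assoc _ _ _).symm, fun h => h.trans (assoc _ _ _)⟩
  rw [h₃, h₅]
  exact (cancel_mono (F.D (a.1 + 1) (a.1 + a.2))).symm

end ExactCouple.Abutment

namespace Duality

open Triangulated

variable {C D A : Type*} [Category* C] [Preadditive C] [HasZeroObject C]
  [HasShift C ℤ] [∀ n : ℤ, (shiftFunctor C n).Additive] [Pretriangulated C]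
  [Category* D] [Preadditive D] [HasZeroObject D]
  [HasShift D ℤ] [∀ n : ℤ, (shiftFunctor D n).Additive] [Pretriangulated D] [IsTriangulated D]
  [Category* A] [Abelian A]

section

variable (Ψ : Duality C D A) (t : TStructure D)

lemma truncLEMap_α (X : C) (Y : D) (k m : ℤ) :
    Ψ.truncLEMap t X Y k m ≫ (Ψ.tAbutment t X Y).α (-k) m = 0 := by
  have := t.isGE_shift ((t.truncGE (m + 1 - -k)).obj Y) (m + 1 - -k) m (k + 1) (by lia)
  have h₁ : (t.truncLEι k).app (Y⟦m⟧) ≫ ((t.truncGEπ (m + 1 - -k)).app Y)⟦m⟧' = 0 :=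
    t.zero_of_isLE_of_isGE _ k (k + 1) (by lia) (t.isLE_truncLE_obj (Y⟦m⟧) k k) this
  have h₂ : (Ψ.Φ.obj (op X)).map ((t.truncLEι k).app (Y⟦m⟧)) ≫
      (Ψ.Φ.obj (op X)).map (((t.truncGEπ (m + 1 - -k)).app Y)⟦m⟧') = 0 := by
    rw [← Functor.map_comp, h₁, Functor.map_zero]
  exact h₂

/-- The kernel consists locally of elements coming from `(t_{≤ m+k} Y)[m]`. This object has
`t`-degree `≤ k`, so its map to `Y[m]` factors through `t_{≤ k}(Y[m])`, and the two need not be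
identified. -/
lemma exact_truncLEMap_α (X : C) (Y : D) (k m : ℤ) :
    (ShortComplex.mk _ _ (Ψ.truncLEMap_α t X Y k m)).Exact := by
  rw [ShortComplex.exact_iff_exact_up_to_refinements]
  intro Z x hx
  obtain ⟨Z', π, hπ, y, hy⟩ := ((isTriangleStart_shift₂ _
    (t.triangleLTGE_distinguished (m + 1 - -k) Y) m).exact
      (Ψ.Φ.obj (op X))).exact_up_to_refinements x hx
  have h₁ := t.isLE_truncLT_obj Y (m + 1 - -k) (m + k)
  have h₂ := t.isLE_shift ((t.truncLT (m + 1 - -k)).obj Y) (m + k) m k (by lia)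
  have h₃ := t.liftTruncLT_ι (((t.truncLTι (m + 1 - -k)).app Y)⟦m⟧') k (k + 1) rfl
  refine ⟨Z', π, hπ, y ≫ (Ψ.Φ.obj (op X)).map
    (t.liftTruncLT (((t.truncLTι (m + 1 - -k)).app Y)⟦m⟧') k (k + 1) rfl), hy.trans ?_⟩
  refine Eq.trans ?_ (assoc _ _ _).symm
  refine congrArg (y ≫ ·) (Eq.trans ?_ (Functor.map_comp _ _ _))
  exact congrArg _ h₃.symm

lemma tAbutment_filtration (X : C) (Y : D) (k m : ℤ) :
    (Ψ.tAbutment t X Y).filtration (-k) m = imageSubobject (Ψ.truncLEMap t X Y k m) :=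
  ((ShortComplex.exact_iff_image_eq_kernel _).1 (Ψ.exact_truncLEMap_α t X Y k m)).symm

lemma tAbutment_naturality {X X' : C} (g : X ⟶ X') {Y Y' : D} (f : Y ⟶ Y') (p m : ℤ) :
    (Ψ.tAbutment t X' Y).α p m ≫ (Ψ.tCoupleMap t g f).D p m =
      Ψ.tAbutmentMap t g f m ≫ (Ψ.tAbutment t X Y').α p m := by
  have : (Ψ.Φ.obj (op X')).map ((geπ t Y (m + 1 - p))⟦m⟧') ≫
      Ψ.map g (((t.truncGE (m + 1 - p)).map f)⟦m⟧') =
      Ψ.map g (f⟦m⟧') ≫ (Ψ.Φ.obj (op X)).map ((geπ t Y' (m + 1 - p))⟦m⟧') := by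
    rw [map_right_comp_map, map_comp_map_right, ← Functor.map_comp, ← Functor.map_comp,
      geπ_naturality]
  exact this

end

namespace Orthogonal

variable {Ψ : Duality C D A} {w : WeightStructure C} {t : TStructure D}
  {X X' : C} {𝒯 : w.Tower X} {𝒯' : w.Tower X'} (h : Ψ.Orthogonal w t)

include h

lemma α'_dIso_hom (𝒯 : w.Tower X) (Y : D) (p m : ℤ) :
    (Ψ.weightAbutment 𝒯 Y).α' p m ≫ (h.dIso 𝒯 Y p m).hom =
      (Ψ.abutmentIso t 𝒯 Y m).hom ≫ (Ψ.tAbutment t X Y).α p m := by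
  have : Ψ.edgeMap 𝒯 Y p m ≫ (h.dIso₀ 𝒯 Y p m).hom ≫ (Ψ.shiftIso X _ m).hom =
      (Ψ.shiftIso X Y m).hom ≫ (Ψ.Φ.obj (op X)).map ((geπ t Y (m + 1 - p))⟦m⟧') := by
    rw [← assoc, edgeMap_dIso₀_hom, map_shiftIso_hom]
  exact this

lemma comp_weightAbutment_α_eq_zero_iff (𝒯 : w.Tower X) (Y : D) (p m : ℤ) {Z : A}
    (x : Z ⟶ (Ψ.weightAbutment 𝒯 Y).H m) : x ≫ (Ψ.weightAbutment 𝒯 Y).α p m = 0 ↔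
      (x ≫ (Ψ.abutmentIso t 𝒯 Y m).hom) ≫ (Ψ.tAbutment t X Y).α p m = 0 := by
  rw [assoc, ← h.α'_dIso_hom, ← assoc,
    Preadditive.IsIso.comp_right_eq_zero _ (h.dIso 𝒯 Y p m).hom,
    ← (Ψ.weightAbutment 𝒯 Y).α'_ι p m]
  constructor
  · intro h₁
    exact ExactCouple.Abutment.eq_of_comp_ι ((assoc _ _ _).trans (h₁.trans zero_comp.symm))
  · intro h₁
    exact (assoc _ _ _).symm.trans ((congrArg (· ≫ _) h₁).trans zero_comp)

lemma weightAbutment_filtration (𝒯 : w.Tower X) (Y : D) (k m : ℤ) :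
    (Ψ.weightAbutment 𝒯 Y).filtration (-k) m =
      imageSubobject (Ψ.truncLEMap t X Y k m ≫ (Ψ.abutmentIso t 𝒯 Y m).inv) := by
  have h₁ : (Ψ.truncLEMap t X Y k m ≫ (Ψ.abutmentIso t 𝒯 Y m).inv) ≫
      (Ψ.weightAbutment 𝒯 Y).α (-k) m = 0 := by
    rw [h.comp_weightAbutment_α_eq_zero_iff, assoc, assoc, Iso.inv_hom_id_assoc, truncLEMap_α]
  have h₂ : (ShortComplex.mk _ _ h₁).Exact := by
    rw [ShortComplex.exact_iff_exact_up_to_refinements]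
    intro Z x hx
    obtain ⟨Z', π, hπ, y, hy⟩ := (Ψ.exact_truncLEMap_α t X Y k m).exact_up_to_refinements
      (x ≫ (Ψ.abutmentIso t 𝒯 Y m).hom) ((h.comp_weightAbutment_α_eq_zero_iff 𝒯 Y (-k) m x).1 hx)
    refine ⟨Z', π, hπ, y, ?_⟩
    dsimp at hy ⊢
    rw [← assoc y, ← hy, assoc, assoc, Iso.hom_inv_id, comp_id]
  exact ((ShortComplex.exact_iff_image_eq_kernel _).1 h₂).symm

/-- The isomorphisms between the terms of the weight spectral sequence and of the spectral
sequence coming from `t`-truncations. -/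
def pageIso (𝒯 : w.Tower X) (Y : D) (r : ℤ) (hr : 2 ≤ r) (a : ℤ × ℤ) :
    ((Ψ.T 𝒯 Y).page r hr).X a ≅ ((Ψ.S t X Y).page r hr).X a :=
  ExactCouple.KHom.ssIso (h.kHom 𝒯 Y) (h.kHomInv 𝒯 Y) 2 (by norm_num)
    (fun p n => (h.eIso 𝒯 Y p n).hom_inv_id) (fun p n => (h.eIso 𝒯 Y p n).inv_hom_id) r hr a

lemma pageIso_naturality {g : X ⟶ X'} (φ : 𝒯.Hom 𝒯' g) {Y Y' : D} (f : Y ⟶ Y') (r : ℤ)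
    (hr : 2 ≤ r) (a : ℤ × ℤ) :
    ((Ψ.TMap φ f).hom r hr).f a ≫ (h.pageIso 𝒯 Y' r hr a).hom =
      (h.pageIso 𝒯' Y r hr a).hom ≫ ((Ψ.SMap t g f).hom r hr).f a :=
  ExactCouple.KHom.ssMap_naturality 2 (by norm_num) (h.kHom 𝒯' Y) (h.kHom 𝒯 Y')
    (Ψ.weightCoupleMap φ f) (Ψ.tCoupleMap t g f) (h.eIso_naturality φ f) r hr a

lemma represents_iff (𝒯 : w.Tower X) (Y : D) (r : ℤ) (hr : 2 ≤ r) (a : ℤ × ℤ) {Z : A}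
    (x : Z ⟶ (Ψ.weightAbutment 𝒯 Y).H (a.1 + a.2)) (y : Z ⟶ ((Ψ.T 𝒯 Y).page r hr).X a) :
    (Ψ.weightAbutment 𝒯 Y).Represents 2 (by norm_num) r hr a x y ↔
      (Ψ.tAbutment t X Y).Represents 2 (by norm_num) r hr a
        (x ≫ (Ψ.abutmentIso t 𝒯 Y (a.1 + a.2)).hom) (y ≫ (h.pageIso 𝒯 Y r hr a).hom) :=
  ExactCouple.Abutment.represents_iff (Ψ.weightAbutment 𝒯 Y) (Ψ.tAbutment t X Y) (h.kHom 𝒯 Y)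
    (fun p m => inferInstanceAs (Mono (h.dIso 𝒯 Y p m).hom))
    (fun m => (Ψ.abutmentIso t 𝒯 Y m).hom) (h.α'_dIso_hom 𝒯 Y) 2 (by norm_num) r hr a x y

lemma isZero_tCouple_D {n : ℤ} (hX : w.le n X) (Y : D) (p m : ℤ) (hp : p ≤ -n) :
    IsZero ((Ψ.tCouple t X Y).D p m) :=
  h.isZero_of_le hX (t.isGE_shift ((t.truncGE (m + 1 - p)).obj Y) (m + 1 - p) m (1 - p) (by lia))
    (by lia)

/-- Kernel and cokernel are controlled by `(t_{≤ m-p} Y)[m]` and its shift, of `t`-degrees `≤ -p`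
and `≤ -p - 1`, both below `n`. -/
lemma isIso_tAbutment_α {n : ℤ} (hX : w.ge n X) (Y : D) (p m : ℤ) (hp : 1 - n ≤ p) :
    IsIso ((Ψ.tAbutment t X Y).α p m) := by
  have hT := t.triangleLTGE_distinguished (m + 1 - p) Y
  have h₀ := t.isLE_truncLT_obj Y (m + 1 - p) (m - p)
  have h₁ := isTriangleStart_shift₂ _ hT m
  have h₂ := isTriangleStart_shift₃ _ hT 1 m (m + 1) rfl
  have hm : Mono ((Ψ.tAbutment t X Y).α p m) := (h₁.exact (Ψ.Φ.obj (op X))).mono_g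
    (IsZero.eq_of_src (h.isZero_of_ge hX (t.isLE_shift ((t.truncLT (m + 1 - p)).obj Y) (m - p) m (-p) (by lia)) (by lia)) _ _)
  have he : Epi ((Ψ.tAbutment t X Y).α p m) := (h₂.exact (Ψ.Φ.obj (op X))).epi_f
    (IsZero.eq_of_tgt (h.isZero_of_ge hX
      (t.isLE_shift ((t.truncLT (m + 1 - p)).obj Y) (m - p) (m + 1) (-p - 1) (by lia)) (by lia)) _ _)
  exact isIso_of_mono_of_epi _

/-- Convergence of the spectral sequence coming from `t`-truncations if `X` is bounded. -/
def sConvergence (hX : w.IsBounded X) (Y : D) : Ψ.SConvergence t X Y :=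
  (Ψ.tAbutment t X Y).convergence 2 (by norm_num) (1 - hX.2.choose) (-hX.1.choose)
    (h.isIso_tAbutment_α hX.2.choose_spec Y) (h.isZero_tCouple_D hX.1.choose_spec Y)

lemma sConvergence_naturality (hX : w.IsBounded X) (hX' : w.IsBounded X') {Y Y' : D} (g : X ⟶ X')
    (f : Y ⟶ Y') (r : ℤ) (hr : (h.sConvergence hX Y').r₁ ≤ r)
    (hr' : (h.sConvergence hX' Y).r₁ ≤ r) (a : ℤ × ℤ) {Z : A}
    (x' : Z ⟶ ((Ψ.tAbutment t X' Y).filtration a.1 (a.1 + a.2) : A))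
    (x : Z ⟶ ((Ψ.tAbutment t X Y').filtration a.1 (a.1 + a.2) : A))
    (hx : x' ≫ Subobject.arrow _ ≫ Ψ.tAbutmentMap t g f (a.1 + a.2) = x ≫ Subobject.arrow _) :
    x' ≫ (h.sConvergence hX' Y).edge r hr' a ≫
      ((Ψ.SMap t g f).hom r ((h.sConvergence hX Y').le.trans hr)).f a =
        x ≫ (h.sConvergence hX Y').edge r hr a :=
  (Ψ.tAbutment t X' Y).edge_naturality 2 (by norm_num) (Ψ.tCoupleMap t g f)
    (Ψ.tAbutmentMap t g f) (Ψ.tAbutment_naturality t g f) _ _ r hr' hr a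
    (ExactCouple.Abutment.mono_pageK_of_convergence _ _ _ _ _ _ _ r hr a) x' x hx

end Orthogonal

end Duality

/-! ### Nice dualities: compatibility with `j`. -/

namespace ExactCouple

variable {A : Type*} [Category* A] [Abelian A] {s : ℕ}

/-- The lift `ζ` of `j(x)` is a cycle because `j(x)` is one and `u` is injective on the next term.
Its class computes `j` of the derived couple and, in the other couple, its own image under `k`. -/
lemma exists_derived_lift {c₀ c : ExactCouple A s} (u : Hom c₀ c) {p p' m n : ℤ}
    (hp : p' + 1 = p + (s + 1 : ℕ)) (hn : m + 1 = n) {Z : A} (x : Z ⟶ c.D (p + 1) m)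
    (ζ : Z ⟶ c₀.E p' n) (hζ : ζ ≫ u.E p' n = x ≫ c.j (p + 1) p' m n (by lia) hn)
    (hm : Mono (u.E (p' + s) (n + 1))) : ∃ z : Z ⟶ c₀.derived.E p' n,
      z ≫ u.derived.E p' n = x ≫ c.ε p m ≫ c.derived.j p p' m n hp hn ∧
        ∀ p'' h, (z ≫ c₀.derived.k p' p'' n h) ≫ c₀.ι p'' n = ζ ≫ c₀.k p' p'' n h := by
  have h₀ : ζ ≫ (c₀.scAt p' n).g = 0 := by
    dsimp only
    rw [← cancel_mono (u.E (p' + s) (n + 1)), assoc, u.comm_d, ← assoc, hζ, assoc, j_d, comp_zero,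
      zero_comp]
  refine ⟨(c₀.scAt p' n).liftCycles ζ h₀ ≫ (c₀.scAt p' n).homologyπ, ?_, fun p'' h => ?_⟩
  · change ((c₀.scAt p' n).liftCycles ζ h₀ ≫ (c₀.scAt p' n).homologyπ) ≫
      ShortComplex.homologyMap (u.scAt p' n) = x ≫ c.ε p m ≫ c.j' p p' m n hp hn
    rw [assoc, ShortComplex.homologyπ_naturality, ε_j', ← assoc, ← assoc]
    congr 1
    rw [← cancel_mono (c.scAt p' n).iCycles, assoc, assoc, ShortComplex.cyclesMap_i,
      ShortComplex.liftCycles_i, ← assoc, ShortComplex.liftCycles_i]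
    exact hζ
  · change (((c₀.scAt p' n).liftCycles ζ h₀ ≫ (c₀.scAt p' n).homologyπ) ≫ c₀.k' p' p'' n h) ≫
      c₀.ι p'' n = _
    rw [assoc, k'_ι, assoc, π_kD, ← assoc, ShortComplex.liftCycles_i]

end ExactCouple

namespace Duality

open Triangulated

variable {C D A : Type*} [Category* C] [Preadditive C] [HasZeroObject C]
  [HasShift C ℤ] [∀ n : ℤ, (shiftFunctor C n).Additive] [Pretriangulated C]
  [Category* D] [Preadditive D] [HasZeroObject D]
  [HasShift D ℤ] [∀ n : ℤ, (shiftFunctor D n).Additive] [Pretriangulated D]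
  [Category* A] [Abelian A] {Ψ : Duality C D A}

open Pretriangulated.Opposite in
lemma map_neg_left (Ψ : Duality C D A) {U V : C} (f : U ⟶ V) (Y : D) :
    Ψ.map (-f) (𝟙 Y) = -Ψ.map f (𝟙 Y) := by
  rw [← map_eq_left, ← map_eq_left]
  exact (Ψ.Φ.flip.obj Y).map_neg

lemma IsNice.exists_triple (hΨ : Ψ.IsNice) {S : Triangle C} (hS : S ∈ distTriang C)
    {T : Triangle D} (hT : T ∈ distTriang D) {Z : A} (a : Z ⟶ Ψ.obj S.obj₁ T.obj₁)
    (b : Z ⟶ Ψ.obj S.obj₂ T.obj₂)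
    (hab : a ≫ Ψ.map (𝟙 S.obj₁) T.mor₁ = b ≫ Ψ.map S.mor₁ (𝟙 T.obj₂)) :
    ∃ (Z' : A) (π : Z' ⟶ Z) (_ : Epi π) (c : Z' ⟶ Ψ.obj S.obj₃ T.obj₃),
      π ≫ b ≫ Ψ.map (𝟙 S.obj₂) T.mor₂ = c ≫ Ψ.map S.mor₂ (𝟙 T.obj₃) ∧
        c ≫ Ψ.niceH S T = π ≫ a ≫ Ψ.niceN S T := by
  have := hΨ _ _ hS hT
  have hab' : biprod.lift a b ≫ Ψ.niceRow S T = 0 := by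
    rw [niceRow, biprod.lift_desc, map_eq_left, map_eq_right, Preadditive.comp_neg, hab,
      add_neg_cancel]
  obtain ⟨Z', π, hπ, x, hx⟩ := surjective_up_to_refinements_of_epi
    (Ψ.niceProj S T) (kernel.lift _ (biprod.lift a b) hab')
  let W := x ≫ kernel.ι (Ψ.niceMatrix S T)
  have hx' : π ≫ biprod.lift a b = W ≫ biprod.map (𝟙 _) biprod.fst := by
    have := congrArg (· ≫ kernel.ι _) hx
    simpa [niceProj, W] using this
  have ha : W ≫ biprod.fst = π ≫ a := by
    have := congrArg (· ≫ biprod.fst) hx'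
    simpa using this.symm
  have hb : W ≫ biprod.snd ≫ biprod.fst = π ≫ b := by
    have := congrArg (· ≫ biprod.snd) hx'
    simpa using this.symm
  have hW : W ≫ Ψ.niceMatrix S T = 0 := by simp [W]
  have h₁ : Ψ.niceMatrix S T ≫ biprod.snd ≫ biprod.fst =
      biprod.snd ≫ biprod.fst ≫ Ψ.map (𝟙 _) T.mor₂ -
        biprod.snd ≫ biprod.snd ≫ Ψ.map S.mor₂ (𝟙 _) := by
    rw [niceMatrix, map_eq_left, map_eq_left, map_eq_right, map_eq_right]
    ext <;> simp
  have h₂ : Ψ.niceMatrix S T ≫ biprod.snd ≫ biprod.snd =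
      biprod.snd ≫ biprod.snd ≫ Ψ.niceH S T - biprod.fst ≫ Ψ.niceN S T := by
    rw [niceMatrix]
    ext <;> simp
  have hW₁ := congrArg (W ≫ ·) h₁
  have hW₂ := congrArg (W ≫ ·) h₂
  simp only [reassoc_of% hW, zero_comp, Preadditive.comp_sub, reassoc_of% hb, reassoc_of% ha]
    at hW₁ hW₂
  refine ⟨Z', π, hπ, W ≫ biprod.snd ≫ biprod.snd, ?_, ?_⟩
  · simpa only [assoc] using sub_eq_zero.1 hW₁.symm
  · simpa only [assoc] using sub_eq_zero.1 hW₂.symm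

/-- The isomorphism `V⟦1⟧⟦-1⟧ ≅ V`. -/
def cancelIso (V : C) : V⟦(1 : ℤ)⟧⟦(-1 : ℤ)⟧ ≅ V :=
  (shiftFunctorCompIsoId C (1 : ℤ) (-1) (by simp)).app V

lemma cancelIso_naturality {U V : C} (f : U ⟶ V) :
    f⟦(1 : ℤ)⟧'⟦(-1 : ℤ)⟧' ≫ (cancelIso V).hom = (cancelIso U).hom ≫ f :=
  (shiftFunctorCompIsoId C (1 : ℤ) (-1) (by simp)).hom.naturality f

lemma cancelIso_shift (V : C) : (cancelIso V).hom⟦(1 : ℤ)⟧' =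
    (shiftFunctorCompIsoId C (-1 : ℤ) 1 (by simp)).hom.app (V⟦(1 : ℤ)⟧) :=
  shift_shiftFunctorCompIsoId_hom_app (1 : ℤ) (-1) (by simp) V

/-- The triangle is a twofold rotation, so its third vertex shifted by `-1` is `V₂` up to
`cancelIso`; the sign comes from the rotation. -/
lemma niceN_eq (Ψ : Duality C D A) {V₁ V₂ V₃ : C} (f : V₁ ⟶ V₂) (g : V₂ ⟶ V₃)
    (k : V₃ ⟶ V₁⟦(1 : ℤ)⟧) (T : Triangle D) :
    Ψ.niceN (Triangle.mk k (-f⟦(1 : ℤ)⟧') (-g⟦(1 : ℤ)⟧')) T =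
      -(Ψ.map g (𝟙 T.obj₁) ≫ Ψ.map (cancelIso V₂).hom (𝟙 T.obj₁)) := by
  have h : (-g⟦(1 : ℤ)⟧')⟦(-1 : ℤ)⟧' ≫ (cancelIso V₃).hom = -((cancelIso V₂).hom ≫ g) := by
    rw [Functor.map_neg, Preadditive.neg_comp, cancelIso_naturality]
  refine (Ψ.map_eq_left ((-g⟦(1 : ℤ)⟧')⟦(-1 : ℤ)⟧' ≫ (cancelIso V₃).hom) T.obj₁).trans ?_
  rw [h, map_neg_left, map_map, comp_id]

lemma niceH_eq (Ψ : Duality C D A) {V₁ V₂ V₃ : C} (f : V₁ ⟶ V₂) (g : V₂ ⟶ V₃)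
    (k : V₃ ⟶ V₁⟦(1 : ℤ)⟧) (T : Triangle D) :
    Ψ.niceH (Triangle.mk k (-f⟦(1 : ℤ)⟧') (-g⟦(1 : ℤ)⟧')) T =
      Ψ.map (𝟙 _) T.mor₃ ≫ (Ψ.shiftOne V₂ T.obj₁).inv ≫ Ψ.map (cancelIso V₂).hom (𝟙 T.obj₁) := by
  have h₂ := Ψ.shiftOne_naturality (cancelIso V₂).hom (𝟙 T.obj₁)
  rw [← Iso.eq_comp_inv, assoc, ← Iso.inv_comp_eq] at h₂
  rw [h₂, CategoryTheory.Functor.map_id, cancelIso_shift, ← map_eq_left, ← map_eq_right]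
  rfl

/-- In a nice duality, compatible elements of `Φ(V₃, T₁)` and `Φ(V₁⟦1⟧, T₂)` extend locally to
`Φ(V₂⟦1⟧, T₃)`. -/
lemma IsNice.exists_extension (hΨ : Ψ.IsNice) {V₁ V₂ V₃ : C} (f : V₁ ⟶ V₂) (g : V₂ ⟶ V₃)
    (k : V₃ ⟶ V₁⟦(1 : ℤ)⟧) (hS : Triangle.mk f g k ∈ distTriang C)
    {T : Triangle D} (hT : T ∈ distTriang D) {Z : A} (c : Z ⟶ Ψ.obj V₃ T.obj₁)
    (b : Z ⟶ Ψ.obj (V₁⟦(1 : ℤ)⟧) T.obj₂)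
    (hcb : c ≫ Ψ.map (𝟙 _) T.mor₁ = b ≫ Ψ.map k (𝟙 _)) :
    ∃ (Z' : A) (π : Z' ⟶ Z) (_ : Epi π) (y : Z' ⟶ Ψ.obj (V₂⟦(1 : ℤ)⟧) T.obj₃),
      π ≫ b ≫ Ψ.map (𝟙 _) T.mor₂ = y ≫ Ψ.map (f⟦(1 : ℤ)⟧') (𝟙 _) ∧
        y ≫ Ψ.map (𝟙 _) T.mor₃ =
          π ≫ c ≫ Ψ.map g (𝟙 _) ≫ (Ψ.shiftOne V₂ T.obj₁).hom := by
  -- After two rotations the unknown third component lies over `V₂⟦1⟧`.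
  have hS' : Triangle.mk k (-f⟦(1 : ℤ)⟧') (-g⟦(1 : ℤ)⟧') ∈ distTriang C :=
    rot_of_distTriang _ (rot_of_distTriang _ hS)
  obtain ⟨Z', π, hπ, y, h₁, h₂⟩ := hΨ.exists_triple hS' hT c b hcb
  change Z' ⟶ Ψ.obj (V₂⟦(1 : ℤ)⟧) T.obj₃ at y
  have h₁' : π ≫ b ≫ Ψ.map (𝟙 _) T.mor₂ = y ≫ Ψ.map (-f⟦(1 : ℤ)⟧') (𝟙 _) := h₁
  rw [niceN_eq, niceH_eq] at h₂
  have h₃ : (y ≫ Ψ.map (𝟙 _) T.mor₃ ≫ (Ψ.shiftOne V₂ T.obj₁).inv) ≫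
      Ψ.map (cancelIso V₂).hom (𝟙 T.obj₁) =
      (-(π ≫ c ≫ Ψ.map g (𝟙 T.obj₁))) ≫ Ψ.map (cancelIso V₂).hom (𝟙 T.obj₁) := by
    have h₄ : y ≫ Ψ.map (𝟙 _) T.mor₃ ≫ (Ψ.shiftOne V₂ T.obj₁).inv ≫
        Ψ.map (cancelIso V₂).hom (𝟙 T.obj₁) =
          π ≫ c ≫ (-(Ψ.map g (𝟙 T.obj₁) ≫ Ψ.map (cancelIso V₂).hom (𝟙 T.obj₁))) := h₂
    rw [assoc, assoc, h₄]
    simp only [Preadditive.comp_neg, Preadditive.neg_comp, assoc]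
  rw [cancel_mono, ← assoc y, Iso.comp_inv_eq] at h₃
  -- Changing the sign of `y` absorbs the signs of both rotated morphisms.
  refine ⟨Z', π, hπ, -y, ?_, ?_⟩
  · rw [h₁', map_neg_left, Preadditive.comp_neg, Preadditive.neg_comp]
  · rw [Preadditive.neg_comp]
    refine (congrArg (- ·) h₃).trans ?_
    simp only [Preadditive.neg_comp, neg_neg, assoc]

end Duality

section

variable {C : Type*} [Category* C] [Preadditive C] [HasZeroObject C]
  [HasShift C ℤ] [∀ n : ℤ, (shiftFunctor C n).Additive] [Pretriangulated C]

/-- Shifting a triangle by `a` puts the sign `(-1)^a` on all three morphisms. A sign on the middle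
object clears the first two and leaves the sign on the third, as in `shiftedConn`. -/
lemma shift_distinguished_of_sign {T : Triangle C} (hT : T ∈ distTriang C) (a b : ℤ)
    (h : a + 1 = b) :
    Triangle.mk (T.mor₁⟦a⟧') (T.mor₂⟦a⟧')
      ((a.negOnePow • shiftConn T.mor₃ a b h) ≫ (addIso T.obj₁ a 1 b h).hom) ∈ distTriang C := by
  refine isomorphic_distinguished _ (Triangle.shift_distinguished _ hT a) _
    (Triangle.isoMk _ _ (Iso.refl _) (signIso a.negOnePow _) (Iso.refl _) ?_ ?_ ?_)
  · exact (comp_signIso _ _).trans (id_comp _).symm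
  · refine (comp_id _).trans (Eq.trans ?_ (signIso_comp a.negOnePow
      (a.negOnePow • T.mor₂⟦a⟧')).symm)
    rw [smul_smul, Int.units_mul_self, one_smul]
    rfl
  · have h₁ : (a.negOnePow • shiftConn T.mor₃ a b h) ≫ (addIso T.obj₁ a 1 b h).hom =
        a.negOnePow • T.mor₃⟦a⟧' ≫ (shiftFunctorComm C 1 a).hom.app T.obj₁ := by
      rw [Linear.units_smul_comp]
      exact congrArg (a.negOnePow • ·) (shiftConn_comp T.mor₃ a b h)
    refine Eq.trans ?_ (id_comp _).symm
    refine Eq.trans (congrArg (_ ≫ ·) (CategoryTheory.Functor.map_id _ _)) ?_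
    exact (comp_id _).trans h₁

lemma WeightStructure.Tower.dist_shift {w : WeightStructure C} {X : C} (𝒯 : w.Tower X)
    (p p' m n : ℤ) (hp : p + 1 = p') (hn : m + 1 = n) :
    Triangle.mk ((𝒯.step p p' hp)⟦-n⟧') ((𝒯.proj p p' hp)⟦-n⟧')
      (𝒯.shiftedConn p p m n rfl hn ≫ (addIso (𝒯.Y p) (-n) 1 (-m) (by lia)).hom) ∈
        distTriang C := by
  rw [𝒯.shiftedConn_self, ← Int.negOnePow_neg n]
  exact shift_distinguished_of_sign (𝒯.dist p p' hp) (-n) (-m) (by lia)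

end

namespace Duality

open Triangulated

variable {C D A : Type*} [Category* C] [Preadditive C] [HasZeroObject C]
  [HasShift C ℤ] [∀ n : ℤ, (shiftFunctor C n).Additive] [Pretriangulated C]
  [Category* D] [Preadditive D] [HasZeroObject D]
  [HasShift D ℤ] [∀ n : ℤ, (shiftFunctor D n).Additive] [Pretriangulated D]
  [Category* A] [Abelian A]

/-- The map `Φ(X⟦-m⟧, N) ⟶ Φ(X⟦-m-1⟧, M)` induced by `δ : N ⟶ M⟦1⟧`. -/
def connecting (Ψ : Duality C D A) (X : C) {N M : D} (δ : N ⟶ M⟦(1 : ℤ)⟧) (m n : ℤ)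
    (hn : m + 1 = n) : Ψ.obj (X⟦-m⟧) N ⟶ Ψ.obj (X⟦-n⟧) M :=
  Ψ.map (addIso X (-n) 1 (-m) (by lia)).inv δ ≫ (Ψ.shiftOne (X⟦-n⟧) M).inv

lemma connecting_naturality (Ψ : Duality C D A) {X X' : C} (g : X ⟶ X') {N M : D}
    (δ : N ⟶ M⟦(1 : ℤ)⟧) (m n : ℤ) (hn : m + 1 = n) :
    Ψ.connecting X' δ m n hn ≫ Ψ.map (g⟦-n⟧') (𝟙 M) =
      Ψ.map (g⟦-m⟧') (𝟙 N) ≫ Ψ.connecting X δ m n hn := by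
  have h := Ψ.shiftOne_naturality (g⟦-n⟧') (𝟙 M)
  rw [← Iso.eq_comp_inv, assoc, ← Iso.inv_comp_eq] at h
  rw [connecting, connecting, assoc, h, ← assoc, ← assoc, map_map, map_map,
    ← addIso_inv_naturality, CategoryTheory.Functor.map_id, comp_id, id_comp]

lemma connecting_shiftIso_hom (Ψ : Duality C D A) (X : C) {N M : D} (δ : N ⟶ M⟦(1 : ℤ)⟧) (m n : ℤ)
    (hn : m + 1 = n) :
    Ψ.connecting X δ m n hn ≫ (Ψ.shiftIso X M n).hom =
      (Ψ.shiftIso X N m).hom ≫ Ψ.map (𝟙 X) (shiftConn δ m n hn) := by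
  have h₁ : shiftConn δ m n hn = δ⟦m⟧' ≫ (addIso M 1 m n (by lia)).inv := rfl
  have h₂ := Ψ.shiftIso_naturality (𝟙 X) δ m
  rw [CategoryTheory.Functor.map_id] at h₂
  rw [h₁, Ψ.shiftIso_succ_hom X M m n hn, connecting, assoc, Iso.inv_hom_id_assoc, ← assoc, map_map,
    Iso.hom_inv_id, comp_id, reassoc_of% h₂, map_map, id_comp]

variable {Ψ : Duality C D A} {w : WeightStructure C} {X : C}

/-- The only place where niceness of `Φ` is really used. The connecting morphism of the tower,
lifted by `ζ`, and the truncation morphism `e` form a compatible pair. Niceness extends it to a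
triple, whose third component is forced to be `ξ`; the remaining equation for the triple is the
claim. -/
lemma IsNice.comp_connecting (hΨ : Ψ.IsNice) (𝒯 : w.Tower X) {Y U M P N : D} {κ : M ⟶ P}
    {ι : P ⟶ N} {δ : N ⟶ M⟦(1 : ℤ)⟧} (hT : Triangle.mk κ ι δ ∈ distTriang D) {u : U ⟶ Y}
    {v : U ⟶ M} {e : Y ⟶ P} (hve : v ≫ κ = u ≫ e) {p p' m n : ℤ} (hp : p + 1 = p')
    (hn : m + 1 = n) (hm : Mono (Ψ.map ((𝒯.step p p' hp)⟦-m⟧') (𝟙 N)))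
    {ζ : Ψ.obj ((𝒯.Y p)⟦-m⟧) Y ⟶ Ψ.obj ((𝒯.gr p)⟦-n⟧) U}
    (hζ : ζ ≫ Ψ.map (𝟙 _) u = Ψ.map (𝒯.shiftedConn p p m n rfl hn) (𝟙 Y))
    {ξ : Ψ.obj ((𝒯.Y p)⟦-m⟧) Y ⟶ Ψ.obj (X⟦-m⟧) N}
    (hξ : ξ ≫ Ψ.map ((𝒯.toX p)⟦-m⟧') (𝟙 N) = Ψ.map (𝟙 _) (e ≫ ι)) :
    ξ ≫ Ψ.connecting X δ m n hn ≫ Ψ.map ((𝒯.toX p')⟦-n⟧') (𝟙 M) =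
      ζ ≫ Ψ.map ((𝒯.proj p p' hp)⟦-n⟧') v := by
  obtain ⟨Z', π, hπ, y, h₁, h₂⟩ := hΨ.exists_extension _ _ _ (𝒯.dist_shift p p' m n hp hn) hT
    (ζ ≫ Ψ.map (𝟙 _) v) (Ψ.map (addIso (𝒯.Y p) (-n) 1 (-m) (by lia)).inv e) (by
      have : (ζ ≫ Ψ.map (𝟙 _) v) ≫ Ψ.map (𝟙 _) κ =
          Ψ.map (addIso (𝒯.Y p) (-n) 1 (-m) (by lia)).inv e ≫
            Ψ.map (𝒯.shiftedConn p p m n rfl hn ≫ (addIso (𝒯.Y p) (-n) 1 (-m) (by lia)).hom)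
              (𝟙 P) := by
        rw [map_map, assoc, map_map, hve, ← map_map, reassoc_of% hζ, map_map, assoc,
          Iso.hom_inv_id]
        simp
      exact this)
  change Z' ⟶ Ψ.obj ((𝒯.Y p')⟦-n⟧⟦(1 : ℤ)⟧) N at y
  have h₁' : π ≫ Ψ.map (addIso (𝒯.Y p) (-n) 1 (-m) (by lia)).inv e ≫ Ψ.map (𝟙 _) ι =
    y ≫ Ψ.map ((𝒯.step p p' hp)⟦-n⟧'⟦(1 : ℤ)⟧') (𝟙 N) := h₁
  have h₂' : y ≫ Ψ.map (𝟙 _) δ = π ≫ (ζ ≫ Ψ.map (𝟙 _) v) ≫ Ψ.map ((𝒯.proj p p' hp)⟦-n⟧') (𝟙 M) ≫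
    (Ψ.shiftOne ((𝒯.Y p')⟦-n⟧) M).hom := h₂
  -- The extension `y` exists only locally and is not canonical, but it agrees with `ξ` after
  -- restriction to `Y_p`, and by `hm` this restriction is injective.
  have h₃ : y ≫ Ψ.map (addIso (𝒯.Y p') (-n) 1 (-m) (by lia)).hom (𝟙 N) =
      π ≫ ξ ≫ Ψ.map ((𝒯.toX p')⟦-m⟧') (𝟙 N) := by
    rw [← cancel_mono (Ψ.map ((𝒯.step p p' hp)⟦-m⟧') (𝟙 N))]
    simp only [assoc, map_map, ← Functor.map_comp, 𝒯.step_toX, comp_id]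
    rw [hξ, addIso_naturality]
    have h₄ := h₁' =≫ Ψ.map (addIso (𝒯.Y p) (-n) 1 (-m) (by lia)).hom (𝟙 N)
    simp only [assoc, map_map, comp_id, id_comp, Iso.hom_inv_id] at h₄
    exact h₄.symm
  rw [← cancel_epi π, connecting_naturality, ← assoc ξ, ← assoc π, ← h₃, connecting, assoc,
    ← assoc (Ψ.map _ _) (Ψ.map _ _), map_map, Iso.inv_hom_id, id_comp, ← assoc y, h₂']
  simp only [assoc, Iso.hom_inv_id, comp_id, map_map]

end Duality

namespace Duality

open Triangulated

variable {C D A : Type*} [Category* C] [Preadditive C] [HasZeroObject C]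
  [HasShift C ℤ] [∀ n : ℤ, (shiftFunctor C n).Additive] [Pretriangulated C]
  [Category* D] [Preadditive D] [HasZeroObject D]
  [HasShift D ℤ] [∀ n : ℤ, (shiftFunctor D n).Additive] [Pretriangulated D] [IsTriangulated D]
  [Category* A] [Abelian A]
  {Ψ : Duality C D A} {w : WeightStructure C} {t : TStructure D} {X : C}

/-- The projection `Φ((Y (p + 1))⟦-m⟧, V) ⟶ D'^{p,m}`. -/
def coverMap (Ψ : Duality C D A) (𝒯 : w.Tower X) (V : D) (p m : ℤ) :
    Ψ.obj ((𝒯.Y (p + 1))⟦-m⟧) V ⟶ (Ψ.weightCouple 𝒯 V).derived.D p m :=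
  (Ψ.weightCouple 𝒯 V).ε p m

/-- The inclusion `D'^{p,m} ⟶ Φ((Y p)⟦-m⟧, V)`. -/
def inclMap (Ψ : Duality C D A) (𝒯 : w.Tower X) (V : D) (p m : ℤ) :
    (Ψ.weightCouple 𝒯 V).derived.D p m ⟶ Ψ.obj ((𝒯.Y p)⟦-m⟧) V :=
  (Ψ.weightCouple 𝒯 V).ι p m

instance (𝒯 : w.Tower X) (V : D) (p m : ℤ) : Epi (Ψ.coverMap 𝒯 V p m) :=
  inferInstanceAs (Epi ((Ψ.weightCouple 𝒯 V).ε p m))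

instance (𝒯 : w.Tower X) (V : D) (p m : ℤ) : Mono (Ψ.inclMap 𝒯 V p m) :=
  inferInstanceAs (Mono ((Ψ.weightCouple 𝒯 V).ι p m))

lemma coverMap_inclMap (𝒯 : w.Tower X) (V : D) (p m : ℤ) :
    Ψ.coverMap 𝒯 V p m ≫ Ψ.inclMap 𝒯 V p m = Ψ.map ((𝒯.step p (p + 1) rfl)⟦-m⟧') (𝟙 V) :=
  ((Ψ.weightCouple 𝒯 V).ε_ι p m).trans (Ψ.map_eq_left _ _)

lemma edgeMap_inclMap (𝒯 : w.Tower X) (V : D) (p m : ℤ) :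
    Ψ.edgeMap 𝒯 V p m ≫ Ψ.inclMap 𝒯 V p m = Ψ.map ((𝒯.toX p)⟦-m⟧') (𝟙 V) :=
  ((Ψ.weightAbutment 𝒯 V).α'_ι p m).trans (Ψ.map_eq_left _ _)

lemma coupleMap_derived_D_inclMap (𝒯 : w.Tower X) {V V' : D} (f : V ⟶ V') (p m : ℤ) :
    (Ψ.coupleMap 𝒯 f).derived.D p m ≫ Ψ.inclMap 𝒯 V' p m =
      Ψ.inclMap 𝒯 V p m ≫ Ψ.map (𝟙 _) f :=
  ((Ψ.coupleMap 𝒯 f).D'_ι p m).trans (congrArg (_ ≫ ·)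
    ((Ψ.coupleMap_D 𝒯 _ _ _).trans (Ψ.map_eq_right _ _)))

lemma exists_derived_lift (𝒯 : w.Tower X) {U Y : D} (u : U ⟶ Y) {p p' m n : ℤ}
    (hp : p + 1 + 1 = p + (1 + 1 : ℕ)) (hp' : p + 1 + 1 = p') (hn : m + 1 = n)
    (h₁ : IsIso ((Ψ.coupleMap 𝒯 u).E (p + 1) n))
    (h₂ : IsIso ((Ψ.coupleMap 𝒯 u).E (p + 1 + (1 : ℕ)) (n + 1))) :
    ∃ (ζ : Ψ.obj ((𝒯.Y (p + 1))⟦-m⟧) Y ⟶ Ψ.obj ((𝒯.gr (p + 1))⟦-n⟧) U)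
      (y : Ψ.obj ((𝒯.Y (p + 1))⟦-m⟧) Y ⟶ (Ψ.weightCouple 𝒯 U).derived.E (p + 1) n),
      ζ ≫ Ψ.map (𝟙 _) u = Ψ.map (𝒯.shiftedConn (p + 1) (p + 1) m n rfl hn) (𝟙 Y) ∧
      y ≫ (Ψ.coupleMap 𝒯 u).derived.E (p + 1) n =
        Ψ.coverMap 𝒯 Y p m ≫ (Ψ.weightCouple 𝒯 Y).derived.j p (p + 1) m n hp hn ∧
      (y ≫ (Ψ.weightCouple 𝒯 U).derived.k (p + 1) p' n hp') ≫ Ψ.inclMap 𝒯 U p' n =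
        ζ ≫ Ψ.map ((𝒯.proj (p + 1) p' hp')⟦-n⟧') (𝟙 U) := by
  let ζ := (Ψ.weightCouple 𝒯 Y).j (p + 1) (p + 1) m n (by simp) hn ≫
    inv ((Ψ.coupleMap 𝒯 u).E (p + 1) n)
  have hζ : ζ ≫ (Ψ.coupleMap 𝒯 u).E (p + 1) n =
      (Ψ.weightCouple 𝒯 Y).j (p + 1) (p + 1) m n (by simp) hn := by simp [ζ]
  obtain ⟨y, hy, hy'⟩ := ExactCouple.exists_derived_lift
    (Ψ.coupleMap 𝒯 u) hp hn (𝟙 _) ζ (hζ.trans (id_comp _).symm) inferInstance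
  refine ⟨ζ, y, (congrArg (ζ ≫ ·) ?_).trans (hζ.trans (Ψ.map_eq_left _ _)),
    hy.trans (id_comp _), (hy' p' hp').trans (congrArg (ζ ≫ ·) (Ψ.map_eq_left _ _))⟩
  exact (Ψ.map_eq_right _ _).symm.trans (Ψ.coupleMap_E 𝒯 _ _ _).symm

namespace Orthogonal

variable (h : Ψ.Orthogonal w t) (𝒯 : w.Tower X)

section

include h

/-- In this range `Φ(X[-m], V)` is identified with `Φ(Y_{p+1}[-m], V)` and injects into `Φ(Y_p[-m],
V)`. -/
lemma mono_map_step {V : D} {b : ℤ} (hV : t.IsGE V b) {p p' m : ℤ} (hp : p + 1 = p')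
    (hb : m - p < b) : Mono (Ψ.map ((𝒯.step p p' hp)⟦-m⟧') (𝟙 V)) := by
  have h₁ := h.epi_weightAbutment_α 𝒯 hV (p := p') (m := m) (by lia)
  have h₂ := h.mono_weightAbutment_α 𝒯 hV (p := p') (m := m) (by lia)
  have h₃ := h.mono_weightAbutment_α 𝒯 hV (p := p) (m := m) (by lia)
  have := isIso_of_mono_of_epi ((Ψ.weightAbutment 𝒯 V).α p' m)
  rw [← (Ψ.weightAbutment 𝒯 V).α_i p' p _ hp, mono_comp_iff_of_isIso] at h₃
  rw [← map_eq_left]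
  exact h₃

/-- Supplies the morphism `ξ` for `comp_connecting`; the equality is tested after the injective
restriction to `Y_p`. -/
lemma coverMap_dIso₀_hom (Y : D) (p m : ℤ) :
    (Ψ.coverMap 𝒯 Y p m ≫ (h.dIso₀ 𝒯 Y p m).hom) ≫
        Ψ.map ((𝒯.toX (p + 1))⟦-m⟧') (𝟙 ((t.truncGE (m + 1 - p)).obj Y)) =
      Ψ.map (𝟙 _) (geπ t Y (m + 1 - p)) := by
  have hm := h.mono_map_step 𝒯 (t.isGE_truncGE_obj Y (m + 1 - p) (m + 1 - p)) (p := p)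
    (m := m) rfl (by lia)
  rw [← cancel_mono (Ψ.map ((𝒯.step p (p + 1) rfl)⟦-m⟧') (𝟙 _)), assoc, map_map,
    ← Functor.map_comp, 𝒯.step_toX, comp_id, ← edgeMap_inclMap, assoc, ← assoc (Iso.hom _),
    h.dIso₀_hom_comp, coupleMap_derived_D_inclMap, ← assoc, coverMap_inclMap, map_map, map_map,
    comp_id, id_comp, id_comp, comp_id]

lemma derived_j_iso_hom (hΨ : Ψ.IsNice) (Y : D) (p p' m n : ℤ) (hp : p' + 1 = p + (1 + 1 : ℕ))
    (hn : m + 1 = n) :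
    (Ψ.weightCouple 𝒯 Y).derived.j p p' m n hp hn ≫ (h.isZigzag_trunc 𝒯 Y p' n).iso.hom =
      (h.dIso₀ 𝒯 Y p m).hom ≫ Ψ.connecting X
        (truncδ t Y (n - p') (m + 1 - p) (by push_cast at hp; lia)) m n hn := by
  obtain rfl : p' = p + 1 := by push_cast at hp; lia
  have hu : IsIso ((Ψ.coupleMap 𝒯 (leι t Y (n - (p + 1)))).E (p + 1) n) :=
    h.isIso_coupleMap_mor₁_E 𝒯 (t.triangleLTGE_distinguished (n - (p + 1) + 1) Y)
      (t.isGE_truncGE_obj Y (n - (p + 1) + 1) (n - (p + 1) + 1)) (by lia)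
  have hu' : IsIso ((Ψ.coupleMap 𝒯 (leι t Y (n - (p + 1)))).E (p + 1 + (1 : ℕ)) (n + 1)) :=
    h.isIso_coupleMap_mor₁_E 𝒯 (t.triangleLTGE_distinguished (n - (p + 1) + 1) Y)
      (t.isGE_truncGE_obj Y (n - (p + 1) + 1) (n - (p + 1) + 1)) (by push_cast; lia)
  obtain ⟨ζ, y, hζ, hy, hy'⟩ := exists_derived_lift 𝒯 (leι t Y (n - (p + 1))) (p := p)
    hp rfl hn hu hu'
  -- In `D` the triangle is that of `t_{= q} Y`, `t_{≥ q} Y` and `t_{≥ q+1} Y` with `q = n - (p +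
  -- 1)`; the pair is given by `ζ` and the morphism from `Y` to `t_{≥ q} Y`.
  have h₁ := hΨ.comp_connecting 𝒯
    (dist_trunc t Y (n - (p + 1)) (n - (p + 1)) (m + 1 - p) rfl (by lia) (by lia))
    (geπ_truncK t Y (n - (p + 1)) _ rfl) rfl hn
    (h.mono_map_step 𝒯 (t.isGE_truncGE_obj Y (m + 1 - p) (m + 1 - p)) rfl (by lia)) hζ
    ((h.coverMap_dIso₀_hom 𝒯 Y p m).trans (by rw [geπ_truncI]))
  have h₂ := (h.isZigzag_trunc 𝒯 Y (p + 1) n).comp_iso_hom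
  have h₃ := (Ψ.coupleMap 𝒯 (geπ t ((t.truncLE (n - (p + 1))).obj Y)
    (n - (p + 1)))).derived.comm_k (p + 1) (p + 1 + 1) n rfl
  have := (h.isZigzag_trunc 𝒯 Y (p + 1) n).isIso_edgeMap
  rw [← cancel_epi (Ψ.coverMap 𝒯 Y p m), ← assoc, ← hy,
    ← cancel_mono (Ψ.edgeMap 𝒯 ((t.truncGE (n - (p + 1))).obj ((t.truncLE (n - (p + 1))).obj Y))
      (p + 1 + 1) n), assoc, assoc, h₂, ← h₃, ← cancel_mono (Ψ.inclMap 𝒯 _ _ _)]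
  simp only [assoc]
  rw [coupleMap_derived_D_inclMap, edgeMap_inclMap]
  rw [← assoc y, ← assoc (y ≫ _), hy', assoc, map_map, id_comp, id_comp]
  exact h₁.symm.trans (assoc _ _ _)

end

lemma kHom_commJ (hΨ : Ψ.IsNice) (Y : D) : (h.kHom 𝒯 Y).CommJ := by
  intro p p' m n hp hp' hn
  have : (Ψ.weightCouple 𝒯 Y).derived.j p p' m n hp hn ≫
      (h.isZigzag_trunc 𝒯 Y p' n).iso.hom ≫ (Ψ.shiftIso X _ n).hom =
      ((h.dIso₀ 𝒯 Y p m).hom ≫ (Ψ.shiftIso X _ m).hom) ≫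
        (Ψ.Φ.obj (op X)).map (shiftConn (truncδ t Y (n - p') (m + 1 - p)
          (by push_cast at hp; lia)) m n hn) := by
    rw [← assoc, h.derived_j_iso_hom 𝒯 hΨ, assoc, assoc, map_eq_right]
    exact congrArg (_ ≫ ·) (Ψ.connecting_shiftIso_hom X _ m n hn)
  exact this

lemma kHomInv_commJ (hΨ : Ψ.IsNice) (Y : D) : (h.kHomInv 𝒯 Y).CommJ := by
  intro p p' m n hp hp' hn
  have h₁ := h.kHom_commJ 𝒯 hΨ Y p p' m n hp' hp hn
  refine (Iso.eq_inv_comp (h.dIso 𝒯 Y p m)).2 ?_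
  refine (assoc _ _ _).symm.trans ((Iso.comp_inv_eq (h.eIso 𝒯 Y p' n)).2 ?_)
  exact h₁.symm

/-- In the nice case the comparison is an isomorphism of spectral sequences. -/
def spectralSequenceIso (hΨ : Ψ.IsNice) (Y : D) : Ψ.T 𝒯 Y ≅ Ψ.S t X Y :=
  ExactCouple.KHom.CommJ.spectralSequenceIso 2 (by norm_num) (h.kHom_commJ 𝒯 hΨ Y)
    (h.kHomInv_commJ 𝒯 hΨ Y) (fun p n => (h.eIso 𝒯 Y p n).hom_inv_id)
    (fun p n => (h.eIso 𝒯 Y p n).inv_hom_id)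

lemma spectralSequenceIso_hom_f (hΨ : Ψ.IsNice) (Y : D) (r : ℤ) (hr : 2 ≤ r) (a : ℤ × ℤ) :
    ((h.spectralSequenceIso 𝒯 hΨ Y).hom.hom r hr).f a = (h.pageIso 𝒯 Y r hr a).hom := rfl

end Orthogonal

end Duality

/-! ### The second page in terms of weight complexes. -/

namespace WeightStructure.Tower

variable {C : Type*} [Category* C] [Preadditive C] [HasZeroObject C]
  [HasShift C ℤ] [∀ n : ℤ, (shiftFunctor C n).Additive] [Pretriangulated C]
  {w : WeightStructure C} {X X' : C} (𝒯 : w.Tower X)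

/-- The morphism `(gr a)⟦b⟧ ⟶ (gr (a - 1))⟦b + 1⟧`. -/
def grD (a a' b b' : ℤ) (ha : a' + 1 = a) (hb : b + 1 = b') : (𝒯.gr a)⟦b⟧ ⟶ (𝒯.gr a')⟦b'⟧ :=
  shiftConn (𝒯.grConn a a' ha) b b' hb

/-- Up to the sign carried by `shiftedConn`, the differential of the first page is induced by that
of the weight complex. -/
lemma shiftedConn_proj (p p' p'' n n' : ℤ) (h : p' = p'') (hp : p + 1 = p') (hp' : p + 1 = p'')
    (hn : n + 1 = n') :
    𝒯.shiftedConn p' p'' n n' h hn ≫ (𝒯.proj p p' hp)⟦-n⟧' =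
      n'.negOnePow • 𝒯.grD p'' p (-n') (-n) hp' (by lia) := by
  subst h
  have h₁ := addIso_inv_naturality (𝒯.proj p p' hp) 1 (-n') (-n) (by lia)
  have h₂ : shiftConn (𝒯.conn p') (-n') (-n) (by lia) = (𝒯.conn p')⟦-n'⟧' ≫
    (addIso (𝒯.Y p') 1 (-n') (-n) (by lia)).inv := rfl
  have h₃ : 𝒯.grD p' p (-n') (-n) hp (by lia) = (𝒯.conn p' ≫ (𝒯.proj p p' hp)⟦(1 : ℤ)⟧')⟦-n'⟧' ≫
    (addIso (𝒯.gr p) 1 (-n') (-n) (by lia)).inv := rfl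
  rw [shiftedConn_self, Linear.units_smul_comp, h₂, h₃, assoc, h₁, Functor.map_comp, assoc]

/-- The identification of `(gr a)⟦b⟧` with `(gr a')⟦b'⟧` for `a = a'`, `b = b'`, multiplied
by a sign. -/
def grIso (u : ℤˣ) (a a' b b' : ℤ) (ha : a = a') (hb : b = b') : (𝒯.gr a)⟦b⟧ ≅ (𝒯.gr a')⟦b'⟧ :=
  signIso u _ ≪≫ eqToIso (by rw [ha, hb])

lemma grIso_hom_self (u : ℤˣ) (a b : ℤ) : (𝒯.grIso u a a b b rfl rfl).hom = u • 𝟙 _ := by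
  simp [grIso, signIso]

lemma grIso_hom_grD (u v u' : ℤˣ) (huv : u = v * u') {a c b d a' c' b' d' : ℤ} (ha : a = c)
    (hb : b = d) (ha' : a' = c') (hb' : b' = d') (h₁ : a' + 1 = a) (h₂ : b + 1 = b')
    (h₃ : c' + 1 = c) (h₄ : d + 1 = d') :
    (𝒯.grIso u a c b d ha hb).hom ≫ 𝒯.grD c c' d d' h₃ h₄ =
      (v • 𝒯.grD a a' b b' h₁ h₂) ≫ (𝒯.grIso u' a' c' b' d' ha' hb').hom := by
  subst ha hb ha' hb' huv
  simp [grIso_hom_self, smul_smul, mul_comm]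

lemma Hom.gr_grIso {𝒯 : w.Tower X} {𝒯' : w.Tower X'} {g : X ⟶ X'} (φ : 𝒯.Hom 𝒯' g) (u : ℤˣ)
    {a c b d : ℤ} (ha : a = c) (hb : b = d) :
    (𝒯.grIso u a c b d ha hb).hom ≫ (φ.gr c)⟦d⟧' =
      (φ.gr a)⟦b⟧' ≫ (𝒯'.grIso u a c b d ha hb).hom := by
  subst ha hb
  simp [grIso_hom_self]

end WeightStructure.Tower

namespace Duality

open Triangulated

variable {C D A : Type*} [Category* C] [Preadditive C] [HasZeroObject C]
  [HasShift C ℤ] [∀ n : ℤ, (shiftFunctor C n).Additive] [Pretriangulated C]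
  [Category* D] [Preadditive D] [HasZeroObject D]
  [HasShift D ℤ] [∀ n : ℤ, (shiftFunctor D n).Additive] [Pretriangulated D] [IsTriangulated D]
  [Category* A] [Abelian A]
  {Ψ : Duality C D A} {w : WeightStructure C} {t : TStructure D} {X X' : C}

lemma weightCouple_d (𝒯 : w.Tower X) (V : D) (p p' n n' : ℤ) (hp : p + (1 : ℕ) = p')
    (hn : n + 1 = n') :
    (Ψ.weightCouple 𝒯 V).d p p' n n' hp hn =
      Ψ.map (n'.negOnePow • 𝒯.grD p' p (-n') (-n) (by exact_mod_cast hp) (by lia)) (𝟙 V) := by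
  have h₁ : (Ψ.weightCouple 𝒯 V).d p p' n n' hp hn =
      Ψ.map ((𝒯.proj p (p + 1) rfl)⟦-n⟧') (𝟙 V) ≫
        Ψ.map (𝒯.shiftedConn (p + 1) p' n n' (by exact_mod_cast hp) hn) (𝟙 V) := by
    rw [← map_eq_left, ← map_eq_left]
    rfl
  rw [h₁, map_map, comp_id, 𝒯.shiftedConn_proj]

/-- The complex `Φ(X^{1-j}, V) ⟶ Φ(X^{-j}, V) ⟶ Φ(X^{-1-j}, V)` is isomorphic to a part of the
first page of the weight spectral sequence. -/
def weightScIso (Ψ : Duality C D A) (𝒯 : w.Tower X) (V : D) (j : ℤ) :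
    Ψ.weightSc 𝒯 V j ≅ (Ψ.weightCouple 𝒯 V).scAt j j :=
  ShortComplex.isoMk
    -- The two differentials of the first page carry the signs `(-1)^j` and `(-1)^{j+1}`; the outer
    -- components absorb them and the middle one has none.
    (Ψ.mapIso (𝒯.grIso j.negOnePow (j - (1 : ℕ)) (-(1 - j)) (-(j - 1)) (1 - j) (by simp) (by simp))
      (Iso.refl V))
    (Ψ.mapIso (𝒯.grIso 1 j (-(-j)) (-j) (-j) (by simp) rfl) (Iso.refl V))
    (Ψ.mapIso (𝒯.grIso (j + 1).negOnePow (j + (1 : ℕ)) (-(-1 - j)) (-(j + 1)) (-1 - j)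
      (by push_cast; lia) (by lia)) (Iso.refl V))
    (by
      have h₁ : (Ψ.weightSc 𝒯 V j).f =
          Ψ.map (𝒯.grD (-(-j)) (-(1 - j)) (-j) (1 - j) (by lia) (by lia)) (𝟙 V) := by
        rw [← map_eq_left]
        exact congrArg (fun f => (Ψ.Φ.map f.op).app V) (𝒯.weightComplex_d (-j) (1 - j) (by lia))
      have h₂ := 𝒯.grIso_hom_grD 1 j.negOnePow j.negOnePow (by simp) (a := j) (c := -(-j))
        (b := -j) (d := -j) (a' := j - (1 : ℕ)) (c' := -(1 - j)) (b' := -(j - 1)) (d' := 1 - j)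
        (by simp) rfl (by simp) (by simp) (by simp) (by lia) (by lia) (by lia)
      have : Ψ.map (𝒯.grIso j.negOnePow (j - (1 : ℕ)) (-(1 - j)) (-(j - 1)) (1 - j)
          (by simp) (by simp)).hom (𝟙 V) ≫ Ψ.map (j.negOnePow • 𝒯.grD j (j - (1 : ℕ)) (-j) (-(j - 1))
            (by simp) (by lia)) (𝟙 V) =
          Ψ.map (𝒯.grD (-(-j)) (-(1 - j)) (-j) (1 - j) (by lia) (by lia)) (𝟙 V) ≫
            Ψ.map (𝒯.grIso 1 j (-(-j)) (-j) (-j) (by simp) rfl).hom (𝟙 V) := by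
        rw [map_map, map_map, h₂]
      exact (congrArg (_ ≫ ·) (weightCouple_d 𝒯 V (j - (1 : ℕ)) j (j - 1) j (by simp) (by simp))).trans
        (this.trans (congrArg (· ≫ _) h₁.symm)))
    (by
      have h₁ : (Ψ.weightSc 𝒯 V j).g =
          Ψ.map (𝒯.grD (-(-1 - j)) (-(-j)) (-1 - j) (-j) (by lia) (by lia)) (𝟙 V) := by
        rw [← map_eq_left]
        exact congrArg (fun f => (Ψ.Φ.map f.op).app V) (𝒯.weightComplex_d (-1 - j) (-j) (by lia))
      have h₂ := 𝒯.grIso_hom_grD (j + 1).negOnePow (j + 1).negOnePow 1 (by simp) (a := j + (1 : ℕ))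
        (c := -(-1 - j)) (b := -(j + 1)) (d := -1 - j) (a' := j) (c' := -(-j)) (b' := -j)
        (d' := -j) (by push_cast; lia) (by lia) (by simp) rfl (by simp) (by lia) (by lia) (by lia)
      have : Ψ.map (𝒯.grIso 1 j (-(-j)) (-j) (-j) (by simp) rfl).hom (𝟙 V) ≫
          Ψ.map ((j + 1).negOnePow • 𝒯.grD (j + (1 : ℕ)) j (-(j + 1)) (-j)
            (by simp) (by lia)) (𝟙 V) =
          Ψ.map (𝒯.grD (-(-1 - j)) (-(-j)) (-1 - j) (-j) (by lia) (by lia)) (𝟙 V) ≫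
            Ψ.map (𝒯.grIso (j + 1).negOnePow (j + (1 : ℕ)) (-(-1 - j)) (-(j + 1)) (-1 - j)
              (by push_cast; lia) (by lia)).hom (𝟙 V) := by
        rw [map_map, map_map, h₂]
      exact (congrArg (_ ≫ ·) (weightCouple_d 𝒯 V j (j + (1 : ℕ)) j (j + 1) rfl rfl)).trans
        (this.trans (congrArg (· ≫ _) h₁.symm)))

lemma map_grIso_naturality {𝒯 : w.Tower X} {𝒯' : w.Tower X'} {g : X ⟶ X'} (φ : 𝒯.Hom 𝒯' g)
    {V V' : D} (f : V ⟶ V') (u : ℤˣ) {a c b d : ℤ} (ha : a = c) (hb : b = d) :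
    Ψ.map ((φ.gr c)⟦d⟧') f ≫ Ψ.map (𝒯.grIso u a c b d ha hb).hom (𝟙 V') =
      Ψ.map (𝒯'.grIso u a c b d ha hb).hom (𝟙 V) ≫ Ψ.map ((φ.gr a)⟦b⟧') f := by
  rw [map_map, map_map, φ.gr_grIso, comp_id, id_comp]

lemma weightScIso_naturality {𝒯 : w.Tower X} {𝒯' : w.Tower X'} {g : X ⟶ X'} (φ : 𝒯.Hom 𝒯' g)
    {V V' : D} (f : V ⟶ V') (j : ℤ) :
    Ψ.weightScMap φ f j ≫ (Ψ.weightScIso 𝒯 V' j).hom =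
      (Ψ.weightScIso 𝒯' V j).hom ≫ (Ψ.weightCoupleMap φ f).scAt j j := by
  ext
  · exact (map_grIso_naturality φ f _ _ _).trans
      (congrArg (_ ≫ ·) (Ψ.weightCoupleMap_E φ f _ _).symm)
  · exact (map_grIso_naturality φ f _ _ _).trans
      (congrArg (_ ≫ ·) (Ψ.weightCoupleMap_E φ f _ _).symm)
  · exact (map_grIso_naturality φ f _ _ _).trans
      (congrArg (_ ≫ ·) (Ψ.weightCoupleMap_E φ f _ _).symm)

namespace Orthogonal

variable (h : Ψ.Orthogonal w t)

include h in
-- At `(j, j)` only `t`-degree `0` of `Y[i]` is seen, which is `(t_{= i} Y)[i]`. Shifted truncation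
-- triangles of `Y` replace truncations of `Y[i]`, so that the desired object appears directly.
lemma isZigzag_shift (𝒯 : w.Tower X) (Y : D) (i j : ℤ) :
    IsZigzag Ψ 𝒯 ((leι t Y i)⟦i⟧') ((geπ t ((t.truncLE i).obj Y) i)⟦i⟧') j j where
  isIso_u := h.isIso_coupleMap_mor₁_derived_E 𝒯
    (shift_distinguished_of_sign (t.triangleLTGE_distinguished (i + 1) Y) i (i + 1) rfl)
    (t.isGE_shift ((t.truncGE (i + 1)).obj Y) (i + 1) i 1 (by lia)) (by lia)
  isIso_v := by
    have := t.isLE_truncLT_obj ((t.truncLE i).obj Y) i (i - 1)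
    exact h.isIso_coupleMap_mor₂_derived_E 𝒯
      (shift_distinguished_of_sign
        (t.triangleLTGE_distinguished i ((t.truncLE i).obj Y)) i (i + 1) rfl)
      (t.isLE_shift ((t.truncLT i).obj ((t.truncLE i).obj Y)) (i - 1) i (-1) (by lia)) (by lia)
  isIso_k := h.isIso_derived_k 𝒯
    (t.isLE_shift ((t.truncGE i).obj ((t.truncLE i).obj Y)) i i 0 (by lia)) rfl (by lia)
  isIso_edgeMap := h.isIso_edgeMap 𝒯
    (t.isGE_shift ((t.truncGE i).obj ((t.truncLE i).obj Y)) i i 0 (by lia)) (by lia)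

/-- The homology of the complex `Φ(X^{-*}, Y⟦i⟧)` attached to a weight complex `X^*` is
`Φ(X, (t_{= i} Y)⟦i⟧⟦j⟧)`. -/
def weightScHomologyIso (𝒯 : w.Tower X) (Y : D) (i j : ℤ) :
    (Ψ.weightSc 𝒯 (Y⟦i⟧) j).homology ≅ Ψ.obj X ((((t.truncGELE i i).obj Y)⟦i⟧)⟦j⟧) :=
  ShortComplex.homologyMapIso (Ψ.weightScIso 𝒯 (Y⟦i⟧) j) ≪≫ (h.isZigzag_shift 𝒯 Y i j).iso ≪≫
    Ψ.shiftIso X (((t.truncGELE i i).obj Y)⟦i⟧) j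

lemma weightScHomologyIso_naturality {𝒯 : w.Tower X} {𝒯' : w.Tower X'} {g : X ⟶ X'}
    (φ : 𝒯.Hom 𝒯' g) {Y Y' : D} (f : Y ⟶ Y') (i j : ℤ) :
    ShortComplex.homologyMap (Ψ.weightScMap φ (f⟦i⟧') j) ≫ (h.weightScHomologyIso 𝒯 Y' i j).hom =
      (h.weightScHomologyIso 𝒯' Y i j).hom ≫
        Ψ.map g ((((t.truncGELE i i).map f)⟦i⟧')⟦j⟧') := by
  have h₁ : ShortComplex.homologyMap (Ψ.weightScMap φ (f⟦i⟧') j) ≫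
      ShortComplex.homologyMap (Ψ.weightScIso 𝒯 (Y'⟦i⟧) j).hom =
      ShortComplex.homologyMap (Ψ.weightScIso 𝒯' (Y⟦i⟧) j).hom ≫
        ShortComplex.homologyMap ((Ψ.weightCoupleMap φ (f⟦i⟧')).scAt j j) := by
    rw [← ShortComplex.homologyMap_comp, ← ShortComplex.homologyMap_comp, weightScIso_naturality]
  have h₂ := (h.isZigzag_shift 𝒯' Y i j).iso_naturality (h.isZigzag_shift 𝒯 Y' i j) φ (f⟦i⟧')
    (((t.truncLE i).map f)⟦i⟧') (((t.truncGELE i i).map f)⟦i⟧')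
    (by rw [← Functor.map_comp, ← Functor.map_comp, leι_naturality])
    ((Functor.map_comp _ _ _).symm.trans ((congrArg (fun k => k⟦i⟧') (geπ_naturality t _ _)).trans
      (Functor.map_comp _ _ _)))
  have h₃ := Ψ.shiftIso_naturality g (((t.truncGELE i i).map f)⟦i⟧') j
  refine ((assoc _ _ _).symm.trans (congrArg (· ≫ _) h₁)).trans ?_
  refine (assoc _ _ _).trans (Eq.trans ?_ (assoc _ _ _).symm)
  refine congrArg (_ ≫ ·) (((assoc _ _ _).symm.trans (congrArg (· ≫ _) h₂)).trans ?_)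
  exact (assoc _ _ _).trans ((congrArg (_ ≫ ·) h₃).trans (assoc _ _ _).symm)

end Orthogonal

end Duality

end WeightDuality

end

/-! ### Assembly of the theorem. -/

theorem theorem2p5p1 {C D A : Type*}
    [Category* C] [Preadditive C] [HasZeroObject C] [HasShift C ℤ]
    [∀ n : ℤ, (shiftFunctor C n).Additive] [Pretriangulated C] [IsTriangulated C]
    [Category* D] [Preadditive D] [HasZeroObject D] [HasShift D ℤ]
    [∀ n : ℤ, (shiftFunctor D n).Additive] [Pretriangulated D] [IsTriangulated D]
    [Category* A] [Abelian A]
    (w : WeightStructure C) (t : TStructure D) (Ψ : Duality C D A)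
    (hort : Ψ.Orthogonal w t) :
    -- weight Postnikov towers exist and are weakly functorial
    ((∀ X : C, Nonempty (w.Tower X)) ∧
      ∀ (X X' : C) (g : X ⟶ X') (𝒯 : w.Tower X) (𝒯' : w.Tower X'), Nonempty (𝒯.Hom 𝒯' g)) ∧
    -- `S` converges naturally to `Φ(X, Y⟦p + q⟧)` if `X` is bounded
    (∃ conv : ∀ (X : C) (_ : w.IsBounded X) (Y : D), Ψ.SConvergence t X Y,
      ∀ (X X' : C) (hX : w.IsBounded X) (hX' : w.IsBounded X') (Y Y' : D) (g : X ⟶ X')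
        (f : Y ⟶ Y') (r : ℤ) (hr : (conv X hX Y').r₁ ≤ r) (hr' : (conv X' hX' Y).r₁ ≤ r)
        (a : ℤ × ℤ) (Z : A)
        (x' : Z ⟶ ((Ψ.tAbutment t X' Y).filtration a.1 (a.1 + a.2) : A))
        (x : Z ⟶ ((Ψ.tAbutment t X Y').filtration a.1 (a.1 + a.2) : A)),
        x' ≫ Subobject.arrow _ ≫ Ψ.tAbutmentMap t g f (a.1 + a.2) = x ≫ Subobject.arrow _ →
        x' ≫ (conv X' hX' Y).edge r hr' a ≫
          ((Ψ.SMap t g f).hom r ((conv X hX Y').le.trans hr)).f a =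
            x ≫ (conv X hX Y').edge r hr a) ∧
    -- the terms of `T` and `S` are naturally isomorphic from the second page on
    (∃ e : ∀ (X : C) (𝒯 : w.Tower X) (Y : D) (r : ℤ) (hr : 2 ≤ r) (a : ℤ × ℤ),
        ((Ψ.T 𝒯 Y).page r hr).X a ≅ ((Ψ.S t X Y).page r hr).X a,
      (∀ (X X' : C) (g : X ⟶ X') (𝒯 : w.Tower X) (𝒯' : w.Tower X') (φ : 𝒯.Hom 𝒯' g)
        (Y Y' : D) (f : Y ⟶ Y') (r : ℤ) (hr : 2 ≤ r) (a : ℤ × ℤ),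
        ((Ψ.TMap φ f).hom r hr).f a ≫ (e X 𝒯 Y' r hr a).hom =
          (e X' 𝒯' Y r hr a).hom ≫ ((Ψ.SMap t g f).hom r hr).f a) ∧
      -- the filtrations of the abutments are given by the `t`-truncations of `Y⟦m⟧`
      (∀ (X : C) (𝒯 : w.Tower X) (Y : D) (k m : ℤ),
        (Ψ.weightAbutment 𝒯 Y).filtration (-k) m =
          imageSubobject (Ψ.truncLEMap t X Y k m ≫ (Ψ.abutmentIso t 𝒯 Y m).inv) ∧
        (Ψ.tAbutment t X Y).filtration (-k) m = imageSubobject (Ψ.truncLEMap t X Y k m)) ∧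
      -- compatibility of the isomorphisms with the filtrations
      (∀ (X : C) (𝒯 : w.Tower X) (Y : D) (r : ℤ) (hr : 2 ≤ r) (a : ℤ × ℤ) (Z : A)
        (x : Z ⟶ (Ψ.weightAbutment 𝒯 Y).H (a.1 + a.2))
        (y : Z ⟶ ((Ψ.T 𝒯 Y).page r hr).X a),
        (Ψ.weightAbutment 𝒯 Y).Represents 2 (by norm_num) r hr a x y ↔
          (Ψ.tAbutment t X Y).Represents 2 (by norm_num) r hr a
            (x ≫ (Ψ.abutmentIso t 𝒯 Y (a.1 + a.2)).hom) (y ≫ (e X 𝒯 Y r hr a).hom)) ∧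
      -- if the duality is nice, then these isomorphisms form an isomorphism of `T` with `S`
      (Ψ.IsNice → ∀ (X : C) (𝒯 : w.Tower X) (Y : D),
        ∃ ε : Ψ.T 𝒯 Y ≅ Ψ.S t X Y, ∀ (r : ℤ) (hr : 2 ≤ r) (a : ℤ × ℤ),
          (ε.hom.hom r hr).f a = (e X 𝒯 Y r hr a).hom)) ∧
    -- the computation of the terms of the second page in terms of weight complexes
    (∃ c : ∀ (X : C) (𝒯 : w.Tower X) (Y : D) (i j : ℤ),
        Ψ.obj X ((((t.truncGELE i i).obj Y)⟦i⟧)⟦j⟧) ≅ (Ψ.weightSc 𝒯 (Y⟦i⟧) j).homology,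
      ∀ (X X' : C) (g : X ⟶ X') (𝒯 : w.Tower X) (𝒯' : w.Tower X') (φ : 𝒯.Hom 𝒯' g)
        (Y Y' : D) (f : Y ⟶ Y') (i j : ℤ),
        Ψ.map g ((((t.truncGELE i i).map f)⟦i⟧')⟦j⟧') ≫ (c X 𝒯 Y' i j).hom =
          (c X' 𝒯' Y i j).hom ≫ ShortComplex.homologyMap (Ψ.weightScMap φ (f⟦i⟧') j)) := by
  refine ⟨⟨WeightStructure.Tower.nonempty w, fun X X' g 𝒯 𝒯' =>
      WeightStructure.Tower.Hom.nonempty 𝒯 𝒯' g⟩,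
    ⟨fun X hX Y => hort.sConvergence hX Y, fun X X' hX hX' Y Y' g f r hr hr' a Z x' x hx =>
      hort.sConvergence_naturality hX hX' g f r hr hr' a x' x hx⟩,
    ⟨fun X 𝒯 Y => hort.pageIso 𝒯 Y, fun X X' g 𝒯 𝒯' φ Y Y' f => hort.pageIso_naturality φ f,
      fun X 𝒯 Y k m => ⟨hort.weightAbutment_filtration 𝒯 Y k m, Ψ.tAbutment_filtration t X Y k m⟩,
      fun X 𝒯 Y r hr a Z x y => hort.represents_iff 𝒯 Y r hr a x y,
      fun hΨ X 𝒯 Y => ⟨hort.spectralSequenceIso 𝒯 hΨ Y, hort.spectralSequenceIso_hom_f 𝒯 hΨ Y⟩⟩,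
    ⟨fun X 𝒯 Y i j => (hort.weightScHomologyIso 𝒯 Y i j).symm,
      fun X X' g 𝒯 𝒯' φ Y Y' f i j => ?_⟩⟩
  rw [Iso.symm_hom, Iso.symm_hom, Iso.comp_inv_eq, assoc,
    hort.weightScHomologyIso_naturality φ f i j, Iso.inv_hom_id_assoc]
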